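/- Let $N\ge 3$, let $g_{\alpha\beta}\in\mathbb{R}$ ($1\le\alpha\ne\beta\le N$) with $g_{\alpha\beta}\neq 0$ for $\alpha<\beta$, and let $x_1,\dots,x_N\in\mathbb{C}$. Let $\mathcal{D}$ be the $\mathbb{C}$-algebra generated by $D_1,\dots,D_N$ subject to $$g_{\alpha\beta}D_\alpha D_\beta-g_{\beta\alpha}D_\beta D_\alpha=x_\beta D_\alpha-x_\alpha D_\beta\qquad(\alpha<\beta),$$ and assume that $\mathcal{D}$ is a diffusion algebra, i.e. that the ordered monomials $D_N^{k_N}\cdots D_2^{k_2}D_1^{k_1}$ ($k_j\in\mathbb{N}$) form a $\mathbb{C}$-basis of $\mathcal{D}$. Put $I=\{\alpha: x_\alpha\ne0\}$ and $R=\{\alpha: x_\alpha=0\}$. Let $R_1,\dots,R_M$ be the connected components of the graph on $R$ in which $r\neq s$ are joined if $g_{rs}g_{sr}\ne0$, and let $S$ be the union of those $R_a$ for which there are $r\in R_a$ and $i\in I$ with $g_{ir}g_{ri}\neq0$. **Theorem.** Suppose that one of the following holds: (i) $|I|=L$ and $|S|=N-L$ for some $3\le L\le N$; (ii) $I=\{\mathbf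 i\}$, $|S|=N-1$, and there is $\mathcal{G}\neq 0$ such that $g_{\mathbf i s}=\mathcal{G}$ and $\mathcal{G}\ne g_{\mathbf i s}-g_{s\mathbf i}$ for all $s\in S$; (iii) $I=\{\mathbf i<\mathbf j\}$, $|S|=N-2$, and there is $\mathcal{G}\notin\{0,\Lambda\}$, where $\Lambda=g_{\mathbf{ij}}-g_{\mathbf{ji}}$, such that $g_{\mathbf i s}=\mathcal{G}$ for all $s\in S$; (iv) $I=\emptyset$ and $g_{\beta\alpha}\ne0$ for all $\alpha<\beta$, i.e. $\mathcal{D}$ is a quantum affine $N$-space. Then $\operatorname{GKdim}\mathcal{D}=N$ and $\mathcal{D}$ is differentially smooth. Here a *differential calculus* over a $\Bbbk$-algebra $A$ is a differential graded algebra $(\Omega A=\bigoplus_{n\ge0}\Omega^nA,d)$ with $\Omega^0A=A$ and $\Omega^nA=A\,dA\wedge\cdots\wedge dA$ ($n$ factors $dA$); it is *connected* if $\ker(d|_A)=\Bbbk$, and *$n$-dimensional* if $\Omega^nA\neq0$ and $\Omega^mA=0$ for $m>n$. Let $\mathcal{I}_nA=\operatorname{Hom}_A(\Omega^nA,A)$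 (right $A$-linear maps), with $(a\cdot\phi\cdot b)(\omega)=a\,\phi(b\omega)$ and $(\phi\cdot\omega)(\omega')=\phi(\omega\wedge\omega')$. A *divergence* is a linear map $\nabla:\mathcal{I}_1A\to A$ with $\nabla(\phi\cdot a)=\nabla(\phi)a+\phi(da)$; it extends to $\nabla_n:\mathcal{I}_{n+1}A\to\mathcal{I}_nA$ by $\nabla_n(\phi)(\omega)=\nabla(\phi\cdot\omega)+(-1)^{n+1}\phi(d\omega)$, where $\nabla_0=\nabla$ under $\mathcal{I}_0A=A$. An $n$-dimensional calculus is *integrable* if there are a divergence with $\nabla_m\circ\nabla_{m+1}=0$ for all $m$, an algebra automorphism $\nu$ of $A$, and $A$-bimodule isomorphisms $\Theta_k:\Omega^kA\to{}^{\nu}\mathcal{I}_{n-k}A$ ($0\le k\le n$), the left action on ${}^\nu\mathcal{I}_{n-k}A$ being twisted by $\nu$, such that $\Theta_{k+1}\circ d=\nabla_{n-k-1}\circ\Theta_k$ for $0\le k<n$. A finitely generated algebra of integer Gelfand–Kirillov dimension $n$ is *differentially smooth* if it admits an $n$-dimensional connected integrable differential calculus. -/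

import Mathlib

open Filter
open scoped BigOperators

universe v u

noncomputable section

/-! ## Differential calculi -/

/-- A differential calculus over a `k`-algebra `A`: a non-negatively graded `k`-algebra
`carrier = ⨁ n, grading n` with a degree-one linear map `d` satisfying the graded Leibniz rule
and `d ∘ d = 0`, whose degree-zero part is `A` (through the injective algebra map `incl`), and
such that the degree-`n` part is `A dA ∧ ⋯ ∧ dA` (density condition). -/
structure DifferentialCalculus (k : Type v) [Field k] (A : Type u) [Ring A] [Algebra k A] where
  carrier : Type u
  [ring : Ring carrier]
  [algebra : Algebra k carrier]
  grading : ℕ → Submodule k carrier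
  [graded : GradedAlgebra grading]
  d : carrier →ₗ[k] carrier
  d_mem : ∀ (n : ℕ) (w : carrier), w ∈ grading n → d w ∈ grading (n + 1)
  leibniz : ∀ (n : ℕ) (w w' : carrier), w ∈ grading n →
    d (w * w') = d w * w' + (-1) ^ n * (w * d w')
  d_d : ∀ w : carrier, d (d w) = 0
  incl : A →ₐ[k] carrier
  incl_injective : Function.Injective incl
  range_incl : LinearMap.range incl.toLinearMap = grading 0
  density : ∀ n : ℕ, grading n = Submodule.span k
    {w | ∃ (a₀ : A) (a : Fin n → A),
      w = incl a₀ * (List.ofFn fun i => d (incl (a i))).prod}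

namespace DifferentialCalculus

attribute [instance] DifferentialCalculus.ring DifferentialCalculus.algebra
  DifferentialCalculus.graded

variable {k : Type v} [Field k] {A : Type u} [Ring A] [Algebra k A]

/-- The space `Ωⁿ A` of `n`-forms. -/
abbrev Form (C : DifferentialCalculus k A) (n : ℕ) : Type u := C.grading n

/-- The differential `d : Ωⁿ A → Ωⁿ⁺¹ A`. -/
def dForm (C : DifferentialCalculus k A) (n : ℕ) : C.Form n →ₗ[k] C.Form (n + 1) :=
  C.d.restrict (C.d_mem n)

/-- The wedge product `Ωᵐ A × Ωⁿ A → Ωᵐ⁺ⁿ A`. -/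
def wedge (C : DifferentialCalculus k A) {m n : ℕ} (w : C.Form m) (w' : C.Form n) :
    C.Form (m + n) :=
  ⟨(w : C.carrier) * (w' : C.carrier), SetLike.mul_mem_graded w.2 w'.2⟩

theorem incl_mem (C : DifferentialCalculus k A) (a : A) : C.incl a ∈ C.grading 0 := by
  rw [← C.range_incl]
  exact ⟨a, rfl⟩

/-- The `0`-form given by an element of `A`. -/
def ofAlg (C : DifferentialCalculus k A) (a : A) : C.Form 0 := ⟨C.incl a, C.incl_mem a⟩

/-- The left action of `A` on `Ωⁿ A`. -/
def lmul (C : DifferentialCalculus k A) {n : ℕ} (a : A) (w : C.Form n) : C.Form n :=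
  ⟨C.incl a * (w : C.carrier), by
    have h := SetLike.mul_mem_graded (C.incl_mem a) w.2
    rwa [Nat.zero_add] at h⟩

/-- The right action of `A` on `Ωⁿ A`. -/
def rmul (C : DifferentialCalculus k A) {n : ℕ} (w : C.Form n) (a : A) : C.Form n :=
  ⟨(w : C.carrier) * C.incl a, SetLike.mul_mem_graded w.2 (C.incl_mem a)⟩

/-- The differential `da ∈ Ω¹ A` of an element `a ∈ A`. -/
def dAlg (C : DifferentialCalculus k A) (a : A) : C.Form 1 :=
  ⟨C.d (C.incl a), C.d_mem 0 _ (C.incl_mem a)⟩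

/-- The calculus is connected: `ker (d : A → Ω¹ A) = k`. -/
def IsConnected (C : DifferentialCalculus k A) : Prop :=
  ∀ a : A, C.d (C.incl a) = 0 ↔ ∃ c : k, a = algebraMap k A c

/-- The calculus has dimension `n`: `Ωⁿ A ≠ 0` and `Ωᵐ A = 0` for all `m > n`. -/
def HasDimension (C : DifferentialCalculus k A) (n : ℕ) : Prop :=
  C.grading n ≠ ⊥ ∧ ∀ m : ℕ, n < m → C.grading m = ⊥

/-! ### Integral forms -/

/-- `𝓘ₙ A = Hom_A (Ωⁿ A, A)`, the space of right `A`-linear maps `Ωⁿ A → A`. -/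
def IntegralForm (C : DifferentialCalculus k A) (n : ℕ) : Submodule k (C.Form n →ₗ[k] A) where
  carrier := {φ | ∀ (w : C.Form n) (a : A), φ (C.rmul w a) = φ w * a}
  add_mem' := by
    intro φ ψ hφ hψ w a
    simp only [LinearMap.add_apply, hφ w a, hψ w a, add_mul]
  zero_mem' := by
    intro w a
    simp
  smul_mem' := by
    intro c φ hφ w a
    simp only [LinearMap.smul_apply, hφ w a, smul_mul_assoc]

/-- Left multiplication by a form as a linear map. -/
def wedgeLeft (C : DifferentialCalculus k A) {m : ℕ} (w : C.Form m) (n : ℕ) :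
    C.Form n →ₗ[k] C.Form (m + n) where
  toFun := C.wedge w
  map_add' := by
    intro x y
    ext
    simp [wedge, mul_add]
  map_smul' := by
    intro c x
    ext
    simp [wedge]

/-- The right action of forms on integral forms: `(φ · ω)(ω') = φ (ω ∧ ω')` for
`φ ∈ 𝓘ₙ₊ₘ A`, `ω ∈ Ωⁿ A`, `ω' ∈ Ωᵐ A`. -/
def act (C : DifferentialCalculus k A) {n m : ℕ} (φ : C.IntegralForm (n + m)) (w : C.Form n) :
    C.IntegralForm m :=
  ⟨φ.1 ∘ₗ C.wedgeLeft w m, by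
    intro w' a
    have h : C.wedge w (C.rmul w' a) = C.rmul (C.wedge w w') a := by
      ext
      simp [wedge, rmul, mul_assoc]
    change φ.1 (C.wedge w (C.rmul w' a)) = φ.1 (C.wedge w w') * a
    rw [h]
    exact φ.2 _ _⟩

/-- Left multiplication by an element of `A` as a linear map on forms. -/
def lmulLin (C : DifferentialCalculus k A) (n : ℕ) (a : A) : C.Form n →ₗ[k] C.Form n where
  toFun := C.lmul a
  map_add' := by
    intro x y
    ext
    simp [lmul, mul_add]
  map_smul' := by
    intro c x
    ext
    simp [lmul]

/-- The left `A`-action `(a · φ)(ω) = a φ(ω)` on `𝓘ₙ A`. -/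
def lactI (C : DifferentialCalculus k A) {n : ℕ} (a : A) (φ : C.IntegralForm n) :
    C.IntegralForm n :=
  ⟨LinearMap.mulLeft k a ∘ₗ φ.1, by
    intro w b
    change a * φ.1 (C.rmul w b) = a * φ.1 w * b
    rw [φ.2 w b, mul_assoc]⟩

/-- The right `A`-action `(φ · b)(ω) = φ(b ω)` on `𝓘ₙ A`. -/
def ractI (C : DifferentialCalculus k A) {n : ℕ} (φ : C.IntegralForm n) (b : A) :
    C.IntegralForm n :=
  ⟨φ.1 ∘ₗ C.lmulLin n b, by
    intro w a
    have h : C.lmul b (C.rmul w a) = C.rmul (C.lmul b w) a := by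
      ext
      simp [lmul, rmul, mul_assoc]
    change φ.1 (C.lmul b (C.rmul w a)) = φ.1 (C.lmul b w) * a
    rw [h]
    exact φ.2 _ _⟩

/-- A divergence (hom-connection): a `k`-linear map `∇ : 𝓘₁ A → A` with
`∇ (φ · a) = ∇(φ) a + φ(da)`. -/
structure Divergence (C : DifferentialCalculus k A) where
  toLin : C.IntegralForm 1 →ₗ[k] A
  leibniz : ∀ (φ : C.IntegralForm 1) (a : A),
    toLin (C.ractI φ a) = toLin φ * a + φ.1 (C.dAlg a)

/-- The extension `∇ₙ : 𝓘ₙ₊₁ A → 𝓘ₙ A` of a divergence,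
`∇ₙ(φ)(ω) = ∇(φ · ω) + (-1)ⁿ⁺¹ φ(dω)`.  Under the identification `𝓘₀ A = A`, `φ ↦ φ(1)`,
the map `∇₀` is `∇` itself. -/
def Divergence.ext {C : DifferentialCalculus k A} (D : C.Divergence) (n : ℕ)
    (φ : C.IntegralForm (n + 1)) : C.IntegralForm n :=
  ⟨{ toFun := fun w => D.toLin (C.act φ w) + (-1) ^ (n + 1) * φ.1 (C.dForm n w)
     map_add' := by
      intro x y
      have h : C.act φ (x + y) = C.act φ x + C.act φ y := by
        ext w
        change φ.1 (C.wedge (x + y) w) = φ.1 (C.wedge x w) + φ.1 (C.wedge y w)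
        rw [← map_add]
        congr 1
        ext
        simp [wedge, add_mul]
      rw [h, map_add, map_add, map_add, mul_add]
      abel
     map_smul' := by
      intro c x
      have h : C.act φ (c • x) = c • C.act φ x := by
        ext w
        change φ.1 (C.wedge (c • x) w) = c • φ.1 (C.wedge x w)
        rw [← map_smul]
        congr 1
        ext
        simp [wedge]
      rw [h, map_smul, map_smul, map_smul, mul_smul_comm, RingHom.id_apply, smul_add] }, by
    intro w a
    have h1 : C.act φ (C.rmul w a) = C.ractI (C.act φ w) a := by
      ext w'
      change φ.1 (C.wedge (C.rmul w a) w') = φ.1 (C.wedge w (C.lmul a w'))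
      congr 1
      ext
      simp [wedge, rmul, lmul, mul_assoc]
    have h2 : C.dForm n (C.rmul w a)
        = C.rmul (C.dForm n w) a + (-1 : k) ^ n • C.wedge w (C.dAlg a) := by
      ext
      change C.d ((w : C.carrier) * C.incl a)
        = C.d w * C.incl a + (-1 : k) ^ n • ((w : C.carrier) * C.d (C.incl a))
      rw [C.leibniz n _ _ w.2, Algebra.smul_def]
      simp
    have h3 : φ.1 (C.wedge w (C.dAlg a)) = (C.act φ w).1 (C.dAlg a) := rfl
    change D.toLin (C.act φ (C.rmul w a)) + (-1) ^ (n + 1) * φ.1 (C.dForm n (C.rmul w a))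
      = (D.toLin (C.act φ w) + (-1) ^ (n + 1) * φ.1 (C.dForm n w)) * a
    rw [h1, D.leibniz, h2, map_add, map_smul, φ.2, h3, Algebra.smul_def]
    simp only [map_pow, map_neg, map_one]
    have h4 : ((-1 : A) ^ (n + 1)) * ((-1) ^ n * (C.act φ w).1 (C.dAlg a))
        = - (C.act φ w).1 (C.dAlg a) := by
      rw [← mul_assoc, ← pow_add]
      have : n + 1 + n = 2 * n + 1 := by ring
      rw [this, pow_succ, pow_mul]
      simp
    rw [mul_add, h4]
    noncomm_ring⟩

/-- The `∇ₙ` form a complex: the hom-connection is flat. -/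
def Divergence.IsFlat {C : DifferentialCalculus k A} (D : C.Divergence) : Prop :=
  ∀ (n : ℕ) (φ : C.IntegralForm (n + 2)), D.ext n (D.ext (n + 1) φ) = 0

/-- An `n`-dimensional calculus is integrable: it admits a complex of integral forms, an algebra
automorphism `ν` of `A` and `A`-bimodule isomorphisms `Θ_j : Ωʲ A → ^ν 𝓘ₙ₋ⱼ A`, `0 ≤ j ≤ n`
(written `Θ j m` with `j + m = n`), such that `Θ_{j+1} ∘ d = ∇_{n-j-1} ∘ Θ_j` for `0 ≤ j < n`.
The left action on `^ν 𝓘` is `a ⊗ φ ↦ ν(a) · φ`. -/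
def IsIntegrable (C : DifferentialCalculus k A) (n : ℕ) : Prop :=
  ∃ (D : C.Divergence) (ν : A ≃ₐ[k] A)
    (Θ : ∀ j m : ℕ, j + m = n → (C.Form j ≃ₗ[k] C.IntegralForm m)),
    D.IsFlat ∧
    (∀ (j m : ℕ) (h : j + m = n) (a : A) (w : C.Form j),
      Θ j m h (C.lmul a w) = C.lactI (ν a) (Θ j m h w)) ∧
    (∀ (j m : ℕ) (h : j + m = n) (w : C.Form j) (b : A),
      Θ j m h (C.rmul w b) = C.ractI (Θ j m h w) b) ∧
    (∀ (j m : ℕ) (h : j + (m + 1) = n) (h' : j + 1 + m = n) (w : C.Form j),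
      Θ (j + 1) m h' (C.dForm j w) = D.ext m (Θ j (m + 1) h w))

end DifferentialCalculus

/-! ## Gelfand–Kirillov dimension and differential smoothness -/

/-- The Gelfand–Kirillov dimension: the supremum of `limsup (log dim Vⁿ / log n)` over the
finite-dimensional subspaces `V` of `A` containing `1`. -/
def gkDim (k : Type v) [Field k] (A : Type u) [Ring A] [Algebra k A] : EReal :=
  ⨆ (V : Submodule k A) (_ : V.FG ∧ (1 : A) ∈ V),
    limsup (fun n : ℕ =>
      ((Real.log (Module.finrank k (V ^ n : Submodule k A)) / Real.log n : ℝ) : EReal)) atTop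

/-- An affine algebra with integer Gelfand–Kirillov dimension `n` is differentially smooth if it
admits an `n`-dimensional connected integrable differential calculus. -/
def DifferentiallySmooth (k : Type v) [Field k] (A : Type u) [Ring A] [Algebra k A] : Prop :=
  Algebra.FiniteType k A ∧ ∃ n : ℕ, gkDim k A = (n : EReal) ∧
    ∃ C : DifferentialCalculus k A, C.HasDimension n ∧ C.IsConnected ∧ C.IsIntegrable n

/-! ## Diffusion algebras -/

/-- The relations `g_{αβ} D_α D_β - g_{βα} D_β D_α = x_β D_α - x_α D_β` for `α < β`. -/
inductive DiffusionRel {N : ℕ} (g : Fin N → Fin N → ℝ) (x : Fin N → ℂ) :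
    FreeAlgebra ℂ (Fin N) → FreeAlgebra ℂ (Fin N) → Prop
  | rel (α β : Fin N) (h : α < β) :
      DiffusionRel g x
        ((g α β : ℂ) • (FreeAlgebra.ι ℂ α * FreeAlgebra.ι ℂ β)
          - (g β α : ℂ) • (FreeAlgebra.ι ℂ β * FreeAlgebra.ι ℂ α))
        (x β • FreeAlgebra.ι ℂ α - x α • FreeAlgebra.ι ℂ β)

/-- The complex algebra generated by `D_α` subject to the relations above. -/
abbrev DiffusionAlgebra {N : ℕ} (g : Fin N → Fin N → ℝ) (x : Fin N → ℂ) : Type :=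
  RingQuot (DiffusionRel g x)

/-- The generator `D_α`. -/
def DiffusionAlgebra.gen {N : ℕ} (g : Fin N → Fin N → ℝ) (x : Fin N → ℂ) (α : Fin N) :
    DiffusionAlgebra g x :=
  RingQuot.mkAlgHom ℂ (DiffusionRel g x) (FreeAlgebra.ι ℂ α)

/-- The ordered monomial `D_{α₁}^{k₁} ⋯ D_{α_N}^{k_N}` with `α₁ > α₂ > ⋯ > α_N`; the exponent
of `D_α` is `e α`. -/
def DiffusionAlgebra.monomial {N : ℕ} (g : Fin N → Fin N → ℝ) (x : Fin N → ℂ)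
    (e : Fin N → ℕ) : DiffusionAlgebra g x :=
  (((List.finRange N).reverse).map fun α => DiffusionAlgebra.gen g x α ^ e α).prod

/-- The coefficients define a diffusion algebra: `g_{αβ} ≠ 0` for `α < β`, and the ordered
monomials form a linear basis. -/
def IsDiffusionAlgebra {N : ℕ} (g : Fin N → Fin N → ℝ) (x : Fin N → ℂ) : Prop :=
  (∀ α β : Fin N, α < β → g α β ≠ 0) ∧
    LinearIndependent ℂ (DiffusionAlgebra.monomial g x) ∧
    Submodule.span ℂ (Set.range (DiffusionAlgebra.monomial g x)) = ⊤

/-- `I = {α | x_α ≠ 0}`. -/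
def diffI {N : ℕ} (x : Fin N → ℂ) : Set (Fin N) := {α | x α ≠ 0}

/-- `R = {α | x_α = 0}`. -/
def diffR {N : ℕ} (x : Fin N → ℂ) : Set (Fin N) := {α | x α = 0}

/-- Two indices of `R` are linked if `g_{rs} g_{sr} ≠ 0`. -/
def diffLink {N : ℕ} (g : Fin N → Fin N → ℝ) (x : Fin N → ℂ) (r s : Fin N) : Prop :=
  r ∈ diffR x ∧ s ∈ diffR x ∧ g r s * g s r ≠ 0

/-- `S` is the union of the connected components `R_a` of `R` (for the links above) that contain
an index `r` with `g_{ir} g_{ri} ≠ 0` for some `i ∈ I`. -/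
def diffS {N : ℕ} (g : Fin N → Fin N → ℝ) (x : Fin N → ℂ) : Set (Fin N) :=
  {s | s ∈ diffR x ∧ ∃ r ∈ diffR x, Relation.ReflTransGen (diffLink g x) s r ∧
    ∃ i ∈ diffI x, g i r * g r i ≠ 0}

end

/-!
The Gelfand–Kirillov dimension is found by counting ordered monomials (`IsPBW.gkDim_eq`).  For
differential smoothness it suffices to exhibit one `N`-dimensional connected integrable calculus.

**Calculi from frames.**  A `FormFrame` consists of skew commuting one-forms `wᵢ`, whose ordered
products are a basis of the right module of all forms, and an odd element `θ` of square zero whose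
graded commutator is the differential.  The resulting calculus is integrable
(`FormFrame.exists_calculus`): the coefficient of the volume form in `ω ∧ ω'` is a nondegenerate
pairing between forms of complementary degrees, hence identifies `Ωʲ A` with `𝓘ₙ₋ⱼ A` up to the
twist by the automorphism `ν` with `a vol = vol ν(a)`.  The divergence is the transported
differential, and flatness is the image of `d ∘ d = 0`.

**Three models.**  Frames are realised by operators on a free module whose basis is that of a
quantum exterior algebra (`FormModel`).
* `JetModel.exists_calculus` starts from a single twisted derivation `δ` whose kernel consists of
  the scalars and which takes the value `1` on an invariant element: `da` is the jet
  `-∑ ωᵢ (δ ^ i a / i!)`, truncated to the required number of one-forms.  So the dimension of the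
  calculus may be prescribed independently of the number of derivations at hand.
* `EigenModel.exists_calculus` starts from an automorphism with a suitable eigenvector `c`: the
  differential is the graded commutator with `∑ ωᵢ c`.
* `QuantumAffineModel.exists_calculus` starts from skew derivations dual to the generators.

**Reduction of diffusion algebras.**  Linear independence of the ordered monomials forces both
reorderings of `D_a D_b D_c` to agree, which gives strong relations between the coefficients
(`IsPBW.overlap`, `DiffusionAlgebra.overlap`).  Together with the links they imply that, after an
affine change of generators, the algebra has one of four shapes.  A change of generators preserves
the basis property by a count of dimensions (`IsPBW.of_generatorSpan_eq`), so that automorphisms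
and twisted derivations can be defined on the new generators (`IsPBW.exists_scaling`,
`IsPBW.exists_twistedDerivation`).
* With at least three nonzero parameters, or two with `g_{ij} = g_{ji}`, the coefficients between
  them are constant and the algebra is of Ore type (`OreType`), or they are additive with
  `g_{ba} = 0` for `a < b` and the algebra is of nilpotent type (`NilpotentType`), which only
  happens if no parameter vanishes.
* With one nonzero parameter the algebra is of Ore type.
* With two nonzero parameters and `g_{ij} ≠ g_{ji}` it is of Weyl type (`WeylType`), a quantum
  Weyl algebra extended by quasi-commuting generators.
* Without nonzero parameters it is a quantum affine space (`QuantumAffineSpace`).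

The jets of a twisted derivation serve for the nilpotent and Ore types and for the Weyl type with
`y_0` and `y_1` anticommuting up to a constant, the eigenvector for the other algebras of Weyl
type, and the skew derivations for quantum affine spaces.
-/

noncomputable section

/-! ### Frames of one-forms -/

/-- The ordered product `w i₁ * ⋯ * w iᵣ` over the elements `i₁ < ⋯ < iᵣ` of `S`. -/
def orderedForm {E : Type u} [Ring E] {n : ℕ} (w : Fin n → E) (S : Finset (Fin n)) : E :=
  (S.sort.map w).prod

/-- A frame of one-forms over `A`: the data from which an `n`-dimensional calculus with a free
module of one-forms is built.  All forms live in an ambient algebra `E` (later: operators on a free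
module), into which `A` is embedded by `ρ`.  The one-forms are spanned over `A` by the skew
commuting elements `w 0, …, w (n - 1)`, and the differential is the graded commutator with the odd
element `θ`, which need not itself be a form. -/
structure FormFrame (k : Type v) [Field k] (A : Type u) [Ring A] [Algebra k A] (n : ℕ)
    (E : Type u) [Ring E] [Algebra k E] where
  /-- The embedding of `A` as the forms of degree zero. -/
  ρ : A →ₐ[k] E
  /-- The grading automorphism, which is `(-1) ^ m` on forms of degree `m`. -/
  parity : E →ₐ[k] E
  /-- The basic one-forms. -/
  w : Fin n → E
  /-- The odd element whose graded commutator is the differential. -/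
  θ : E
  /-- The right coefficients of a form with respect to the ordered products of the `w i`. -/
  ev : E →ₗ[k] (Finset (Fin n) → A)
  /-- The automorphism with `a * vol = vol * ν a`, where `vol` is the product of all `w i`. -/
  ν : A ≃ₐ[k] A
  parity_ρ : ∀ a, parity (ρ a) = ρ a
  parity_w : ∀ i, parity (w i) = -w i
  parity_θ : parity θ = -θ
  θ_sq : θ * θ = 0
  w_sq : ∀ i, w i * w i = 0
  w_swap : ∀ i j, i < j → ∃ c : k, c ≠ 0 ∧ w j * w i = c • (w i * w j)
  /-- The ordered products of the `w i` are right linearly independent over `A`. -/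
  ev_form : ∀ S a, ev (orderedForm w S * ρ a) = Pi.single S a
  ρ_mul_w : ∀ a i, ρ a * w i ∈ Submodule.span k (Set.range w) * LinearMap.range ρ.toLinearMap
  w_mul_ρ : ∀ a i, w i * ρ a ∈ LinearMap.range ρ.toLinearMap * Submodule.span k (Set.range w)
  /-- The differential of an element of `A` is a one-form. -/
  comm_θ : ∀ a, θ * ρ a - ρ a * θ ∈
    Submodule.span k (Set.range w) * LinearMap.range ρ.toLinearMap
  /-- The differential of a basic one-form is a two-form. -/
  θ_w : ∀ i, θ * w i + w i * θ ∈ Submodule.span k (Set.range w) * Submodule.span k (Set.range w) *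
    LinearMap.range ρ.toLinearMap
  /-- The calculus is connected. -/
  scalar_of_comm : ∀ a, θ * ρ a = ρ a * θ → ∃ c : k, a = algebraMap k A c
  /-- The basic one-forms lie in `A dA`. -/
  dense : ∀ i, w i ∈ Submodule.span k {x | ∃ a b, x = ρ a * (θ * ρ b - ρ b * θ)}
  ev_ρ_mul_vol : ∀ a, ev (ρ a * orderedForm w Finset.univ) Finset.univ = ν a

namespace FormFrame

section
variable {k : Type v} [CommSemiring k] {E : Type u} [Semiring E] [Algebra k E]

theorem mul_le_mul_of_le_left {M M' L : Submodule k E} (h : M ≤ M') : M * L ≤ M' * L :=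
  mul_le_mul' h le_rfl

end

section
variable {E : Type u} [Ring E] {n : ℕ} (w : Fin n → E)

@[simp] theorem orderedForm_empty : orderedForm w ∅ = 1 := by simp [orderedForm]

theorem orderedForm_insert {a : Fin n} {S : Finset (Fin n)} (h : ∀ b ∈ S, a < b) :
    orderedForm w (insert a S) = w a * orderedForm w S := by
  unfold orderedForm
  rw [Finset.sort_insert (r := (· ≤ ·)) (fun b hb => (h b hb).le)
    (fun ha => lt_irrefl _ (h a ha))]
  simp

theorem orderedForm_singleton (a : Fin n) : orderedForm w {a} = w a := by
  simp [orderedForm]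

end

variable {k : Type v} [Field k] {A : Type u} [Ring A] [Algebra k A] {n : ℕ}
    {E : Type u} [Ring E] [Algebra k E] (F : FormFrame k A n E)

/-- The ordered products of the one-forms `w i`. -/
abbrev form (S : Finset (Fin n)) : E := orderedForm F.w S

/-- Up to a nonzero scalar, multiplication by `w i` inserts `i` into the index set. -/
theorem w_mul_form (i : Fin n) (S : Finset (Fin n)) :
    (i ∈ S → F.w i * F.form S = 0) ∧
    (i ∉ S → ∃ c : k, c ≠ 0 ∧ F.w i * F.form S = c • F.form (insert i S)) := by
  induction S using Finset.induction_on_min with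
  | empty =>
    refine ⟨fun h => by simp at h, fun _ => ⟨1, one_ne_zero, ?_⟩⟩
    simp [form, orderedForm_singleton]
  | insert a S ha ih =>
    have hform : F.form (insert a S) = F.w a * F.form S := orderedForm_insert _ ha
    rcases lt_trichotomy i a with h | h | h
    · have hi : i ∉ insert a S := by
        intro hi
        rcases Finset.mem_insert.1 hi with rfl | hi
        · exact lt_irrefl _ h
        · exact lt_asymm h (ha i hi)
      refine ⟨fun h' => absurd h' hi, fun _ => ⟨1, one_ne_zero, ?_⟩⟩
      rw [one_smul]
      refine (orderedForm_insert _ ?_).symm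
      intro b hb
      rcases Finset.mem_insert.1 hb with rfl | hb
      · exact h
      · exact h.trans (ha b hb)
    · subst h
      refine ⟨fun _ => ?_, fun h' => absurd (Finset.mem_insert_self _ _) h'⟩
      rw [hform, ← mul_assoc, F.w_sq, zero_mul]
    · obtain ⟨c, hc, hsw⟩ := F.w_swap a i h
      have key : F.w i * F.form (insert a S) = c • (F.w a * (F.w i * F.form S)) := by
        rw [hform, ← mul_assoc, hsw, smul_mul_assoc, mul_assoc]
      refine ⟨fun h' => ?_, fun h' => ?_⟩
      · rw [key, ih.1 ((Finset.mem_insert.1 h').resolve_left h.ne'), mul_zero, smul_zero]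
      · obtain ⟨c', hc', h2⟩ := ih.2 (fun h2 => h' (Finset.mem_insert_of_mem h2))
        refine ⟨c * c', mul_ne_zero hc hc', ?_⟩
        rw [key, h2, mul_smul_comm, smul_smul, Finset.insert_comm]
        congr 1
        refine (orderedForm_insert _ ?_).symm
        intro b hb
        rcases Finset.mem_insert.1 hb with rfl | hb
        · exact h
        · exact ha b hb

theorem form_mul_form (S T : Finset (Fin n)) :
    (¬ Disjoint S T → F.form S * F.form T = 0) ∧
    (Disjoint S T → ∃ c : k, c ≠ 0 ∧ F.form S * F.form T = c • F.form (S ∪ T)) := by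
  induction S using Finset.induction_on_min with
  | empty =>
    refine ⟨fun h => absurd (Finset.disjoint_empty_left _) h, fun _ => ⟨1, one_ne_zero, ?_⟩⟩
    simp [form]
  | insert a S ha ih =>
    have hform : F.form (insert a S) = F.w a * F.form S := orderedForm_insert _ ha
    have haS : a ∉ S := fun h => lt_irrefl _ (ha a h)
    by_cases hd : Disjoint S T
    · obtain ⟨c, hc, h⟩ := ih.2 hd
      by_cases haT : a ∈ T
      · refine ⟨fun _ => ?_, fun h' => ?_⟩
        · rw [hform, mul_assoc, h, mul_smul_comm,
            (F.w_mul_form a _).1 (Finset.mem_union_right _ haT), smul_zero]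
        · exact absurd haT (Finset.disjoint_left.1 h' (Finset.mem_insert_self _ _))
      · refine ⟨fun h' => absurd (Finset.disjoint_insert_left.2 ⟨haT, hd⟩) h', fun _ => ?_⟩
        obtain ⟨c', hc', h'⟩ := (F.w_mul_form a (S ∪ T)).2 (by simp [haS, haT])
        refine ⟨c * c', mul_ne_zero hc hc', ?_⟩
        rw [hform, mul_assoc, h, mul_smul_comm, h', smul_smul, Finset.insert_union]
    · refine ⟨fun _ => ?_, fun h' => absurd (Finset.disjoint_insert_left.1 h').2 hd⟩
      rw [hform, mul_assoc, ih.1 hd, mul_zero]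

/-- The image of `A` in the ambient algebra. -/
abbrev base : Submodule k E := LinearMap.range F.ρ.toLinearMap

/-- The span of the basic one-forms. -/
abbrev oneForms : Submodule k E := Submodule.span k (Set.range F.w)

/-- The span of the ordered products of `m` basic one-forms. -/
def constForms (m : ℕ) : Submodule k E :=
  Submodule.span k (F.form '' {S | S.card = m})

/-- The span of all ordered products of basic one-forms. -/
def allConstForms : Submodule k E := Submodule.span k (Set.range F.form)

theorem ρ_mem (a : A) : F.ρ a ∈ F.base := ⟨a, rfl⟩

theorem base_one : (1 : E) ∈ F.base := ⟨1, by simp⟩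

theorem base_mul_base : F.base * F.base ≤ F.base := by
  rw [Submodule.mul_le]
  rintro _ ⟨a, rfl⟩ _ ⟨b, rfl⟩
  exact ⟨a * b, by simp⟩

theorem le_mul_base (M : Submodule k E) : M ≤ M * F.base := fun x hx => by
  simpa using Submodule.mul_mem_mul hx F.base_one

theorem le_base_mul (M : Submodule k E) : M ≤ F.base * M := fun x hx => by
  simpa using Submodule.mul_mem_mul F.base_one hx

theorem base_mul_oneForms : F.base * F.oneForms ≤ F.oneForms * F.base := by
  have : F.base * F.oneForms =
      Submodule.span k (Set.range F.ρ) * Submodule.span k (Set.range F.w) := by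
    congr 1
    exact (Submodule.span_eq F.base).symm
  rw [this, Submodule.span_mul_span, Submodule.span_le]
  rintro _ ⟨_, ⟨a, rfl⟩, _, ⟨i, rfl⟩, rfl⟩
  exact F.ρ_mul_w a i

theorem oneForms_mul_base : F.oneForms * F.base ≤ F.base * F.oneForms := by
  have : F.oneForms * F.base =
      Submodule.span k (Set.range F.w) * Submodule.span k (Set.range F.ρ) := by
    congr 1
    exact (Submodule.span_eq F.base).symm
  rw [this, Submodule.span_mul_span, Submodule.span_le]
  rintro _ ⟨_, ⟨i, rfl⟩, _, ⟨a, rfl⟩, rfl⟩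
  exact F.w_mul_ρ a i

theorem form_mem {S : Finset (Fin n)} {m : ℕ} (h : S.card = m) : F.form S ∈ F.constForms m :=
  Submodule.subset_span ⟨S, h, rfl⟩

theorem constForms_zero : F.constForms 0 = 1 := by
  have : F.form '' {S | S.card = 0} = {1} := by
    ext x
    simp [form, Finset.card_eq_zero]
  rw [constForms, this, Submodule.one_eq_span]

theorem constForms_one : F.constForms 1 = F.oneForms := by
  have : F.form '' {S | S.card = 1} = Set.range F.w := by
    ext x
    simp only [Set.mem_image, Set.mem_ofPred_eq, Finset.card_eq_one, Set.mem_range]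
    constructor
    · rintro ⟨S, ⟨a, rfl⟩, rfl⟩
      exact ⟨a, (orderedForm_singleton _ _).symm⟩
    · rintro ⟨a, rfl⟩
      exact ⟨{a}, ⟨a, rfl⟩, orderedForm_singleton _ _⟩
  rw [constForms, this]

theorem constForms_mul (m l : ℕ) : F.constForms m * F.constForms l ≤ F.constForms (m + l) := by
  rw [constForms, constForms, Submodule.span_mul_span, Submodule.span_le]
  rintro _ ⟨_, ⟨S, hS, rfl⟩, _, ⟨T, hT, rfl⟩, rfl⟩
  by_cases h : Disjoint S T
  · obtain ⟨c, -, h'⟩ := (F.form_mul_form S T).2 h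
    change F.form S * F.form T ∈ _
    rw [h']
    refine Submodule.smul_mem _ _ (F.form_mem ?_)
    rw [Finset.card_union_of_disjoint h, hS, hT]
  · change F.form S * F.form T ∈ _
    rw [(F.form_mul_form S T).1 h]
    exact Submodule.zero_mem _

theorem constForms_succ_le (m : ℕ) : F.constForms (m + 1) ≤ F.oneForms * F.constForms m := by
  rw [constForms, Submodule.span_le]
  rintro _ ⟨S, hS, rfl⟩
  have hne : S.Nonempty := by
    rw [← Finset.card_pos, hS]
    exact Nat.succ_pos m
  have hins : insert (S.min' hne) (S.erase (S.min' hne)) = S :=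
    Finset.insert_erase (S.min'_mem hne)
  have : F.form S = F.w (S.min' hne) * F.form (S.erase (S.min' hne)) := by
    conv_lhs => rw [← hins]
    refine orderedForm_insert _ ?_
    intro b hb
    exact lt_of_le_of_ne (S.min'_le b (Finset.mem_of_mem_erase hb)) (Finset.ne_of_mem_erase hb).symm
  rw [this]
  refine Submodule.mul_mem_mul (Submodule.subset_span ⟨_, rfl⟩) (F.form_mem ?_)
  rw [Finset.card_erase_of_mem (S.min'_mem hne), hS]
  rfl

theorem oneForms_mul_constForms (m : ℕ) : F.oneForms * F.constForms m ≤ F.constForms (m + 1) := by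
  rw [← constForms_one, add_comm m 1]
  exact F.constForms_mul 1 m

theorem base_mul_constForms (m : ℕ) : F.base * F.constForms m ≤ F.constForms m * F.base := by
  induction m with
  | zero => simp [constForms_zero]
  | succ m ih =>
    calc F.base * F.constForms (m + 1) ≤ F.base * (F.oneForms * F.constForms m) :=
          mul_le_mul' le_rfl (F.constForms_succ_le m)
      _ = (F.base * F.oneForms) * F.constForms m := (mul_assoc _ _ _).symm
      _ ≤ (F.oneForms * F.base) * F.constForms m := mul_le_mul_of_le_left F.base_mul_oneForms
      _ = F.oneForms * (F.base * F.constForms m) := mul_assoc _ _ _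
      _ ≤ F.oneForms * (F.constForms m * F.base) := mul_le_mul' le_rfl ih
      _ = (F.oneForms * F.constForms m) * F.base := (mul_assoc _ _ _).symm
      _ ≤ F.constForms (m + 1) * F.base := mul_le_mul_of_le_left (F.oneForms_mul_constForms m)

theorem constForms_mul_base (m : ℕ) : F.constForms m * F.base ≤ F.base * F.constForms m := by
  induction m with
  | zero => simp [constForms_zero]
  | succ m ih =>
    calc F.constForms (m + 1) * F.base ≤ (F.oneForms * F.constForms m) * F.base :=
          mul_le_mul_of_le_left (F.constForms_succ_le m)
      _ = F.oneForms * (F.constForms m * F.base) := mul_assoc _ _ _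
      _ ≤ F.oneForms * (F.base * F.constForms m) := mul_le_mul' le_rfl ih
      _ = (F.oneForms * F.base) * F.constForms m := (mul_assoc _ _ _).symm
      _ ≤ (F.base * F.oneForms) * F.constForms m := mul_le_mul_of_le_left F.oneForms_mul_base
      _ = F.base * (F.oneForms * F.constForms m) := mul_assoc _ _ _
      _ ≤ F.base * F.constForms (m + 1) := mul_le_mul' le_rfl (F.oneForms_mul_constForms m)

/-- The forms of degree `m`, as a subspace of the ambient algebra. -/
def forms (m : ℕ) : Submodule k E := F.constForms m * F.base

theorem forms_mul (m l : ℕ) : F.forms m * F.forms l ≤ F.forms (m + l) := by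
  unfold forms
  calc F.constForms m * F.base * (F.constForms l * F.base)
      = F.constForms m * (F.base * F.constForms l) * F.base := by simp only [mul_assoc]
    _ ≤ F.constForms m * (F.constForms l * F.base) * F.base :=
        mul_le_mul_of_le_left (mul_le_mul' le_rfl (F.base_mul_constForms l))
    _ = F.constForms m * F.constForms l * (F.base * F.base) := by simp only [mul_assoc]
    _ ≤ F.constForms (m + l) * F.base :=
        mul_le_mul' (F.constForms_mul m l) F.base_mul_base

theorem forms_zero : F.forms 0 = F.base := by simp [forms, constForms_zero]

/-- The space of all forms inside the ambient algebra. -/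
def allForms : Submodule k E := F.allConstForms * F.base

theorem constForms_le (m : ℕ) : F.constForms m ≤ F.allConstForms :=
  Submodule.span_mono (by rintro _ ⟨S, -, rfl⟩; exact ⟨S, rfl⟩)

theorem forms_le (m : ℕ) : F.forms m ≤ F.allForms :=
  mul_le_mul_of_le_left (F.constForms_le m)

theorem allForms_eq : F.allForms = ⨆ m, F.forms m := by
  refine le_antisymm ?_ (iSup_le F.forms_le)
  have : F.allConstForms ≤ ⨆ m, F.constForms m := by
    rw [allConstForms, Submodule.span_le]
    rintro _ ⟨S, rfl⟩
    exact (le_iSup F.constForms S.card) (F.form_mem rfl)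
  calc F.allForms ≤ (⨆ m, F.constForms m) * F.base := mul_le_mul_of_le_left this
    _ = ⨆ m, F.forms m := by rw [Submodule.iSup_mul]; rfl

/-- The subalgebra of all forms. -/
def algebraOfForms : Subalgebra k E :=
  F.allForms.toSubalgebra
    (F.forms_le 0 (by rw [forms_zero]; exact F.base_one))
    (by
      intro x y hx hy
      have : F.allForms * F.allForms ≤ F.allForms := by
        rw [F.allForms_eq, Submodule.iSup_mul]
        refine iSup_le fun m => ?_
        rw [Submodule.mul_iSup]
        exact iSup_le fun l => (F.forms_mul m l).trans (le_iSup F.forms (m + l))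
      exact this (Submodule.mul_mem_mul hx hy))

/-- Every form is determined by its right coefficients `F.ev`. -/
theorem sum_ev {x : E} (hx : x ∈ F.allForms) : ∑ S, F.form S * F.ρ (F.ev x S) = x := by
  have key : ∀ u ∈ F.allConstForms, ∀ a, ∑ S, F.form S * F.ρ (F.ev (u * F.ρ a) S) = u * F.ρ a := by
    intro u hu a
    induction hu using Submodule.span_induction with
    | mem x h =>
      obtain ⟨T, rfl⟩ := h
      rw [F.ev_form, Finset.sum_eq_single T]
      · simp
      · intro S _ hS
        simp [Pi.single_eq_of_ne hS]
      · simp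
    | zero => simp
    | add x y _ _ hx hy =>
      simp only [add_mul, map_add, Pi.add_apply, mul_add, Finset.sum_add_distrib, hx, hy]
    | smul c x _ hx =>
      simp only [smul_mul_assoc, map_smul, Pi.smul_apply, mul_smul_comm, ← Finset.smul_sum, hx]
  induction hx using Submodule.mul_induction_on' with
  | mem_mul_mem m hm n hn =>
    obtain ⟨a, rfl⟩ := hn
    exact key m hm a
  | add x _ y _ hx hy =>
    simp only [map_add, Pi.add_apply, mul_add, Finset.sum_add_distrib, hx, hy]

theorem ev_mul_ρ {x : E} (hx : x ∈ F.allForms) (a : A) (S : Finset (Fin n)) :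
    F.ev (x * F.ρ a) S = F.ev x S * a := by
  conv_lhs => rw [← F.sum_ev hx]
  simp only [Finset.sum_mul, mul_assoc, ← map_mul, map_sum, F.ev_form, Finset.sum_apply]
  rw [Finset.sum_eq_single S]
  · simp
  · intro T _ hT
    exact Pi.single_eq_of_ne hT.symm _
  · simp

/-- A form is of degree `m` if and only if its coefficients vanish outside the sets of size `m`. -/
theorem mem_forms_iff {x : E} {m : ℕ} :
    x ∈ F.forms m ↔ x ∈ F.allForms ∧ ∀ S, S.card ≠ m → F.ev x S = 0 := by
  constructor
  · intro hx
    refine ⟨F.forms_le m hx, ?_⟩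
    intro S hS
    have key : ∀ u ∈ F.constForms m, ∀ a, F.ev (u * F.ρ a) S = 0 := by
      intro u hu a
      induction hu using Submodule.span_induction with
      | mem x h =>
        obtain ⟨T, hT, rfl⟩ := h
        rw [F.ev_form, Pi.single_eq_of_ne]
        rintro rfl
        exact hS hT
      | zero => simp
      | add x y _ _ hx hy => simp [add_mul, hx, hy]
      | smul c x _ hx => simp [hx]
    induction hx using Submodule.mul_induction_on' with
    | mem_mul_mem m hm n hn =>
      obtain ⟨a, rfl⟩ := hn
      exact key m hm a
    | add x _ y _ hx hy => simp [hx, hy]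
  · rintro ⟨hx, h⟩
    rw [← F.sum_ev hx]
    refine Submodule.sum_mem _ fun S _ => ?_
    by_cases hS : S.card = m
    · exact Submodule.mul_mem_mul (F.form_mem hS) (F.ρ_mem _)
    · rw [h S hS]
      simp

/-- The differential: the graded commutator `x ↦ θ x - (-1) ^ |x| x θ`. -/
def diff : E →ₗ[k] E :=
  LinearMap.mulLeft k F.θ - LinearMap.mulRight k F.θ ∘ₗ F.parity.toLinearMap

theorem diff_apply (x : E) : F.diff x = F.θ * x - F.parity x * F.θ := rfl

theorem diff_mul (x y : E) : F.diff (x * y) = F.diff x * y + F.parity x * F.diff y := by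
  simp only [diff_apply, map_mul]
  noncomm_ring

theorem diff_diff (x : E) (hx : F.parity (F.parity x) = x) : F.diff (F.diff x) = 0 := by
  simp only [diff_apply, map_sub, map_mul, F.parity_θ, hx]
  have h : F.θ * (F.θ * x) - -F.θ * F.parity x * F.θ -
      (F.θ * (F.parity x * F.θ) - x * -F.θ * F.θ)
      = (F.θ * F.θ) * x - x * (F.θ * F.θ) := by noncomm_ring
  rw [h, F.θ_sq, zero_mul, mul_zero, sub_zero]

theorem diff_ρ (a : A) : F.diff (F.ρ a) = F.θ * F.ρ a - F.ρ a * F.θ := by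
  rw [diff_apply, F.parity_ρ]

theorem parity_constForms {m : ℕ} {x : E} (hx : x ∈ F.constForms m) :
    F.parity x = (-1 : k) ^ m • x := by
  induction hx using Submodule.span_induction with
  | mem x h =>
    obtain ⟨S, hS, rfl⟩ := h
    rw [Set.mem_ofPred_eq] at hS
    subst hS
    induction S using Finset.induction_on_min with
    | empty => simp [form]
    | insert a S ha ih =>
      have hform : F.form (insert a S) = F.w a * F.form S := orderedForm_insert _ ha
      have haS : a ∉ S := fun h => lt_irrefl _ (ha a h)
      rw [hform, map_mul, ih, F.parity_w, Finset.card_insert_of_notMem haS, pow_succ]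
      simp
  | zero => simp
  | add x y _ _ hx hy => simp [hx, hy]
  | smul c x _ hx => rw [map_smul, hx, smul_comm]

theorem parity_forms {m : ℕ} {x : E} (hx : x ∈ F.forms m) : F.parity x = (-1 : k) ^ m • x := by
  induction hx using Submodule.mul_induction_on' with
  | mem_mul_mem x hx y hy =>
    obtain ⟨a, rfl⟩ := hy
    have h : F.parity (F.ρ.toLinearMap a) = F.ρ.toLinearMap a := F.parity_ρ a
    rw [map_mul, F.parity_constForms hx, h, smul_mul_assoc]
  | add x _ y _ hx hy => simp [hx, hy]

theorem parity_parity {x : E} (hx : x ∈ F.allForms) : F.parity (F.parity x) = x := by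
  rw [allForms_eq] at hx
  induction hx using Submodule.iSup_induction' with
  | mem m x hx =>
    rw [F.parity_forms hx, map_smul, F.parity_forms hx, smul_smul, ← mul_pow]
    simp
  | zero => simp
  | add x y _ _ hx hy => simp [hx, hy]

theorem oneForms_mul_forms (m : ℕ) : F.oneForms * F.forms m ≤ F.forms (m + 1) := by
  rw [forms, ← mul_assoc]
  exact mul_le_mul_of_le_left (F.oneForms_mul_constForms m)

theorem forms_mul_mem {m l r : ℕ} (h : m + l = r) {x y : E} (hx : x ∈ F.forms m)
    (hy : y ∈ F.forms l) : x * y ∈ F.forms r :=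
  h ▸ F.forms_mul m l (Submodule.mul_mem_mul hx hy)

theorem constForms_le_forms (m : ℕ) : F.constForms m ≤ F.forms m := F.le_mul_base _

theorem diff_form_mem (S : Finset (Fin n)) : F.diff (F.form S) ∈ F.forms (S.card + 1) := by
  induction S using Finset.induction_on_min with
  | empty => simp [form, diff_apply]
  | insert a S ha ih =>
    have hform : F.form (insert a S) = F.w a * F.form S := orderedForm_insert _ ha
    have haS : a ∉ S := fun h => lt_irrefl _ (ha a h)
    rw [hform, diff_mul, F.parity_w, Finset.card_insert_of_notMem haS]
    have hw : F.diff (F.w a) ∈ F.forms 2 := by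
      have h1 := F.θ_w a
      have h2 : F.diff (F.w a) = F.θ * F.w a + F.w a * F.θ := by
        rw [diff_apply, F.parity_w]
        noncomm_ring
      rw [h2]
      refine mul_le_mul_of_le_left ?_ h1
      have := F.oneForms_mul_constForms 1
      rwa [constForms_one] at this
    refine Submodule.add_mem _ ?_ ?_
    · exact F.forms_mul_mem (by omega) hw (F.constForms_le_forms _ (F.form_mem rfl))
    · rw [neg_mul]
      refine Submodule.neg_mem _ (F.oneForms_mul_forms _ (Submodule.mul_mem_mul ?_ ih))
      exact Submodule.subset_span ⟨a, rfl⟩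

theorem diff_mem {m : ℕ} {x : E} (hx : x ∈ F.forms m) : F.diff x ∈ F.forms (m + 1) := by
  have key : ∀ u ∈ F.constForms m, ∀ a, F.diff (u * F.ρ a) ∈ F.forms (m + 1) := by
    intro u hu a
    induction hu using Submodule.span_induction with
    | mem x h =>
      obtain ⟨S, hS, rfl⟩ := h
      rw [Set.mem_ofPred_eq] at hS
      subst hS
      rw [diff_mul]
      refine Submodule.add_mem _ ?_ ?_
      · exact F.forms_mul_mem (l := 0) (by omega) (F.diff_form_mem S)
          (by rw [forms_zero]; exact F.ρ_mem a)
      · rw [F.parity_constForms (F.form_mem rfl), diff_ρ, smul_mul_assoc]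
        refine Submodule.smul_mem _ _ (F.forms_mul_mem (l := 1) rfl
          (F.constForms_le_forms _ (F.form_mem rfl)) ?_)
        have := F.comm_θ a
        rwa [forms, constForms_one]
    | zero => simp
    | add x y _ _ hx hy =>
      rw [add_mul, map_add]
      exact Submodule.add_mem _ hx hy
    | smul c x _ hx =>
      rw [smul_mul_assoc, map_smul]
      exact Submodule.smul_mem _ _ hx
  induction hx using Submodule.mul_induction_on' with
  | mem_mul_mem m hm n hn =>
    obtain ⟨a, rfl⟩ := hn
    exact key m hm a
  | add x _ y _ hx hy =>
    rw [map_add]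
    exact Submodule.add_mem _ hx hy

/-- The space of exact one-forms `da`. -/
def exactForms : Submodule k E := LinearMap.range (F.diff ∘ₗ F.ρ.toLinearMap)

theorem exactForms_le : F.exactForms ≤ F.forms 1 := by
  rintro _ ⟨a, rfl⟩
  have := F.comm_θ a
  change F.diff (F.ρ a) ∈ _
  rwa [diff_ρ, forms, constForms_one]

/-- By the Leibniz rule, `(da) b = d(ab) - a db`. -/
theorem exactForms_mul_base : F.exactForms * F.base ≤ F.base * F.exactForms := by
  rw [Submodule.mul_le]
  rintro _ ⟨a, rfl⟩ _ ⟨b, rfl⟩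
  change F.diff (F.ρ a) * F.ρ b ∈ _
  have h := F.diff_mul (F.ρ a) (F.ρ b)
  rw [F.parity_ρ, ← map_mul] at h
  rw [eq_sub_of_add_eq h.symm]
  refine Submodule.sub_mem _ (F.le_base_mul _ ⟨a * b, rfl⟩) ?_
  exact Submodule.mul_mem_mul (F.ρ_mem a) ⟨b, rfl⟩

theorem oneForms_le_base_mul_exactForms : F.oneForms ≤ F.base * F.exactForms := by
  rw [oneForms, Submodule.span_le]
  rintro _ ⟨i, rfl⟩
  refine Submodule.span_le.2 ?_ (F.dense i)
  rintro _ ⟨a, b, rfl⟩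
  rw [← diff_ρ]
  exact Submodule.mul_mem_mul (F.ρ_mem a) ⟨b, rfl⟩

theorem exactForms_pow_mul_base (m : ℕ) :
    F.exactForms ^ m * F.base ≤ F.base * F.exactForms ^ m := by
  induction m with
  | zero => simp
  | succ m ih =>
    calc F.exactForms ^ (m + 1) * F.base = F.exactForms * (F.exactForms ^ m * F.base) := by
          rw [pow_succ', mul_assoc]
      _ ≤ F.exactForms * (F.base * F.exactForms ^ m) := mul_le_mul' le_rfl ih
      _ = (F.exactForms * F.base) * F.exactForms ^ m := (mul_assoc _ _ _).symm
      _ ≤ (F.base * F.exactForms) * F.exactForms ^ m :=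
        mul_le_mul_of_le_left F.exactForms_mul_base
      _ = F.base * F.exactForms ^ (m + 1) := by rw [pow_succ', mul_assoc]

theorem constForms_le_base_mul (m : ℕ) : F.constForms m ≤ F.base * F.exactForms ^ m := by
  induction m with
  | zero =>
    rw [constForms_zero, pow_zero]
    exact F.le_base_mul 1
  | succ m ih =>
    calc F.constForms (m + 1) ≤ F.oneForms * F.constForms m := F.constForms_succ_le m
      _ ≤ (F.base * F.exactForms) * (F.base * F.exactForms ^ m) :=
        mul_le_mul' F.oneForms_le_base_mul_exactForms ih
      _ = F.base * ((F.exactForms * F.base) * F.exactForms ^ m) := by simp only [mul_assoc]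
      _ ≤ F.base * ((F.base * F.exactForms) * F.exactForms ^ m) :=
        mul_le_mul' le_rfl (mul_le_mul_of_le_left F.exactForms_mul_base)
      _ = (F.base * F.base) * F.exactForms ^ (m + 1) := by rw [pow_succ']; simp only [mul_assoc]
      _ ≤ F.base * F.exactForms ^ (m + 1) := mul_le_mul_of_le_left F.base_mul_base

theorem exactForms_pow_le (m : ℕ) : F.exactForms ^ m ≤ F.forms m := by
  induction m with
  | zero =>
    rw [pow_zero, forms_zero, Submodule.one_le]
    exact F.base_one
  | succ m ih =>
    rw [pow_succ', add_comm]
    exact (mul_le_mul' F.exactForms_le ih).trans (F.forms_mul 1 m)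

/-- The density condition `Ωᵐ A = A dA ∧ ⋯ ∧ dA` inside the ambient algebra. -/
theorem forms_eq (m : ℕ) : F.forms m = F.base * F.exactForms ^ m := by
  refine le_antisymm ?_ ?_
  · calc F.forms m ≤ (F.base * F.exactForms ^ m) * F.base :=
          mul_le_mul_of_le_left (F.constForms_le_base_mul m)
      _ = F.base * (F.exactForms ^ m * F.base) := mul_assoc _ _ _
      _ ≤ F.base * (F.base * F.exactForms ^ m) :=
        mul_le_mul' le_rfl (F.exactForms_pow_mul_base m)
      _ = (F.base * F.base) * F.exactForms ^ m := (mul_assoc _ _ _).symm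
      _ ≤ _ := mul_le_mul_of_le_left F.base_mul_base
  · have := mul_le_mul' (F.forms_zero.ge) (F.exactForms_pow_le m)
    refine this.trans ?_
    simpa using F.forms_mul 0 m

end FormFrame

/-! ### The calculus of a frame -/

namespace FormFrame

variable {k : Type v} [Field k] {A : Type u} [Ring A] [Algebra k A] {n : ℕ}
    {E : Type u} [Ring E] [Algebra k E] (F : FormFrame k A n E)

/-- The forms of degree `m` as a subspace of the algebra of forms. -/
def degree (m : ℕ) : Submodule k F.algebraOfForms :=
  (F.forms m).comap F.algebraOfForms.val.toLinearMap

theorem mem_degree {m : ℕ} {x : F.algebraOfForms} : x ∈ F.degree m ↔ (x : E) ∈ F.forms m :=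
  Iff.rfl

theorem map_degree (m : ℕ) :
    (F.degree m).map F.algebraOfForms.val.toLinearMap = F.forms m := by
  rw [degree, Submodule.map_comap_eq, inf_eq_right]
  intro x hx
  exact ⟨⟨x, F.forms_le m hx⟩, rfl⟩

instance : SetLike.GradedMonoid F.degree where
  one_mem := by
    rw [mem_degree, forms_zero]
    exact F.base_one
  mul_mem := fun m l x y hx hy => F.forms_mul m l (Submodule.mul_mem_mul hx hy)

theorem degree_isInternal : DirectSum.IsInternal F.degree := by
  rw [DirectSum.isInternal_submodule_iff_iSupIndep_and_iSup_eq_top]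
  constructor
  · rw [iSupIndep_def]
    intro m
    rw [Submodule.disjoint_def]
    intro x hx hx'
    have h1 : ∀ S, S.card = m → F.ev (x : E) S = 0 := by
      intro S hS
      have hle : (⨆ j, ⨆ (_ : j ≠ m), F.degree j) ≤
          LinearMap.ker ((LinearMap.proj S ∘ₗ F.ev) ∘ₗ F.algebraOfForms.val.toLinearMap) := by
        refine iSup_le fun j => iSup_le fun hj y hy => ?_
        exact (F.mem_forms_iff.1 hy).2 S (fun h => hj (h.symm.trans hS))
      exact hle hx'
    have h2 := (F.mem_forms_iff.1 hx).2
    apply Subtype.ext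
    rw [← F.sum_ev x.2]
    refine Finset.sum_eq_zero fun S _ => ?_
    by_cases hS : S.card = m
    · rw [h1 S hS]; simp
    · rw [show F.ev (x : E) S = 0 from h2 S hS]; simp
  · rw [eq_top_iff]
    rintro x -
    have hx : (x : E) ∈ ⨆ m, F.forms m := by
      rw [← allForms_eq]
      exact x.2
    have : (⨆ m, F.degree m).map F.algebraOfForms.val.toLinearMap = ⨆ m, F.forms m := by
      rw [Submodule.map_iSup]
      simp_rw [map_degree]
    rw [← this] at hx
    obtain ⟨y, hy, hyx⟩ := hx
    have : y = x := Subtype.ext hyx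
    rwa [← this]

instance : DirectSum.Decomposition F.degree := F.degree_isInternal.chooseDecomposition

instance : GradedAlgebra F.degree where

theorem diff_mem_allForms {x : E} (hx : x ∈ F.allForms) : F.diff x ∈ F.allForms := by
  rw [allForms_eq] at hx
  induction hx using Submodule.iSup_induction' with
  | mem m x hx => exact F.forms_le _ (F.diff_mem hx)
  | zero => simp
  | add x y _ _ hx hy =>
    rw [map_add]
    exact Submodule.add_mem _ hx hy

/-- The inclusion of `A` as the forms of degree zero. -/
def inclusion : A →ₐ[k] F.algebraOfForms :=
  F.ρ.codRestrict _ fun a => F.forms_le 0 (by rw [forms_zero]; exact F.ρ_mem a)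

theorem ev_ρ (a : A) : F.ev (F.ρ a) = Pi.single ∅ a := by
  have := F.ev_form ∅ a
  rwa [orderedForm_empty, one_mul] at this

/-- The differential on the algebra of forms. -/
def dForms : F.algebraOfForms →ₗ[k] F.algebraOfForms :=
  F.diff.restrict (p := F.allForms) (q := F.allForms) fun _ hx => F.diff_mem_allForms hx

theorem coe_dForms (x : F.algebraOfForms) : (F.dForms x : E) = F.diff x := rfl

/-- The differential calculus defined by a frame. -/
def calculus : DifferentialCalculus k A where
  carrier := F.algebraOfForms
  grading := F.degree
  d := F.dForms
  d_mem := fun m w hw => F.diff_mem hw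
  leibniz := by
    intro m w w' hw
    apply Subtype.ext
    change F.diff ((w : E) * w') = F.diff w * w' + (((-1) ^ m * (w * F.dForms w') :
      F.algebraOfForms) : E)
    rw [diff_mul, F.parity_forms (F.mem_degree.1 hw), smul_mul_assoc, Algebra.smul_def]
    simp [coe_dForms]
  d_d := fun w => Subtype.ext (F.diff_diff _ (F.parity_parity w.2))
  incl := F.inclusion
  incl_injective := by
    intro a b h
    have h' : F.ρ a = F.ρ b := congrArg Subtype.val h
    have := congrArg F.ev h'
    rw [ev_ρ, ev_ρ] at this
    exact Pi.single_injective _ this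
  range_incl := by
    ext x
    rw [mem_degree, forms_zero]
    constructor
    · rintro ⟨a, rfl⟩
      exact ⟨a, rfl⟩
    · rintro ⟨a, ha⟩
      exact ⟨a, Subtype.ext ha⟩
  density := by
    intro m
    have hinj : Function.Injective F.algebraOfForms.val.toLinearMap := Subtype.val_injective
    apply Submodule.map_injective_of_injective hinj
    rw [map_degree, forms_eq, Submodule.map_span]
    have hb : F.base = Submodule.span k (F.base : Set E) := (Submodule.span_eq _).symm
    rw [Submodule.pow_eq_span_pow_set, hb, Submodule.span_mul_span]
    congr 1
    ext x
    constructor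
    · rintro ⟨_, ⟨a, rfl⟩, y, hy, rfl⟩
      obtain ⟨f, rfl⟩ := Set.mem_pow.1 hy
      choose b hb using fun i => (f i).2
      refine ⟨_, ⟨a, b, rfl⟩, ?_⟩
      rw [AlgHom.toLinearMap_apply, map_mul, map_list_prod, List.map_ofFn]
      change F.ρ a * _ = F.ρ a * _
      congr 3
      funext i
      exact hb i
    · rintro ⟨_, ⟨a, b, rfl⟩, rfl⟩
      refine ⟨F.ρ a, F.ρ_mem a, (List.ofFn fun i => F.diff (F.ρ (b i))).prod, ?_, ?_⟩
      · exact Set.mem_pow.2 ⟨fun i => ⟨F.diff (F.ρ (b i)), b i, rfl⟩, rfl⟩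
      · rw [AlgHom.toLinearMap_apply, map_mul, map_list_prod, List.map_ofFn]
        rfl

/-- The inclusion of the algebra of forms into the ambient algebra. -/
def toAmbient : F.calculus.carrier →ₐ[k] E := F.algebraOfForms.val

theorem toAmbient_injective : Function.Injective F.toAmbient := Subtype.val_injective

/-- A form of degree `m` as an element of the ambient algebra. -/
def ofForm (m : ℕ) : F.calculus.Form m →ₗ[k] E :=
  F.toAmbient.toLinearMap ∘ₗ (F.calculus.grading m).subtype

theorem ofForm_injective (m : ℕ) : Function.Injective (F.ofForm m) :=
  F.toAmbient_injective.comp Subtype.val_injective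

theorem ofForm_mem {m : ℕ} (x : F.calculus.Form m) : F.ofForm m x ∈ F.forms m := x.2

/-- An element of the ambient algebra of degree `m` as a form. -/
def mkForm {m : ℕ} (x : E) (hx : x ∈ F.forms m) : F.calculus.Form m := ⟨⟨x, F.forms_le m hx⟩, hx⟩

theorem ofForm_mkForm {m : ℕ} (x : E) (hx : x ∈ F.forms m) : F.ofForm m (F.mkForm x hx) = x := rfl

theorem ofForm_rmul {m : ℕ} (x : F.calculus.Form m) (a : A) :
    F.ofForm m (F.calculus.rmul x a) = F.ofForm m x * F.ρ a := rfl

theorem ofForm_lmul {m : ℕ} (x : F.calculus.Form m) (a : A) :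
    F.ofForm m (F.calculus.lmul a x) = F.ρ a * F.ofForm m x := rfl

theorem ofForm_wedge {m l : ℕ} (x : F.calculus.Form m) (y : F.calculus.Form l) :
    F.ofForm (m + l) (F.calculus.wedge x y) = F.ofForm m x * F.ofForm l y := rfl

theorem ofForm_dForm {m : ℕ} (x : F.calculus.Form m) :
    F.ofForm (m + 1) (F.calculus.dForm m x) = F.diff (F.ofForm m x) := rfl

theorem calculus_isConnected : F.calculus.IsConnected := by
  intro a
  constructor
  · intro h
    have h' : F.diff (F.ρ a) = 0 := congrArg Subtype.val h
    rw [diff_ρ, sub_eq_zero] at h'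
    exact F.scalar_of_comm a h'
  · rintro ⟨c, rfl⟩
    apply Subtype.ext
    change F.diff (F.ρ _) = 0
    rw [diff_ρ, AlgHom.commutes, Algebra.commutes, sub_self]

/-- The volume form. -/
abbrev vol : E := F.form Finset.univ

/-- There are no ordered products of more than `n` basic one-forms, and the volume form does not
vanish. -/
theorem calculus_hasDimension [Nontrivial A] : F.calculus.HasDimension n := by
  constructor
  · intro h
    have hv : F.vol ∈ F.forms n :=
      F.constForms_le_forms n (F.form_mem (by simp))
    have hv' : (⟨F.vol, F.forms_le n hv⟩ : F.algebraOfForms) ∈ F.degree n := hv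
    have h0 : (⟨F.vol, F.forms_le n hv⟩ : F.algebraOfForms) = 0 := by
      have : F.degree n = ⊥ := h
      rwa [this, Submodule.mem_bot] at hv'
    have h1 : F.vol = 0 := congrArg Subtype.val h0
    have h2 := F.ev_form Finset.univ 1
    change F.ev (F.vol * F.ρ 1) = _ at h2
    rw [h1] at h2
    have := congrFun h2 Finset.univ
    simp at this
  · intro m hm
    change F.degree m = ⊥
    rw [eq_bot_iff]
    intro x hx
    have hx' := F.mem_forms_iff.1 hx
    rw [Submodule.mem_bot]
    apply Subtype.ext
    rw [← F.sum_ev x.2]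
    refine Finset.sum_eq_zero fun S _ => ?_
    rw [show F.ev (x : E) S = 0 from hx'.2 S ?_]
    · simp
    · have := Finset.card_le_univ S
      rw [Fintype.card_fin] at this
      omega

/-- The coefficient of the volume form. -/
def top : E →ₗ[k] A := LinearMap.proj Finset.univ ∘ₗ F.ev

theorem top_vol_mul (a : A) : F.top (F.vol * F.ρ a) = a := by
  change F.ev _ _ = _
  rw [F.ev_form]
  simp

theorem top_mul_ρ {x : E} (hx : x ∈ F.allForms) (a : A) : F.top (x * F.ρ a) = F.top x * a :=
  F.ev_mul_ρ hx a _

theorem eq_vol_mul_top {x : E} (hx : x ∈ F.forms n) : x = F.vol * F.ρ (F.top x) := by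
  have hx' := F.mem_forms_iff.1 hx
  conv_lhs => rw [← F.sum_ev hx'.1]
  rw [Finset.sum_eq_single Finset.univ]
  · rfl
  · intro S _ hS
    rw [hx'.2 S]
    · simp
    · intro h
      apply hS
      rw [← Finset.card_eq_iff_eq_univ, h, Fintype.card_fin]
  · simp

theorem ρ_mul_vol (a : A) : F.ρ a * F.vol = F.vol * F.ρ (F.ν a) := by
  have h : F.ρ a * F.vol ∈ F.forms n := F.base_mul_constForms n
    (Submodule.mul_mem_mul (F.ρ_mem a) (F.form_mem (by simp)))
  rw [← F.ev_ρ_mul_vol]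
  exact F.eq_vol_mul_top h

theorem top_ρ_mul {x : E} (hx : x ∈ F.forms n) (a : A) : F.top (F.ρ a * x) = F.ν a * F.top x := by
  conv_lhs => rw [F.eq_vol_mul_top hx, ← mul_assoc, F.ρ_mul_vol, mul_assoc, ← map_mul]
  exact F.top_vol_mul _

theorem exists_form_mul_compl (S : Finset (Fin n)) :
    ∃ c : k, c ≠ 0 ∧ F.form S * F.form Sᶜ = c • F.vol := by
  obtain ⟨c, hc, h⟩ := (F.form_mul_form S Sᶜ).2 disjoint_compl_right
  exact ⟨c, hc, by rw [h, Finset.union_compl]⟩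

/-- The nonzero scalar by which `form S * form Sᶜ` differs from the volume form. -/
def complCoeff (S : Finset (Fin n)) : k := (F.exists_form_mul_compl S).choose

theorem complCoeff_ne_zero (S : Finset (Fin n)) : F.complCoeff S ≠ 0 :=
  (F.exists_form_mul_compl S).choose_spec.1

theorem form_mul_compl (S : Finset (Fin n)) :
    F.form S * F.form Sᶜ = F.complCoeff S • F.vol :=
  (F.exists_form_mul_compl S).choose_spec.2

theorem form_mul_eq_zero {S T : Finset (Fin n)} (h : S.card + T.card = n) (hT : T ≠ Sᶜ) :
    F.form S * F.form T = 0 := by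
  refine (F.form_mul_form S T).1 fun hd => hT ?_
  have h1 : T ⊆ Sᶜ := by
    rw [Finset.subset_compl_iff_disjoint_left]
    exact hd
  refine Finset.eq_of_subset_of_card_le h1 ?_
  rw [Finset.card_compl, Fintype.card_fin]
  omega

theorem top_form_mul {S T : Finset (Fin n)} (h : S.card + T.card = n) (a : A) :
    F.top (F.ρ a * F.form S * F.form T) =
      if T = Sᶜ then F.complCoeff S • F.ν a else 0 := by
  split_ifs with hT
  · rw [hT, mul_assoc, form_mul_compl, mul_smul_comm, map_smul, F.ρ_mul_vol, top_vol_mul]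
  · rw [mul_assoc, F.form_mul_eq_zero h hT, mul_zero, map_zero]

/-- Forms of degree `j` have left coefficients with respect to the ordered products. -/
theorem exists_left_coeff {j : ℕ} {x : E} (hx : x ∈ F.forms j) :
    ∃ a : Finset (Fin n) → A, x = ∑ S with S.card = j, F.ρ (a S) * F.form S := by
  have hx' := F.constForms_mul_base j hx
  clear hx
  have key : ∀ u ∈ F.constForms j, ∀ a, ∃ b : Finset (Fin n) → A,
      F.ρ a * u = ∑ S with S.card = j, F.ρ (b S) * F.form S := by
    intro u hu a
    induction hu using Submodule.span_induction with
    | mem x h =>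
      obtain ⟨T, hT, rfl⟩ := h
      rw [Set.mem_ofPred_eq] at hT
      refine ⟨Pi.single T a, ?_⟩
      rw [Finset.sum_eq_single T]
      · simp
      · intro S _ hS
        simp [Pi.single_eq_of_ne hS]
      · simp [hT]
    | zero => exact ⟨0, by simp⟩
    | add x y _ _ hx hy =>
      obtain ⟨b, hb⟩ := hx
      obtain ⟨b', hb'⟩ := hy
      exact ⟨b + b', by simp [mul_add, hb, hb', add_mul, Finset.sum_add_distrib]⟩
    | smul c x _ hx =>
      obtain ⟨b, hb⟩ := hx
      exact ⟨c • b, by simp [hb, Finset.smul_sum]⟩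
  induction hx' using Submodule.mul_induction_on' with
  | mem_mul_mem r hr u hu =>
    obtain ⟨a, rfl⟩ := hr
    exact key u hu a
  | add x _ y _ hx hy =>
    obtain ⟨b, hb⟩ := hx
    obtain ⟨b', hb'⟩ := hy
    exact ⟨b + b', by simp [hb, hb', add_mul, Finset.sum_add_distrib]⟩

theorem top_sum_mul {j m : ℕ} (h : j + m = n) (a : Finset (Fin n) → A) {T : Finset (Fin n)}
    (hT : T.card = m) :
    F.top ((∑ S with S.card = j, F.ρ (a S) * F.form S) * F.form T) =
      F.complCoeff Tᶜ • F.ν (a Tᶜ) := by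
  rw [Finset.sum_mul, map_sum, Finset.sum_eq_single Tᶜ]
  · rw [F.top_form_mul, if_pos (compl_compl T).symm]
    rw [Finset.card_compl, Fintype.card_fin, hT]
    omega
  · intro S hS hne
    rw [Finset.mem_filter] at hS
    rw [F.top_form_mul (by omega), if_neg]
    rintro rfl
    exact hne (compl_compl S).symm
  · intro h'
    exfalso
    apply h'
    simp only [Finset.mem_filter, Finset.mem_univ, true_and]
    rw [Finset.card_compl, Fintype.card_fin, hT]
    omega

/-- The pairing of complementary degrees is nondegenerate. -/
theorem eq_zero_of_top {j m : ℕ} (h : j + m = n) {x : E} (hx : x ∈ F.forms j)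
    (h0 : ∀ y ∈ F.forms m, F.top (x * y) = 0) : x = 0 := by
  obtain ⟨a, rfl⟩ := F.exists_left_coeff hx
  refine Finset.sum_eq_zero fun S hS => ?_
  rw [Finset.mem_filter] at hS
  have hc : Sᶜ.card = m := by
    rw [Finset.card_compl, Fintype.card_fin]
    omega
  have h1 := h0 _ (F.constForms_le_forms m (F.form_mem hc))
  rw [F.top_sum_mul h a hc, compl_compl, smul_eq_zero] at h1
  have h2 := h1.resolve_left (F.complCoeff_ne_zero S)
  rw [map_eq_zero_iff _ F.ν.injective] at h2
  rw [h2]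
  simp

/-- Every right `A`-linear functional on forms is given by the pairing. -/
theorem exists_top_eq {j m : ℕ} (h : j + m = n) (φ : F.calculus.IntegralForm m) :
    ∃ x ∈ F.forms j, ∀ y : F.calculus.Form m, F.top (x * F.ofForm m y) = φ.1 y := by
  let b : Finset (Fin n) → A := fun T =>
    if hT : T.card = m then
      φ.1 (F.mkForm (F.form T) (F.constForms_le_forms m (F.form_mem hT)))
    else 0
  let x : E := ∑ S with S.card = j, F.ρ (F.ν.symm ((F.complCoeff S)⁻¹ • b Sᶜ)) * F.form S
  have hx : x ∈ F.forms j := by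
    refine Submodule.sum_mem _ fun S hS => ?_
    rw [Finset.mem_filter] at hS
    exact F.forms_mul_mem (m := 0) (by omega) (by rw [forms_zero]; exact F.ρ_mem _)
      (F.constForms_le_forms j (F.form_mem hS.2))
  refine ⟨x, hx, ?_⟩
  have hxT : ∀ T : Finset (Fin n), ∀ hT : T.card = m,
      F.top (x * F.form T) =
        φ.1 (F.mkForm (F.form T) (F.constForms_le_forms m (F.form_mem hT))) := by
    intro T hT
    rw [F.top_sum_mul h _ hT, AlgEquiv.apply_symm_apply, smul_smul,
      mul_inv_cancel₀ (F.complCoeff_ne_zero _), one_smul, compl_compl]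
    simp only [b, dif_pos hT]
  have key : ∀ u : E, ∀ hu : u ∈ F.forms m, F.top (x * u) = φ.1 (F.mkForm u hu) := by
    intro u hu
    have hu' := F.mem_forms_iff.1 hu
    have hsum : u = ∑ T with T.card = m, F.form T * F.ρ (F.ev u T) := by
      conv_lhs => rw [← F.sum_ev hu'.1]
      rw [Finset.sum_filter]
      refine Finset.sum_congr rfl fun T _ => ?_
      split_ifs with hT
      · rfl
      · rw [hu'.2 T hT]; simp
    have hlift : F.mkForm u hu =
        ∑ T ∈ (Finset.univ.filter fun T : Finset (Fin n) => T.card = m).attach,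
        F.calculus.rmul (F.mkForm (F.form T) (F.constForms_le_forms m
          (F.form_mem (Finset.mem_filter.1 T.2).2))) (F.ev u T) := by
      apply F.ofForm_injective
      rw [map_sum, ofForm_mkForm]
      conv_lhs => rw [hsum]
      rw [← Finset.sum_attach]
      rfl
    rw [hlift, map_sum]
    conv_lhs => rw [hsum]
    rw [Finset.mul_sum, map_sum, ← Finset.sum_attach]
    refine Finset.sum_congr rfl fun T _ => ?_
    have hT := (Finset.mem_filter.1 T.2).2
    rw [φ.2, ← hxT _ hT, ← mul_assoc, F.top_mul_ρ]
    exact F.forms_le n (F.forms_mul_mem h hx (F.constForms_le_forms m (F.form_mem hT)))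
  exact fun y => key _ y.2

end FormFrame

/-! ### Integrability by the pairing with the volume form -/

namespace FormFrame

variable {k : Type v} [Field k] {A : Type u} [Ring A] [Algebra k A] {n : ℕ}
    {E : Type u} [Ring E] [Algebra k E] (F : FormFrame k A n E)

/-- The sign `(-1) ^ ((n - 1) * j)` of the pairing on forms of degree `j`, with which the pairing
intertwines the differential with the divergence.  The exponent is written with `n + 1`, which has
the parity of `n - 1` and avoids truncated subtraction. -/
def pairingSign (n j : ℕ) (k : Type v) [Field k] : k := (-1) ^ ((n + 1) * j)

theorem pairingSign_mul_self (j : ℕ) : pairingSign n j k * pairingSign n j k = 1 := by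
  rw [pairingSign, ← mul_pow]
  simp

theorem pairingSign_succ (j : ℕ) :
    pairingSign n (j + 1) k = (-1) ^ (n + 1) * pairingSign n j k := by
  rw [pairingSign, pairingSign, ← pow_add]
  congr 1
  ring

/-- The pairing with a fixed form, `ω' ↦ ± φ(ω ∧ ω')`, where `φ` is the coefficient of the
volume form. -/
def pairing (j m : ℕ) (h : j + m = n) : F.calculus.Form j →ₗ[k] F.calculus.IntegralForm m where
  toFun w :=
    ⟨pairingSign n j k • (F.top ∘ₗ LinearMap.mulLeft k (F.ofForm j w) ∘ₗ F.ofForm m), by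
      intro w' a
      change pairingSign n j k • F.top (F.ofForm j w * F.ofForm m (F.calculus.rmul w' a)) =
        pairingSign n j k • F.top (F.ofForm j w * F.ofForm m w') * a
      rw [ofForm_rmul, ← mul_assoc, F.top_mul_ρ, smul_mul_assoc]
      exact F.forms_le n (F.forms_mul_mem h (F.ofForm_mem w) (F.ofForm_mem w'))⟩
  map_add' x y := by
    apply Subtype.ext
    apply LinearMap.ext
    intro w'
    change pairingSign n j k • F.top (F.ofForm j (x + y) * F.ofForm m w') =
      pairingSign n j k • F.top (F.ofForm j x * F.ofForm m w') +
        pairingSign n j k • F.top (F.ofForm j y * F.ofForm m w')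
    rw [map_add, add_mul, map_add, smul_add]
  map_smul' c x := by
    apply Subtype.ext
    apply LinearMap.ext
    intro w'
    change pairingSign n j k • F.top (F.ofForm j (c • x) * F.ofForm m w') =
      c • (pairingSign n j k • F.top (F.ofForm j x * F.ofForm m w'))
    rw [map_smul, smul_mul_assoc, map_smul, smul_comm]

theorem pairing_apply {j m : ℕ} (h : j + m = n) (w : F.calculus.Form j) (w' : F.calculus.Form m) :
    (F.pairing j m h w).1 w' = pairingSign n j k • F.top (F.ofForm j w * F.ofForm m w') := rfl

theorem pairing_bijective {j m : ℕ} (h : j + m = n) : Function.Bijective (F.pairing j m h) := by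
  constructor
  · rw [injective_iff_map_eq_zero]
    intro w hw
    apply F.ofForm_injective
    rw [map_zero]
    refine F.eq_zero_of_top h (F.ofForm_mem w) fun y hy => ?_
    have h1 : (F.pairing j m h w).1 (F.mkForm y hy) = 0 := by rw [hw]; rfl
    rw [pairing_apply, ofForm_mkForm] at h1
    have h2 := congrArg (fun t => pairingSign n j k • t) h1
    simpa only [smul_smul, pairingSign_mul_self, one_smul, smul_zero] using h2
  · intro φ
    obtain ⟨x, hx, hφ⟩ := F.exists_top_eq h φ
    refine ⟨pairingSign n j k • F.mkForm x hx, ?_⟩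
    apply Subtype.ext
    apply LinearMap.ext
    intro w'
    rw [pairing_apply, map_smul, ofForm_mkForm, smul_mul_assoc, map_smul, smul_smul,
      pairingSign_mul_self, one_smul, hφ]

/-- The pairing as an isomorphism between forms and integral forms. -/
def pairingEquiv (j m : ℕ) (h : j + m = n) :
    F.calculus.Form j ≃ₗ[k] F.calculus.IntegralForm m :=
  LinearEquiv.ofBijective (F.pairing j m h) (F.pairing_bijective h)

theorem pairingEquiv_apply {j m : ℕ} (h : j + m = n) (w : F.calculus.Form j) :
    F.pairingEquiv j m h w = F.pairing j m h w := rfl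

theorem diff_mul_of_mem {j : ℕ} {x y : E} (hx : x ∈ F.forms j) :
    F.diff (x * y) = F.diff x * y + (-1 : k) ^ j • (x * F.diff y) := by
  rw [diff_mul, F.parity_forms hx, smul_mul_assoc]

/-- The divergence which corresponds to the differential on forms of degree `n - 1` under the
pairing. -/
def divergence (r : ℕ) (h : r + 1 = n) : F.calculus.Divergence where
  toLin := ((-1 : k) ^ r * pairingSign n r k) •
    (F.top ∘ₗ F.diff ∘ₗ F.ofForm r ∘ₗ (F.pairingEquiv r 1 h).symm.toLinearMap)
  leibniz := by
    intro φ a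
    obtain ⟨w, rfl⟩ := (F.pairingEquiv r 1 h).surjective φ
    have h1 : F.calculus.ractI (F.pairingEquiv r 1 h w) a =
        F.pairingEquiv r 1 h (F.calculus.rmul w a) := by
      apply Subtype.ext
      apply LinearMap.ext
      intro w'
      change (F.pairing r 1 h w).1 (F.calculus.lmul a w') =
        (F.pairing r 1 h (F.calculus.rmul w a)).1 w'
      rw [pairing_apply, pairing_apply, ofForm_lmul, ofForm_rmul, mul_assoc]
    rw [h1]
    simp only [LinearMap.smul_apply, LinearMap.comp_apply, LinearEquiv.coe_coe,
      LinearEquiv.symm_apply_apply]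
    rw [ofForm_rmul, F.diff_mul_of_mem (F.ofForm_mem w), map_add, map_smul,
      F.top_mul_ρ (F.forms_le _ (F.diff_mem (F.ofForm_mem w))), smul_add, smul_mul_assoc]
    congr 1
    change _ = (F.pairing r 1 h w).1 (F.calculus.dAlg a)
    rw [pairing_apply, smul_smul, mul_right_comm, ← mul_pow]
    simp only [mul_neg, mul_one, neg_neg, one_pow, one_mul]
    rfl

theorem divergence_toLin {r : ℕ} (h : r + 1 = n) (w : F.calculus.Form r) :
    (F.divergence r h).toLin (F.pairing r 1 h w) =
      ((-1 : k) ^ r * pairingSign n r k) • F.top (F.diff (F.ofForm r w)) := by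
  rw [← pairingEquiv_apply]
  simp [divergence]

/-- The extension of the divergence to all integral forms corresponds to the differential under the
pairing: the differential of a product `ω ∧ ω'` with `ω'` of complementary degree minus one splits
by the graded Leibniz rule, and the signs cancel the second term in the definition of the extension.
-/
theorem ext_pairing {r : ℕ} (hr : r + 1 = n) {j m : ℕ} (h : j + (m + 1) = n) (h' : j + 1 + m = n)
    (w : F.calculus.Form j) :
    (F.divergence r hr).ext m (F.pairing j (m + 1) h w) =
      F.pairing (j + 1) m h' (F.calculus.dForm j w) := by
  have hjm : j + m = r := by omega
  subst hjm
  apply Subtype.ext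
  apply LinearMap.ext
  intro w'
  change (F.divergence (j + m) hr).toLin (F.calculus.act (F.pairing j (m + 1) h w) w') +
    (-1) ^ (m + 1) * (F.pairing j (m + 1) h w).1 (F.calculus.dForm m w') = _
  have h1 : F.calculus.act (F.pairing j (m + 1) h w) w' =
      (pairingSign n j k * pairingSign n (j + m) k) •
        F.pairing (j + m) 1 hr (F.calculus.wedge w w') := by
    apply Subtype.ext
    apply LinearMap.ext
    intro w''
    change (F.pairing j (m + 1) h w).1 (F.calculus.wedge w' w'') =
      (pairingSign n j k * pairingSign n (j + m) k) •
        (F.pairing (j + m) 1 hr (F.calculus.wedge w w')).1 w''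
    rw [pairing_apply, pairing_apply, ofForm_wedge, ofForm_wedge, smul_smul, mul_assoc
      (pairingSign n j k), pairingSign_mul_self, mul_one, mul_assoc]
  have h2 : ((-1 : A)) ^ (m + 1) * (F.pairing j (m + 1) h w).1 (F.calculus.dForm m w') =
      (-1 : k) ^ (m + 1) • (F.pairing j (m + 1) h w).1 (F.calculus.dForm m w') := by
    rw [Algebra.smul_def]
    simp
  rw [h1, h2, map_smul, divergence_toLin, ofForm_wedge, F.diff_mul_of_mem (F.ofForm_mem w),
    map_add, map_smul, pairing_apply, pairing_apply, ofForm_dForm, ofForm_dForm, pairingSign_succ]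
  simp only [smul_add, smul_smul]
  have e1 : pairingSign n j k * pairingSign n (j + m) k *
      ((-1) ^ (j + m) * pairingSign n (j + m) k) = (-1) ^ (j + m) * pairingSign n j k := by
    linear_combination ((-1) ^ (j + m) * pairingSign n j k) *
      pairingSign_mul_self (k := k) (n := n) (j + m)
  have e2 : (-1 : k) ^ (n + 1) = (-1) ^ (j + m) := by
    rw [← hr, add_assoc, pow_add]
    simp
  have e3 : (-1 : k) ^ (j + m) * (-1) ^ j = (-1) ^ m := by
    rw [← pow_add, show j + m + j = 2 * j + m by ring, pow_add, pow_mul]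
    simp
  rw [e1, e2]
  have e4 : (-1 : k) ^ (j + m) * pairingSign n j k * (-1) ^ j = (-1) ^ m * pairingSign n j k := by
    rw [mul_right_comm, e3]
  have e5 : pairingSign n j k * pairingSign n (j + m) k *
      ((-1) ^ (j + m) * pairingSign n (j + m) k * (-1) ^ j) = (-1) ^ m * pairingSign n j k := by
    rw [← mul_assoc, e1, e4]
  rw [e5, pow_succ, add_assoc, ← add_smul]
  simp

/-- Flatness is the image of `d ∘ d = 0` under the pairing; integral forms of degree above `n`
vanish. -/
theorem divergence_isFlat {r : ℕ} (hr : r + 1 = n) : (F.divergence r hr).IsFlat := by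
  intro m φ
  by_cases hm : m + 2 ≤ n
  · obtain ⟨j, hj⟩ := Nat.exists_eq_add_of_le' hm
    have h : j + (m + 1 + 1) = n := hj.symm
    obtain ⟨w, rfl⟩ := (F.pairing_bijective h).2 φ
    rw [F.ext_pairing hr h (by omega), F.ext_pairing hr (by omega) (by omega)]
    have : F.calculus.dForm (j + 1) (F.calculus.dForm j w) = 0 :=
      Subtype.ext (F.calculus.d_d _)
    rw [this, map_zero]
  · -- there are no nonzero forms of degree greater than `n`
    have h0 : φ = 0 := by
      apply Subtype.ext
      apply LinearMap.ext
      intro w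
      have : w = 0 := by
        apply F.ofForm_injective
        have h1 := F.mem_forms_iff.1 (F.ofForm_mem w)
        rw [← F.sum_ev h1.1, map_zero]
        refine Finset.sum_eq_zero fun S _ => ?_
        rw [h1.2 S]
        · simp
        · have := Finset.card_le_univ S
          rw [Fintype.card_fin] at this
          omega
      rw [this, map_zero, map_zero]
    have hz : ∀ l, (F.divergence r hr).ext l 0 = 0 := by
      intro l
      apply Subtype.ext
      apply LinearMap.ext
      intro w
      change (F.divergence r hr).toLin (F.calculus.act 0 w) + (-1) ^ (l + 1) * 0 = 0
      have : F.calculus.act (0 : F.calculus.IntegralForm (l + 1)) w = 0 := rfl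
      rw [this, map_zero, mul_zero, add_zero]
    rw [h0, hz, hz]

theorem calculus_isIntegrable (hn : 1 ≤ n) : F.calculus.IsIntegrable n := by
  obtain ⟨r, rfl⟩ : ∃ r, n = r + 1 := ⟨n - 1, by omega⟩
  refine ⟨F.divergence r rfl, F.ν, F.pairingEquiv, F.divergence_isFlat rfl, ?_, ?_, ?_⟩
  · intro j m h a w
    apply Subtype.ext
    apply LinearMap.ext
    intro w'
    change (F.pairing j m h (F.calculus.lmul a w)).1 w' = F.ν a * (F.pairing j m h w).1 w'
    rw [pairing_apply, pairing_apply, ofForm_lmul, mul_assoc, F.top_ρ_mul, mul_smul_comm]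
    exact F.forms_mul_mem h (F.ofForm_mem w) (F.ofForm_mem w')
  · intro j m h w b
    apply Subtype.ext
    apply LinearMap.ext
    intro w'
    change (F.pairing j m h (F.calculus.rmul w b)).1 w' =
      (F.pairing j m h w).1 (F.calculus.lmul b w')
    rw [pairing_apply, pairing_apply, ofForm_lmul, ofForm_rmul, mul_assoc]
  · intro j m h h' w
    exact (F.ext_pairing rfl h h' w).symm

/-- A frame with `n ≥ 1` basic one-forms yields an `n`-dimensional connected integrable
differential calculus. -/
theorem exists_calculus [Nontrivial A] (F : FormFrame k A n E) (hn : 1 ≤ n) :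
    ∃ C : DifferentialCalculus k A, C.HasDimension n ∧ C.IsConnected ∧ C.IsIntegrable n :=
  ⟨F.calculus, F.calculus_hasDimension, F.calculus_isConnected, F.calculus_isIntegrable hn⟩

end FormFrame

/-! ### Operators on a free module with a quantum exterior basis -/

namespace FormModel

variable {k : Type v} [Field k] {A : Type u} [Ring A] [Algebra k A] {m : ℕ}

/-- The coefficient `∏ κ i s` over the elements `s < i` of `S`. -/
def swapCoeff (κ : Fin m → Fin m → k) (i : Fin m) (S : Finset (Fin m)) : k :=
  ∏ s ∈ S with s < i, κ i s

theorem swapCoeff_insert_lt {κ : Fin m → Fin m → k} {i j : Fin m} {S : Finset (Fin m)} (h : j < i)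
    (hj : j ∉ S) : swapCoeff κ i (insert j S) = κ i j * swapCoeff κ i S := by
  rw [swapCoeff, Finset.filter_insert, if_pos h, Finset.prod_insert, swapCoeff]
  simp [hj]

theorem swapCoeff_insert_of_le {κ : Fin m → Fin m → k} {i j : Fin m} {S : Finset (Fin m)}
    (h : i ≤ j) : swapCoeff κ i (insert j S) = swapCoeff κ i S := by
  rw [swapCoeff, Finset.filter_insert, if_neg h.not_gt, swapCoeff]

theorem swapCoeff_erase_of_le {κ : Fin m → Fin m → k} {i j : Fin m} {S : Finset (Fin m)}
    (h : i ≤ j) : swapCoeff κ i (S.erase j) = swapCoeff κ i S := by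
  by_cases hj : j ∈ S
  · conv_rhs => rw [← Finset.insert_erase hj, swapCoeff_insert_of_le h]
  · rw [Finset.erase_eq_of_notMem hj]

theorem swapCoeff_of_lt {κ : Fin m → Fin m → k} {i j : Fin m} {S : Finset (Fin m)} (h : j < i)
    (hj : j ∈ S) : swapCoeff κ i S = κ i j * swapCoeff κ i (S.erase j) := by
  conv_lhs => rw [← Finset.insert_erase hj]
  exact swapCoeff_insert_lt h (Finset.notMem_erase j S)

variable (A)

/-- Left multiplication by the `i`-th generator on the free right `A`-module with basis the ordered
products of generators `ω` subject to `ω i ω i = 0` and `ω i ω j = κ i j ω j ω i` for `j < i`.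
An element is the function sending a set `S` to the coefficient of the ordered product over `S`. -/
def wedgeOp (κ : Fin m → Fin m → k) (i : Fin m) : Module.End k (Finset (Fin m) → A) where
  toFun y S := if i ∈ S then swapCoeff κ i S • y (S.erase i) else 0
  map_add' x y := by
    funext S
    by_cases h : i ∈ S <;> simp [h]
  map_smul' c y := by
    funext S
    by_cases h : i ∈ S <;> simp [h, smul_comm c]

/-- Contraction with the dual of the `i`-th generator. -/
def contractOp (κ : Fin m → Fin m → k) (i : Fin m) : Module.End k (Finset (Fin m) → A) where
  toFun y S := if i ∈ S then 0 else swapCoeff κ i S • y (insert i S)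
  map_add' x y := by
    funext S
    by_cases h : i ∈ S <;> simp [h]
  map_smul' c y := by
    funext S
    by_cases h : i ∈ S <;> simp [h, smul_comm c]

variable {A}

theorem wedgeOp_apply (κ : Fin m → Fin m → k) (i : Fin m) (y : Finset (Fin m) → A)
    (S : Finset (Fin m)) :
    wedgeOp A κ i y S = if i ∈ S then swapCoeff κ i S • y (S.erase i) else 0 := rfl

theorem contractOp_apply (κ : Fin m → Fin m → k) (i : Fin m) (y : Finset (Fin m) → A)
    (S : Finset (Fin m)) :
    contractOp A κ i y S = if i ∈ S then 0 else swapCoeff κ i S • y (insert i S) := rfl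

variable (κ : Fin m → Fin m → k)

theorem wedgeOp_mul_self (i : Fin m) : wedgeOp A κ i * wedgeOp A κ i = 0 := by
  apply LinearMap.ext
  intro y
  funext S
  simp [wedgeOp_apply]

theorem contractOp_mul_self (i : Fin m) : contractOp A κ i * contractOp A κ i = 0 := by
  apply LinearMap.ext
  intro y
  funext S
  simp [contractOp_apply]

theorem wedgeOp_mul_wedgeOp {i j : Fin m} (h : j < i) :
    wedgeOp A κ i * wedgeOp A κ j = κ i j • (wedgeOp A κ j * wedgeOp A κ i) := by
  apply LinearMap.ext
  intro y
  funext S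
  simp only [Module.End.mul_apply, wedgeOp_apply, LinearMap.smul_apply, Pi.smul_apply,
    Finset.mem_erase]
  by_cases hi : i ∈ S <;> by_cases hj : j ∈ S
  · rw [if_pos hi, if_pos ⟨h.ne, hj⟩, if_pos hj, if_pos ⟨h.ne', hi⟩, smul_smul, smul_smul,
      smul_smul, swapCoeff_of_lt h hj, swapCoeff_erase_of_le h.le, Finset.erase_right_comm]
    congr 1
    ring
  all_goals simp [hi, hj]

theorem contractOp_mul_wedgeOp_of_lt {i j : Fin m} (h : i < j) :
    contractOp A κ i * wedgeOp A κ j = κ j i • (wedgeOp A κ j * contractOp A κ i) := by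
  apply LinearMap.ext
  intro y
  funext S
  simp only [Module.End.mul_apply, wedgeOp_apply, contractOp_apply, LinearMap.smul_apply,
    Pi.smul_apply, Finset.mem_erase, Finset.mem_insert]
  by_cases hi : i ∈ S <;> by_cases hj : j ∈ S
  · simp [hi, hj, h.ne]
  · simp [hi, hj]
  · rw [if_neg hi, if_pos (Or.inr hj), if_pos hj, if_neg (by tauto), smul_smul, smul_smul,
      smul_smul, swapCoeff_insert_lt h hi, swapCoeff_erase_of_le h.le,
      Finset.erase_insert_of_ne h.ne]
    congr 1
    ring
  · simp [hi, hj, h.ne']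

theorem contractOp_mul_wedgeOp_of_gt {i j : Fin m} (h : j < i) :
    contractOp A κ i * wedgeOp A κ j = κ i j • (wedgeOp A κ j * contractOp A κ i) := by
  apply LinearMap.ext
  intro y
  funext S
  simp only [Module.End.mul_apply, wedgeOp_apply, contractOp_apply, LinearMap.smul_apply,
    Pi.smul_apply, Finset.mem_erase, Finset.mem_insert]
  by_cases hi : i ∈ S <;> by_cases hj : j ∈ S
  · simp [hi, hj, h.ne']
  · simp [hi, hj]
  · rw [if_neg hi, if_pos (Or.inr hj), if_pos hj, if_neg (by tauto), smul_smul, smul_smul,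
      smul_smul, swapCoeff_insert_of_le h.le, swapCoeff_of_lt h hj,
      Finset.erase_insert_of_ne h.ne']
    congr 1
    ring
  · simp [hi, hj, h.ne]

theorem contractOp_mul_wedgeOp_self {i : Fin m} (h : ∀ j < i, κ i j * κ i j = 1) :
    contractOp A κ i * wedgeOp A κ i + wedgeOp A κ i * contractOp A κ i = 1 := by
  have hsq : ∀ S, swapCoeff κ i S * swapCoeff κ i S = 1 := by
    intro S
    rw [swapCoeff, ← Finset.prod_mul_distrib]
    refine Finset.prod_eq_one fun j hj => h j (Finset.mem_filter.1 hj).2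
  apply LinearMap.ext
  intro y
  funext S
  simp only [Module.End.mul_apply, wedgeOp_apply, contractOp_apply, LinearMap.add_apply,
    Pi.add_apply, Finset.mem_erase, Finset.mem_insert, Module.End.one_apply]
  by_cases hi : i ∈ S
  · simp [hi, smul_smul, swapCoeff_erase_of_le le_rfl, hsq]
  · simp [hi, smul_smul, swapCoeff_insert_of_le le_rfl, hsq]

theorem wedgeOp_single {i : Fin m} {S : Finset (Fin m)} (h : ∀ j ∈ S, i < j) (a : A) :
    wedgeOp A κ i (Pi.single S a) = Pi.single (insert i S) a := by
  have hi : i ∉ S := fun hi => lt_irrefl _ (h i hi)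
  funext T
  rw [wedgeOp_apply]
  by_cases hT : T = insert i S
  · subst hT
    have : swapCoeff κ i (insert i S) = 1 := by
      rw [swapCoeff_insert_of_le le_rfl, swapCoeff, Finset.filter_false_of_mem, Finset.prod_empty]
      exact fun j hj => (h j hj).not_gt
    rw [if_pos (Finset.mem_insert_self _ _), this, Finset.erase_insert hi, one_smul]
    simp
  · rw [Pi.single_eq_of_ne hT]
    split_ifs with hiT
    · rw [Pi.single_eq_of_ne, smul_zero]
      rintro rfl
      exact hT (Finset.insert_erase hiT).symm
    · rfl

theorem orderedForm_single {n : ℕ} (f : Fin n ↪o Fin m) (S : Finset (Fin n)) (a : A) :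
    orderedForm (fun i => wedgeOp A κ (f i)) S (Pi.single ∅ a) =
      Pi.single (S.map f.toEmbedding) a := by
  induction S using Finset.induction_on_min with
  | empty => simp
  | insert b S hb ih =>
    rw [FormFrame.orderedForm_insert _ hb, Module.End.mul_apply, ih, Finset.map_insert]
    refine wedgeOp_single κ ?_ a
    intro j hj
    obtain ⟨l, hl, rfl⟩ := Finset.mem_map.1 hj
    exact f.lt_iff_lt.2 (hb l hl)

/-- The coefficients with respect to the ordered products over the sets `S.map f` of the result of
applying an operator to the vacuum vector.  The embedding `f` selects the generators which serve as
one-forms; the remaining ones are auxiliary. -/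
def coeffAtVacuum {n : ℕ} (f : Fin n ↪o Fin m) :
    Module.End k (Finset (Fin m) → A) →ₗ[k] (Finset (Fin n) → A) where
  toFun T S := T (Pi.single ∅ 1) (S.map f.toEmbedding)
  map_add' _ _ := rfl
  map_smul' _ _ := rfl

theorem coeffAtVacuum_orderedForm {n : ℕ} (f : Fin n ↪o Fin m)
    {T : Module.End k (Finset (Fin m) → A)} {a : A} (hT : T (Pi.single ∅ 1) = Pi.single ∅ a)
    (S : Finset (Fin n)) :
    coeffAtVacuum f (orderedForm (fun i => wedgeOp A κ (f i)) S * T) = Pi.single S a := by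
  funext S'
  change (orderedForm (fun i => wedgeOp A κ (f i)) S * T) (Pi.single ∅ 1) (S'.map f.toEmbedding) = _
  rw [Module.End.mul_apply, hT, orderedForm_single]
  by_cases h : S' = S
  · subst h
    simp
  · rw [Pi.single_eq_of_ne h, Pi.single_eq_of_ne]
    exact fun h' => h (Finset.map_injective _ h')

section parity

/-- The operator `y S ↦ (-1) ^ |S| y S`. -/
def signOp (k : Type v) [Field k] (A : Type u) [Ring A] [Algebra k A] (m : ℕ) :
    Module.End k (Finset (Fin m) → A) where
  toFun y S := (-1 : k) ^ S.card • y S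
  map_add' x y := by
    funext S
    simp
  map_smul' c y := by
    funext S
    simp [smul_comm c]

theorem signOp_apply (y : Finset (Fin m) → A) (S : Finset (Fin m)) :
    signOp k A m y S = (-1 : k) ^ S.card • y S := rfl

theorem signOp_mul_self : signOp k A m * signOp k A m = 1 := by
  apply LinearMap.ext
  intro y
  funext S
  simp only [Module.End.mul_apply, signOp_apply, smul_smul, ← mul_pow, Module.End.one_apply]
  simp

/-- Conjugation with the sign operator. -/
def parityHom (k : Type v) [Field k] (A : Type u) [Ring A] [Algebra k A] (m : ℕ) :
    Module.End k (Finset (Fin m) → A) →ₐ[k] Module.End k (Finset (Fin m) → A) :=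
  AlgHom.ofLinearMap
    (LinearMap.mulLeft k (signOp k A m) ∘ₗ LinearMap.mulRight k (signOp k A m))
    (by simp [signOp_mul_self])
    (by
      intro x y
      simp only [LinearMap.comp_apply, LinearMap.mulLeft_apply, LinearMap.mulRight_apply]
      calc _ = signOp k A m * (x * 1 * y * signOp k A m) := by rw [mul_one]
        _ = _ := by rw [← signOp_mul_self (k := k) (A := A) (m := m)]; simp only [mul_assoc])

theorem parityHom_apply (x : Module.End k (Finset (Fin m) → A)) :
    parityHom k A m x = signOp k A m * (x * signOp k A m) := rfl

theorem parityHom_of_comm {x : Module.End k (Finset (Fin m) → A)}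
    (h : signOp k A m * x = x * signOp k A m) : parityHom k A m x = x := by
  rw [parityHom_apply, ← mul_assoc, h, mul_assoc, signOp_mul_self, mul_one]

theorem parityHom_of_anticomm {x : Module.End k (Finset (Fin m) → A)}
    (h : signOp k A m * x = -(x * signOp k A m)) : parityHom k A m x = -x := by
  have h2 : x * signOp k A m * signOp k A m = x := by rw [mul_assoc, signOp_mul_self, mul_one]
  rw [parityHom_apply, ← mul_assoc, h]
  exact (LinearMap.neg_comp _ _).trans (congrArg Neg.neg h2)

theorem parityHom_wedgeOp (i : Fin m) : parityHom k A m (wedgeOp A κ i) = -wedgeOp A κ i := by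
  apply parityHom_of_anticomm
  apply LinearMap.ext
  intro y
  funext S
  simp only [Module.End.mul_apply, signOp_apply, wedgeOp_apply, LinearMap.neg_apply, Pi.neg_apply]
  by_cases h : i ∈ S
  · rw [if_pos h, if_pos h, smul_smul, smul_smul, ← neg_smul]
    congr 1
    have := Finset.card_erase_add_one h
    rw [← this, pow_succ]
    ring
  · simp [h]

theorem parityHom_contractOp (i : Fin m) :
    parityHom k A m (contractOp A κ i) = -contractOp A κ i := by
  apply parityHom_of_anticomm
  apply LinearMap.ext
  intro y
  funext S
  simp only [Module.End.mul_apply, signOp_apply, contractOp_apply, LinearMap.neg_apply,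
    Pi.neg_apply]
  by_cases h : i ∈ S
  · simp [h]
  · rw [if_neg h, if_neg h, smul_smul, smul_smul, ← neg_smul, Finset.card_insert_of_notMem h,
      pow_succ]
    congr 1
    ring

end parity

section coefficients

variable {G : Type*} [CommMonoid G] (τ : G →* (A →ₐ[k] A)) (γ : Fin m → G)

/-- Left multiplication by elements of `A` when the generator `ω i` satisfies
`a ω i = ω i τ (γ i) a`. -/
def coeffHom : A →ₐ[k] Module.End k (Finset (Fin m) → A) where
  toFun x :=
    { toFun := fun y S => τ (∏ s ∈ S, γ s) x * y S
      map_add' := fun y z => by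
        funext S
        simp [mul_add]
      map_smul' := fun c y => by
        funext S
        simp }
  map_one' := by
    apply LinearMap.ext
    intro y
    funext S
    simp
  map_mul' x z := by
    apply LinearMap.ext
    intro y
    funext S
    simp [mul_assoc]
  map_zero' := by
    apply LinearMap.ext
    intro y
    funext S
    simp
  map_add' x z := by
    apply LinearMap.ext
    intro y
    funext S
    simp [add_mul]
  commutes' c := by
    apply LinearMap.ext
    intro y
    funext S
    simp [Algebra.smul_def]

theorem coeffHom_apply (x : A) (y : Finset (Fin m) → A) (S : Finset (Fin m)) :
    coeffHom τ γ x y S = τ (∏ s ∈ S, γ s) x * y S := rfl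

theorem coeffHom_mul_wedgeOp (x : A) (i : Fin m) :
    coeffHom τ γ x * wedgeOp A κ i = wedgeOp A κ i * coeffHom τ γ (τ (γ i) x) := by
  apply LinearMap.ext
  intro y
  funext S
  simp only [Module.End.mul_apply, coeffHom_apply, wedgeOp_apply]
  by_cases h : i ∈ S
  · rw [if_pos h, if_pos h, mul_smul_comm, ← Finset.prod_erase_mul _ _ h, map_mul]
    rfl
  · simp [h]

theorem contractOp_mul_coeffHom (x : A) (i : Fin m) :
    contractOp A κ i * coeffHom τ γ x = coeffHom τ γ (τ (γ i) x) * contractOp A κ i := by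
  apply LinearMap.ext
  intro y
  funext S
  simp only [Module.End.mul_apply, coeffHom_apply, contractOp_apply]
  by_cases h : i ∈ S
  · simp [h]
  · rw [if_neg h, if_neg h, mul_smul_comm, Finset.prod_insert h, mul_comm, map_mul]
    rfl

theorem coeffHom_vacuum (x : A) :
    coeffHom τ γ x (Pi.single ∅ 1) = Pi.single ∅ x := by
  funext S
  rw [coeffHom_apply]
  by_cases h : S = ∅
  · subst h
    simp
  · rw [Pi.single_eq_of_ne h, Pi.single_eq_of_ne h, mul_zero]

theorem parityHom_coeffHom (x : A) : parityHom k A m (coeffHom τ γ x) = coeffHom τ γ x := by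
  apply parityHom_of_comm
  apply LinearMap.ext
  intro y
  funext S
  simp [signOp_apply, coeffHom_apply]

theorem contractOp_vacuum (i : Fin m) (a : A) : contractOp A κ i (Pi.single ∅ a) = 0 := by
  funext S
  rw [contractOp_apply]
  split_ifs
  · rfl
  · rw [Pi.single_eq_of_ne (Finset.insert_ne_empty _ _), smul_zero]
    rfl

end coefficients

end FormModel

/-! ### Spans of commutators -/

/-- The span of the elements `a [θ, b]` is stable under right multiplication by `A`. -/
theorem span_commutator_mul_mem {k : Type v} [Field k] {A : Type u} [Ring A] [Algebra k A]
    {E : Type u} [Ring E] [Algebra k E] (ρ : A →ₐ[k] E) (θ : E) {y : E}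
    (hy : y ∈ Submodule.span k {x | ∃ a b, x = ρ a * (θ * ρ b - ρ b * θ)}) (c : A) :
    y * ρ c ∈ Submodule.span k {x | ∃ a b, x = ρ a * (θ * ρ b - ρ b * θ)} := by
  induction hy using Submodule.span_induction with
  | mem x h =>
    obtain ⟨a, b, rfl⟩ := h
    have : ρ a * (θ * ρ b - ρ b * θ) * ρ c = ρ a * (θ * ρ (b * c) - ρ (b * c) * θ) -
        ρ (a * b) * (θ * ρ c - ρ c * θ) := by
      simp only [map_mul]
      noncomm_ring
    rw [this]
    exact Submodule.sub_mem _ (Submodule.subset_span ⟨_, _, rfl⟩)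
      (Submodule.subset_span ⟨_, _, rfl⟩)
  | zero => simp
  | add x y _ _ hx hy =>
    rw [add_mul]
    exact Submodule.add_mem _ hx hy
  | smul r x _ hx =>
    rw [smul_mul_assoc]
    exact Submodule.smul_mem _ _ hx

theorem mul_span_commutator_mem {k : Type v} [Field k] {A : Type u} [Ring A] [Algebra k A]
    {E : Type u} [Ring E] [Algebra k E] (ρ : A →ₐ[k] E) (θ : E) {y : E}
    (hy : y ∈ Submodule.span k {x | ∃ a b, x = ρ a * (θ * ρ b - ρ b * θ)}) (c : A) :
    ρ c * y ∈ Submodule.span k {x | ∃ a b, x = ρ a * (θ * ρ b - ρ b * θ)} := by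
  induction hy using Submodule.span_induction with
  | mem x h =>
    obtain ⟨a, b, rfl⟩ := h
    rw [← mul_assoc, ← map_mul]
    exact Submodule.subset_span ⟨_, _, rfl⟩
  | zero => simp
  | add x y _ _ hx hy =>
    rw [mul_add]
    exact Submodule.add_mem _ hx hy
  | smul r x _ hx =>
    rw [mul_smul_comm]
    exact Submodule.smul_mem _ _ hx

/-! ### Divided powers of a twisted derivation -/

/-- Summation of a function supported in `i + j < m` by diagonals. -/
theorem sum_range_sum_antidiagonal {M : Type*} [AddCommMonoid M] (f : ℕ → ℕ → M) (m : ℕ)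
    (h : ∀ i j, m ≤ i + j → f i j = 0) :
    ∑ r ∈ Finset.range m, ∑ p ∈ Finset.HasAntidiagonal.antidiagonal r, f p.1 p.2 =
      ∑ i ∈ Finset.range m, ∑ j ∈ Finset.range m, f i j := by
  rw [← Finset.sum_product', Finset.sum_sigma']
  refine Finset.sum_bij_ne_zero (fun p _ _ => p.2) ?_ ?_ ?_ ?_
  · rintro ⟨r, p⟩ hp -
    simp only [Finset.mem_sigma, Finset.mem_range, Finset.HasAntidiagonal.mem_antidiagonal] at hp
    simp only [Finset.mem_product, Finset.mem_range]
    omega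
  · rintro ⟨r, p⟩ hp - ⟨r', p'⟩ hp' - rfl
    simp only [Finset.mem_sigma, Finset.mem_range,
      Finset.HasAntidiagonal.mem_antidiagonal] at hp hp'
    have : r = r' := by omega
    subst this
    rfl
  · rintro ⟨i, j⟩ - hne
    have hlt : i + j < m := by
      by_contra hlt
      exact hne (h i j (not_lt.1 hlt))
    exact ⟨⟨i + j, (i, j)⟩, by simp [hlt], hne, rfl⟩
  · intros
    rfl

namespace TwistedDerivation

variable {k : Type v} [Field k] {A : Type u} [Ring A] [Algebra k A]
  (σ : A →ₐ[k] A) (δ : A →ₗ[k] A)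

/-- Iterates of a twisted derivation commuting with its twist satisfy the binomial Leibniz rule. -/
theorem pow_apply_mul (hδ : ∀ x y, δ (x * y) = δ x * y + σ x * δ y) (hc : ∀ x, σ (δ x) = δ (σ x))
    (r : ℕ) (x y : A) :
    (δ ^ r) (x * y) = ∑ p ∈ Finset.HasAntidiagonal.antidiagonal r,
      r.choose p.1 • ((δ ^ p.1) ((σ ^ p.2) x) * (δ ^ p.2) y) := by
  have hcp : ∀ i (x : A), σ ((δ ^ i) x) = (δ ^ i) (σ x) := by
    intro i
    induction i with
    | zero => intro x; rfl
    | succ i ih =>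
      intro x
      rw [pow_succ', Module.End.mul_apply, Module.End.mul_apply, hc, ih]
  induction r with
  | zero => simp
  | succ r ih =>
    rw [Finset.sum_antidiagonal_choose_succ_nsmul
      (fun i j => (δ ^ i) ((σ ^ j) x) * (δ ^ j) y), pow_succ', Module.End.mul_apply, ih, map_sum,
      ← Finset.sum_add_distrib]
    refine Finset.sum_congr rfl fun p hp => ?_
    have hsymm : r.choose p.2 = r.choose p.1 := by
      rw [Finset.HasAntidiagonal.mem_antidiagonal] at hp
      rw [← Nat.choose_symm_of_eq_add hp.symm]
    rw [hsymm, ← smul_add, map_nsmul, hδ, hcp, add_comm]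
    congr 2
    · rw [pow_succ' σ, pow_succ' δ]
      rfl
    · rw [pow_succ' δ]
      rfl

/-- The divided power `δ ^ r / r!`. -/
def divPow (r : ℕ) : A →ₗ[k] A := ((r.factorial : k)⁻¹) • δ ^ r

theorem divPow_apply (r : ℕ) (x : A) : divPow δ r x = ((r.factorial : k)⁻¹) • (δ ^ r) x := rfl

@[simp] theorem divPow_zero (x : A) : divPow δ 0 x = x := by simp [divPow_apply]

@[simp] theorem divPow_one (x : A) : divPow δ 1 x = δ x := by simp [divPow_apply]

theorem inv_factorial_mul_choose [CharZero k] {r i j : ℕ} (h : i + j = r) :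
    ((r.factorial : k)⁻¹) * (r.choose i : k) = ((i.factorial : k)⁻¹) * ((j.factorial : k)⁻¹) := by
  subst h
  have h1 : (i.factorial : k) ≠ 0 := Nat.cast_ne_zero.2 (Nat.factorial_ne_zero _)
  have h2 : (j.factorial : k) ≠ 0 := Nat.cast_ne_zero.2 (Nat.factorial_ne_zero _)
  have h3 : ((i + j).factorial : k) ≠ 0 := Nat.cast_ne_zero.2 (Nat.factorial_ne_zero _)
  have h4 : ((i + j).choose i : k) * i.factorial * j.factorial = (i + j).factorial := by
    rw [Nat.choose_symm_add]
    exact_mod_cast Nat.add_choose_mul_factorial_mul_factorial i j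
  field_simp
  linear_combination h4

theorem divPow_mul [CharZero k] (hδ : ∀ x y, δ (x * y) = δ x * y + σ x * δ y)
    (hc : ∀ x, σ (δ x) = δ (σ x)) (r : ℕ) (x y : A) :
    divPow δ r (x * y) = ∑ p ∈ Finset.HasAntidiagonal.antidiagonal r,
      divPow δ p.1 ((σ ^ p.2) x) * divPow δ p.2 y := by
  rw [divPow_apply, pow_apply_mul σ δ hδ hc, Finset.smul_sum]
  refine Finset.sum_congr rfl fun p hp => ?_
  rw [Finset.HasAntidiagonal.mem_antidiagonal] at hp
  rw [← Nat.cast_smul_eq_nsmul k, smul_smul, inv_factorial_mul_choose hp, divPow_apply,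
    divPow_apply, smul_mul_smul_comm]

theorem divPow_divPow [CharZero k] (i j : ℕ) (x : A) :
    divPow δ i (divPow δ j x) = ((i + j).choose i : k) • divPow δ (i + j) x := by
  rw [divPow_apply, divPow_apply, divPow_apply, map_smul, smul_smul, smul_smul, pow_add,
    Module.End.mul_apply, mul_comm ((i + j).choose i : k), inv_factorial_mul_choose rfl]

theorem map_divPow (hc : ∀ x, σ (δ x) = δ (σ x)) (j r : ℕ) (x : A) :
    (σ ^ j) (divPow δ r x) = divPow δ r ((σ ^ j) x) := by
  have h1 : ∀ r x, σ (divPow δ r x) = divPow δ r (σ x) := by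
    intro r
    induction r with
    | zero => intro x; simp
    | succ r ih =>
      intro x
      rw [divPow_apply, divPow_apply, map_smul]
      congr 1
      have hcp : ∀ i (x : A), σ ((δ ^ i) x) = (δ ^ i) (σ x) := by
        intro i
        induction i with
        | zero => intro x; rfl
        | succ i ih =>
          intro x
          rw [pow_succ', Module.End.mul_apply, Module.End.mul_apply, hc, ih]
      exact hcp _ _
  induction j with
  | zero => rfl
  | succ j ih =>
    rw [pow_succ']
    change σ ((σ ^ j) _) = divPow δ r (σ ((σ ^ j) x))
    rw [ih, h1]

end TwistedDerivation

/-! ### Calculi of jets of a twisted derivation -/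

namespace JetModel

open FormModel TwistedDerivation

variable {k : Type v} [Field k] {A : Type u} [Ring A] [Algebra k A] (n : ℕ)

variable (k A) in
/-- Left multiplication by the `j`-th anticommuting generator among `n + 1`, or `0` if `n < j`. -/
def wedge (j : ℕ) : Module.End k (Finset (Fin (n + 1)) → A) :=
  if h : j < n + 1 then wedgeOp A (fun _ _ => -1) ⟨j, h⟩ else 0

theorem wedge_of_lt {j : ℕ} (h : j < n + 1) :
    wedge k A n j = wedgeOp A (fun _ _ => -1) ⟨j, h⟩ := dif_pos h

theorem wedge_of_le {j : ℕ} (h : n + 1 ≤ j) : wedge k A n j = 0 := dif_neg h.not_gt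

variable (k A) in
/-- The derivation replacing the `i`-th generator by the next one. -/
def shift : Module.End k (Finset (Fin (n + 1)) → A) :=
  ∑ i : Fin n, wedgeOp A (fun _ _ => -1) i.succ * contractOp A (fun _ _ => -1) i.castSucc

theorem wedgeOp_anticomm (i j : Fin (n + 1)) :
    (wedgeOp A (fun _ _ => (-1 : k)) i) * wedgeOp A (fun _ _ => -1) j =
      (-1 : k) • (wedgeOp A (fun _ _ => -1) j * wedgeOp A (fun _ _ => -1) i) := by
  rcases lt_trichotomy j i with h | h | h
  · exact wedgeOp_mul_wedgeOp _ h
  · subst h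
    simp [wedgeOp_mul_self]
  · rw [wedgeOp_mul_wedgeOp _ h, smul_smul]
    simp

theorem contractOp_anticomm {i j : Fin (n + 1)} (h : i ≠ j) :
    (contractOp A (fun _ _ => (-1 : k)) i) * wedgeOp A (fun _ _ => -1) j =
      (-1 : k) • (wedgeOp A (fun _ _ => -1) j * contractOp A (fun _ _ => -1) i) := by
  rcases lt_or_gt_of_ne h with h | h
  · exact contractOp_mul_wedgeOp_of_lt _ h
  · exact contractOp_mul_wedgeOp_of_gt _ h

theorem shift_mul_wedge (j : ℕ) :
    shift k A n * wedge k A n j = wedge k A n j * shift k A n + wedge k A n (j + 1) := by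
  by_cases hj : j < n + 1
  · rw [wedge_of_lt n hj, shift, Finset.sum_mul, Finset.mul_sum]
    have hterm : ∀ i : Fin n, wedgeOp A (fun _ _ => (-1 : k)) i.succ *
        contractOp A (fun _ _ => -1) i.castSucc * wedgeOp A (fun _ _ => -1) ⟨j, hj⟩ =
        wedgeOp A (fun _ _ => -1) ⟨j, hj⟩ * (wedgeOp A (fun _ _ => -1) i.succ *
        contractOp A (fun _ _ => -1) i.castSucc) +
        if (i : ℕ) = j then wedge k A n (j + 1) else 0 := by
      intro i
      by_cases hij : (i : ℕ) = j
      · have hi : i.castSucc = ⟨j, hj⟩ := Fin.ext hij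
        have hs : wedge k A n (j + 1) = wedgeOp A (fun _ _ => -1) i.succ := by
          rw [wedge_of_lt n (by omega)]
          congr 1
          exact Fin.ext (by simp [hij])
        have hself := contractOp_mul_wedgeOp_self (A := A) (fun _ _ => (-1 : k)) (i := i.castSucc)
          (by simp)
        rw [if_pos hij, hs, ← hi, mul_assoc, eq_sub_of_add_eq hself, mul_sub, mul_one,
          ← mul_assoc, ← mul_assoc, wedgeOp_anticomm n i.succ i.castSucc, smul_mul_assoc]
        module
      · rw [if_neg hij, add_zero, mul_assoc, contractOp_anticomm n (fun h => hij (by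
          simpa using congrArg Fin.val h)), mul_smul_comm, ← mul_assoc, wedgeOp_anticomm n i.succ,
          smul_mul_assoc, smul_smul, mul_assoc]
        simp
    rw [Finset.sum_congr rfl fun i _ => hterm i, Finset.sum_add_distrib]
    congr 1
    by_cases hj' : j < n
    · rw [Finset.sum_eq_single (⟨j, hj'⟩ : Fin n)]
      · simp
      · intro i _ hi
        exact if_neg fun h => hi (Fin.ext h)
      · simp
    · rw [wedge_of_le n (by omega)]
      simp
  · rw [wedge_of_le n (by omega), wedge_of_le n (by omega)]
    simp

theorem shift_pow_mul_wedge (r j : ℕ) :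
    shift k A n ^ r * wedge k A n j = ∑ p ∈ Finset.HasAntidiagonal.antidiagonal r,
      r.choose p.1 • (wedge k A n (j + p.1) * shift k A n ^ p.2) := by
  induction r with
  | zero => simp
  | succ r ih =>
    rw [Finset.sum_antidiagonal_choose_succ_nsmul
      (fun i l => wedge k A n (j + i) * shift k A n ^ l), pow_succ', mul_assoc, ih,
      Finset.mul_sum, ← Finset.sum_add_distrib]
    refine Finset.sum_congr rfl fun p hp => ?_
    have hsymm : r.choose p.2 = r.choose p.1 := by
      rw [Finset.HasAntidiagonal.mem_antidiagonal] at hp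
      rw [← Nat.choose_symm_of_eq_add hp.symm]
    rw [hsymm, ← smul_add, mul_smul_comm, ← mul_assoc, shift_mul_wedge, add_mul, mul_assoc,
      ← pow_succ', add_assoc]

theorem shift_apply_eq_zero {y : Finset (Fin (n + 1)) → A} {S : Finset (Fin (n + 1))}
    (h : ∀ i : Fin n, i.succ ∈ S → i.castSucc ∉ S → y (insert i.castSucc (S.erase i.succ)) = 0) :
    shift k A n y S = 0 := by
  rw [shift, LinearMap.sum_apply, Finset.sum_apply]
  refine Finset.sum_eq_zero fun i _ => ?_
  rw [Module.End.mul_apply, wedgeOp_apply]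
  split_ifs with h1
  · rw [contractOp_apply]
    split_ifs with h2
    · rw [smul_zero]
    · rw [h i h1 (fun h3 => h2 (Finset.mem_erase.2 ⟨Fin.castSucc_lt_succ.ne, h3⟩)), smul_zero,
        smul_zero]
  · rfl

theorem shift_pow_apply_eq_zero (y : Finset (Fin (n + 1)) → A) (r : ℕ) (S : Finset (Fin (n + 1)))
    (h : ∑ s ∈ S, (s : ℕ) < r) : (shift k A n ^ r) y S = 0 := by
  induction r generalizing S with
  | zero => simp at h
  | succ r ih =>
    rw [pow_succ', Module.End.mul_apply]
    refine shift_apply_eq_zero n fun i h1 h2 => ih _ ?_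
    rw [Finset.sum_insert (fun h3 => h2 (Finset.mem_of_mem_erase h3))]
    have := Finset.sum_erase_add S (fun s : Fin (n + 1) => (s : ℕ)) h1
    simp only [Fin.val_succ, Fin.val_castSucc] at *
    omega

theorem parityHom_shift : parityHom k A (n + 1) (shift k A n) = shift k A n := by
  rw [shift, map_sum]
  refine Finset.sum_congr rfl fun i _ => ?_
  rw [map_mul, parityHom_wedgeOp, parityHom_contractOp]
  refine LinearMap.ext fun y => ?_
  simp only [Module.End.mul_apply, LinearMap.neg_apply, map_neg, neg_neg]

/-- A bound for the nilpotency degree of `shift`. -/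
def shiftBound : ℕ := ∑ s : Fin (n + 1), (s : ℕ) + 1

theorem shift_pow_eq_zero {r : ℕ} (h : shiftBound n ≤ r) : shift k A n ^ r = 0 := by
  apply LinearMap.ext
  intro y
  funext S
  refine shift_pow_apply_eq_zero n y r S (lt_of_lt_of_le (Nat.lt_succ_of_le ?_) h)
  exact Finset.sum_le_sum_of_subset (Finset.subset_univ S)

section

variable (σ : A →ₐ[k] A)

/-- Multiplication by elements of `A`, where `a ωⱼ = ωⱼ σ ^ j a` for the generators `ωⱼ`. -/
def coeff : A →ₐ[k] Module.End k (Finset (Fin (n + 1)) → A) :=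
  coeffHom (powersHom (A →ₐ[k] A) σ) (fun i => Multiplicative.ofAdd (i : ℕ))

theorem coeff_mul_wedge (x : A) (j : ℕ) :
    coeff n σ x * wedge k A n j = wedge k A n j * coeff n σ ((σ ^ j) x) := by
  by_cases hj : j < n + 1
  · rw [wedge_of_lt n hj, coeff, coeffHom_mul_wedgeOp]
    simp
  · rw [wedge_of_le n (not_lt.1 hj)]
    simp

theorem coeff_mul_shift (x : A) :
    coeff n σ x * shift k A n = shift k A n * coeff n σ (σ x) := by
  rw [shift, Finset.mul_sum, Finset.sum_mul]
  refine Finset.sum_congr rfl fun i _ => ?_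
  rw [coeff, ← mul_assoc, coeffHom_mul_wedgeOp, mul_assoc, mul_assoc, contractOp_mul_coeffHom]
  simp [pow_succ]

theorem coeff_mul_shift_pow (x : A) (r : ℕ) :
    coeff n σ x * shift k A n ^ r = shift k A n ^ r * coeff n σ ((σ ^ r) x) := by
  induction r with
  | zero => simp
  | succ r ih =>
    rw [pow_succ, ← mul_assoc, ih, mul_assoc, coeff_mul_shift, mul_assoc, pow_succ']
    rfl

theorem coeff_single (x : A) (S : Finset (Fin (n + 1))) :
    coeff n σ x (Pi.single S 1) = Pi.single S ((σ ^ (∑ s ∈ S, (s : ℕ))) x) := by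
  funext T
  rw [coeff, coeffHom_apply]
  by_cases h : T = S
  · subst h
    rw [← ofAdd_sum]
    simp
  · rw [Pi.single_eq_of_ne h, Pi.single_eq_of_ne h, mul_zero]

variable (δ : A →ₗ[k] A)

theorem divPow_one_eq_zero (hδ : ∀ x y, δ (x * y) = δ x * y + σ x * δ y) {r : ℕ} (hr : r ≠ 0) :
    divPow δ r (1 : A) = 0 := by
  have h1 : δ 1 = 0 := by
    have := hδ 1 1
    simpa using this
  obtain ⟨r, rfl⟩ := Nat.exists_eq_succ_of_ne_zero hr
  rw [divPow_apply, pow_succ, Module.End.mul_apply, h1, map_zero, smul_zero]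

variable [CharZero k]

/-- The algebra map `x ↦ ∑ᵣ shift ^ r (δ ^ r x / r!)`.  The range of summation exceeds
`shiftBound n` by `n + 1`, so that double sums may be rearranged by antidiagonals: beyond this range
a power of `shift` or a generator of too large index vanishes. -/
def jetHom (hδ : ∀ x y, δ (x * y) = δ x * y + σ x * δ y) (hc : ∀ x, σ (δ x) = δ (σ x)) :
    A →ₐ[k] Module.End k (Finset (Fin (n + 1)) → A) :=
  AlgHom.ofLinearMap
    (∑ r ∈ Finset.range (shiftBound n + (n + 1)),
      LinearMap.mulLeft k (shift k A n ^ r) ∘ₗ (coeff n σ).toLinearMap ∘ₗ divPow δ r)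
    (by
      rw [LinearMap.sum_apply, Finset.sum_eq_single 0]
      · simp
      · intro r _ hr
        simp [divPow_one_eq_zero σ δ hδ hr]
      · intro h
        exact absurd (Finset.mem_range.2 (by omega)) h)
    (by
      intro x y
      simp only [LinearMap.sum_apply, LinearMap.comp_apply, LinearMap.mulLeft_apply,
        AlgHom.toLinearMap_apply]
      rw [Finset.sum_mul_sum, ← sum_range_sum_antidiagonal]
      · refine Finset.sum_congr rfl fun r _ => ?_
        rw [divPow_mul σ δ hδ hc, map_sum, Finset.mul_sum]
        refine Finset.sum_congr rfl fun p hp => ?_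
        rw [Finset.HasAntidiagonal.mem_antidiagonal] at hp
        rw [map_mul, mul_assoc, ← mul_assoc (coeff n σ _) (shift k A n ^ _),
          coeff_mul_shift_pow, ← hp, pow_add, map_divPow σ δ hc]
        simp only [mul_assoc]
      · intro i j hij
        rw [mul_assoc, ← mul_assoc (coeff n σ _) (shift k A n ^ _), coeff_mul_shift_pow,
          ← mul_assoc, ← mul_assoc, ← pow_add, shift_pow_eq_zero n (by omega), zero_mul, zero_mul])

variable (hδ : ∀ x y, δ (x * y) = δ x * y + σ x * δ y) (hc : ∀ x, σ (δ x) = δ (σ x))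

theorem jetHom_apply (x : A) : jetHom n σ δ hδ hc x =
    ∑ r ∈ Finset.range (shiftBound n + (n + 1)), shift k A n ^ r * coeff n σ (divPow δ r x) := by
  simp [jetHom]

/-- Moving a generator past `x` produces the generators of higher index with the divided powers of
the derivation as coefficients. -/
theorem jetHom_mul_wedge (x : A) (j : ℕ) : jetHom n σ δ hδ hc x * wedge k A n j =
    ∑ i ∈ Finset.range (shiftBound n + (n + 1)),
      wedge k A n (j + i) * jetHom n σ δ hδ hc ((σ ^ j) (divPow δ i x)) := by
  simp only [jetHom_apply, Finset.mul_sum]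
  rw [Finset.sum_mul, ← sum_range_sum_antidiagonal (fun i l => wedge k A n (j + i) *
    (shift k A n ^ l * coeff n σ (divPow δ l ((σ ^ j) (divPow δ i x)))))]
  · refine Finset.sum_congr rfl fun r _ => ?_
    rw [mul_assoc, coeff_mul_wedge, ← mul_assoc, shift_pow_mul_wedge, Finset.sum_mul]
    refine Finset.sum_congr rfl fun p hp => ?_
    rw [Finset.HasAntidiagonal.mem_antidiagonal] at hp
    rw [← map_divPow σ δ hc, divPow_divPow, add_comm p.2 p.1, hp, map_smul, map_smul,
      ← Nat.cast_smul_eq_nsmul k, smul_mul_assoc, mul_smul_comm, mul_smul_comm, mul_assoc,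
      Nat.choose_symm_of_eq_add hp.symm]
  · intro i l hil
    by_cases hi : n + 1 ≤ i
    · rw [wedge_of_le n (by omega), zero_mul]
    · rw [shift_pow_eq_zero n (by omega), zero_mul, mul_zero]

theorem jetHom_vacuum (x : A) : jetHom n σ δ hδ hc x (Pi.single ∅ 1) = Pi.single ∅ x := by
  rw [jetHom_apply, LinearMap.sum_apply, Finset.sum_eq_single 0]
  · rw [pow_zero, one_mul, divPow_zero, coeff, coeffHom_vacuum]
  · intro r _ hr
    obtain ⟨r, rfl⟩ := Nat.exists_eq_succ_of_ne_zero hr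
    have h0 : ∀ a : A, shift k A n (Pi.single ∅ a) = 0 := by
      intro a
      funext S
      exact shift_apply_eq_zero n fun i _ _ => Pi.single_eq_of_ne (Finset.insert_ne_empty _ _) _
    rw [Module.End.mul_apply, coeff, coeffHom_vacuum, pow_succ, Module.End.mul_apply, h0, map_zero]
  · intro h
    exact absurd (Finset.mem_range.2 (by omega)) h

theorem jetHom_vol (x : A) :
    jetHom n σ δ hδ hc x (Pi.single (Finset.univ.map (Fin.succEmb n)) 1) =
      Pi.single (Finset.univ.map (Fin.succEmb n))
        ((σ ^ (∑ s ∈ Finset.univ.map (Fin.succEmb n), (s : ℕ))) x) := by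
  rw [jetHom_apply, LinearMap.sum_apply, Finset.sum_eq_single 0]
  · rw [pow_zero, one_mul, divPow_zero, coeff_single]
  · intro r _ hr
    obtain ⟨r, rfl⟩ := Nat.exists_eq_succ_of_ne_zero hr
    have h0 : ∀ a : A,
        shift k A n (Pi.single (Finset.univ.map (Fin.succEmb n)) a) = 0 := by
      intro a
      funext S
      refine shift_apply_eq_zero n fun i _ _ => Pi.single_eq_of_ne (fun h => ?_) _
      have : i.succ ∈ Finset.univ.map (Fin.succEmb n) :=
        Finset.mem_map.2 ⟨i, Finset.mem_univ _, rfl⟩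
      rw [← h] at this
      simp [Fin.castSucc_lt_succ.ne'] at this
    rw [Module.End.mul_apply, coeff_single, pow_succ, Module.End.mul_apply, h0, map_zero]
  · intro h
    exact absurd (Finset.mem_range.2 (by omega)) h

theorem parityHom_jetHom (x : A) :
    parityHom k A (n + 1) (jetHom n σ δ hδ hc x) = jetHom n σ δ hδ hc x := by
  rw [jetHom_apply, map_sum]
  refine Finset.sum_congr rfl fun r _ => ?_
  rw [map_mul, map_pow, parityHom_shift, coeff, parityHom_coeffHom]

end

theorem algEquiv_pow_apply (σ : A ≃ₐ[k] A) (r : ℕ) (x : A) :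
    (σ ^ r) x = ((σ : A →ₐ[k] A) ^ r) x := by
  induction r generalizing x with
  | zero => rfl
  | succ r ih =>
    rw [pow_succ, pow_succ]
    exact ih (σ x)

theorem wedge_mem_span {j : ℕ} (hj : j ≠ 0) : wedge k A n j ∈
    Submodule.span k (Set.range fun i : Fin n => wedgeOp A (fun _ _ => (-1 : k)) i.succ) := by
  by_cases h : j < n + 1
  · rw [wedge_of_lt n h]
    refine Submodule.subset_span ⟨⟨j - 1, by omega⟩, ?_⟩
    dsimp only
    congr 1
    exact Fin.ext (by simp; omega)
  · rw [wedge_of_le n (not_lt.1 h)]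
    exact zero_mem _

/-- A twisted derivation `δ` commuting with its twist `σ`, whose only constants are the scalars and
which admits a `σ`-invariant `e` with `δ e = 1`, gives an integrable calculus of every dimension.
There are anticommuting generators `ω₀, …, ωₙ` with `a ωⱼ = ∑ᵢ ωⱼ₊ᵢ σ ^ j (δ ^ i a / i!)`; the
one-forms are generated by `ω₁, …, ωₙ`, and the differential is the graded commutator with `ω₀`, so
that `da = -∑ᵢ ωᵢ (δ ^ i a / i!)`, summed over `i ≥ 1`. -/
theorem exists_calculus [CharZero k] [Nontrivial A] (hn : 1 ≤ n) (σ : A ≃ₐ[k] A) (δ : A →ₗ[k] A)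
    (hδ : ∀ x y, δ (x * y) = δ x * y + σ x * δ y) (hc : ∀ x, σ (δ x) = δ (σ x))
    (hker : ∀ a, δ a = 0 → ∃ c : k, a = algebraMap k A c) (e : A) (he : δ e = 1) (hσ : σ e = e) :
    ∃ C : DifferentialCalculus k A, C.HasDimension n ∧ C.IsConnected ∧ C.IsIntegrable n := by
  have hm := jetHom_mul_wedge n (σ : A →ₐ[k] A) δ hδ hc
  have hvac := jetHom_vacuum n (σ : A →ₐ[k] A) δ hδ hc
  set ρ := jetHom n (σ : A →ₐ[k] A) δ hδ hc with hρ
  set W := Submodule.span k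
    (Set.range fun i : Fin n => wedgeOp A (fun _ _ => (-1 : k)) i.succ) with hW
  have hsucc : ∀ i : Fin n, wedgeOp A (fun _ _ => (-1 : k)) i.succ = wedge k A n (i + 1) :=
    fun i => by
      rw [wedge_of_lt n (by omega)]
      rfl
  have hz : wedgeOp A (fun _ _ => (-1 : k)) (0 : Fin (n + 1)) = wedge k A n 0 := by
    rw [wedge_of_lt n (by omega)]
    rfl
  -- the leading term of the commutation rule
  have hm' : ∀ x j, ρ x * wedge k A n j = wedge k A n j * ρ (((σ : A →ₐ[k] A) ^ j) x) +
      ∑ i ∈ (Finset.range (shiftBound n + (n + 1))).erase 0,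
        wedge k A n (j + i) * ρ (((σ : A →ₐ[k] A) ^ j) (divPow δ i x)) := by
    intro x j
    rw [hm, ← Finset.add_sum_erase _ _ (Finset.mem_range.2 (by omega : 0 <
      shiftBound n + (n + 1)))]
    simp
  have hmemR : ∀ a, ρ a ∈ LinearMap.range ρ.toLinearMap := fun a => ⟨a, rfl⟩
  -- downward induction on `j`: the correction terms only involve generators of larger index
  have hleft : ∀ d j a, j ≠ 0 → n + 1 ≤ j + d →
      wedge k A n j * ρ a ∈ LinearMap.range ρ.toLinearMap * W := by
    intro d
    induction d using Nat.strong_induction_on with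
    | _ d ih =>
      intro j a hj hd
      by_cases hjn : n + 1 ≤ j
      · rw [wedge_of_le n hjn, zero_mul]
        exact zero_mem _
      · have hinv : ((σ : A →ₐ[k] A) ^ j) ((σ ^ j).symm a) = a := by
          rw [← algEquiv_pow_apply]
          exact (σ ^ j).apply_symm_apply a
        have h := hm' ((σ ^ j).symm a) j
        rw [hinv] at h
        rw [← sub_eq_of_eq_add h]
        refine Submodule.sub_mem _ (Submodule.mul_mem_mul (hmemR _) (wedge_mem_span n hj))
          (Submodule.sum_mem _ fun i hi => ?_)
        have hi0 := (Finset.mem_erase.1 hi).1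
        exact ih (d - 1) (by omega) (j + i) _ (by omega) (by omega)
  have hdiv : ∀ i, 2 ≤ i → divPow δ i e = 0 := by
    intro i hi
    obtain ⟨i, rfl⟩ := Nat.exists_eq_add_of_le' hi
    have h1 : δ 1 = 0 := by simpa using divPow_one_eq_zero (σ : A →ₐ[k] A) δ hδ one_ne_zero
    rw [divPow_apply, pow_add, Module.End.mul_apply, pow_succ, Module.End.mul_apply, pow_one, he,
      h1, map_zero, smul_zero]
  have hσj : ∀ j, ((σ : A →ₐ[k] A) ^ j) e = e := by
    intro j
    induction j with
    | zero => rfl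
    | succ j ih =>
      rw [pow_succ]
      exact (congrArg _ hσ).trans ih
  -- since `δ e = 1`, commutation with `e` replaces a generator by the next one
  have hstep : ∀ j, ρ e * wedge k A n j = wedge k A n j * ρ e + wedge k A n (j + 1) := by
    intro j
    by_cases hj : j < n + 1
    · rw [hm', hσj, Finset.sum_eq_single 1]
      · rw [divPow_one, he, map_one, map_one, mul_one]
      · intro i hi hi1
        rw [hdiv i (by have := (Finset.mem_erase.1 hi).1; omega), map_zero, map_zero, mul_zero]
      · intro h
        exact absurd (Finset.mem_erase.2 ⟨one_ne_zero, Finset.mem_range.2 (by omega)⟩) h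
    · rw [wedge_of_le n (by omega), wedge_of_le n (by omega)]
      simp
  refine FormFrame.exists_calculus
    { ρ := ρ
      parity := parityHom k A (n + 1)
      w := fun i => wedgeOp A (fun _ _ => (-1 : k)) i.succ
      θ := wedgeOp A (fun _ _ => (-1 : k)) 0
      ev := coeffAtVacuum (Fin.succOrderEmb n)
      ν := σ ^ (∑ s ∈ Finset.univ.map (Fin.succEmb n), (s : ℕ))
      parity_ρ := parityHom_jetHom n _ δ hδ hc
      parity_w := fun i => parityHom_wedgeOp _ _
      parity_θ := parityHom_wedgeOp _ _
      θ_sq := wedgeOp_mul_self _ _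
      w_sq := fun i => wedgeOp_mul_self _ _
      w_swap := fun i j _ => ⟨-1, by simp, wedgeOp_anticomm n _ _⟩
      ev_form := fun S a => coeffAtVacuum_orderedForm _ (Fin.succOrderEmb n) (hvac a) S
      ρ_mul_w := ?_
      w_mul_ρ := ?_
      comm_θ := ?_
      θ_w := ?_
      scalar_of_comm := ?_
      dense := ?_
      ev_ρ_mul_vol := ?_ } hn
  · intro a i
    rw [hsucc, hm]
    exact Submodule.sum_mem _ fun l _ =>
      Submodule.mul_mem_mul (wedge_mem_span n (by omega)) (hmemR _)
  · intro a i
    rw [hsucc]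
    exact hleft (n + 1) _ _ (by omega) (by omega)
  · intro a
    rw [hz, hm', pow_zero]
    simp only [AlgHom.one_apply, sub_add_cancel_left]
    exact Submodule.neg_mem _ (Submodule.sum_mem _ fun l hl =>
      Submodule.mul_mem_mul (wedge_mem_span n (by have := (Finset.mem_erase.1 hl).1; omega))
        (hmemR _))
  · intro i
    have h0 : ∀ X : Module.End k (Finset (Fin (n + 1)) → A), (-1 : k) • X + X = 0 := fun X => by
      module
    rw [wedgeOp_anticomm n 0 i.succ, h0]
    exact zero_mem _
  · intro a ha
    refine hker a ?_
    -- compare the coefficients at the first generator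
    have hcoef : ∀ j b, (wedge k A n j * ρ b) (Pi.single ∅ 1) {⟨1, by omega⟩} =
        if j = 1 then b else 0 := by
      intro j b
      rw [Module.End.mul_apply, hvac]
      by_cases hj : j < n + 1
      · rw [wedge_of_lt n hj, wedgeOp_single _ (by simp)]
        by_cases hj1 : j = 1
        · subst hj1
          simp
        · rw [if_neg hj1, Pi.single_eq_of_ne]
          simp only [insert_empty_eq, ne_eq, Finset.singleton_inj, Fin.mk.injEq]
          exact fun h => hj1 h.symm
      · rw [wedge_of_le n (by omega), if_neg (by omega)]
        rfl
    have h1 := hm a 0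
    rw [← hz, ← ha, hz] at h1
    have h2 := congrFun (LinearMap.congr_fun h1 (Pi.single ∅ 1)) {⟨1, by omega⟩}
    rw [hcoef, LinearMap.sum_apply, Finset.sum_apply] at h2
    simp only [hcoef, zero_add] at h2
    rw [Finset.sum_ite_eq_of_mem' _ _ _ (Finset.mem_range.2 (by omega))] at h2
    simpa using h2.symm
  · have h0 : wedge k A n 1 ∈ Submodule.span k {x | ∃ a b, x = ρ a *
        (wedgeOp A (fun _ _ => (-1 : k)) 0 * ρ b - ρ b * wedgeOp A (fun _ _ => (-1 : k)) 0)} := by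
      have h1 : wedge k A n 1 = -(ρ 1 *
          (wedgeOp A (fun _ _ => (-1 : k)) 0 * ρ e - ρ e * wedgeOp A (fun _ _ => (-1 : k)) 0)) := by
        rw [map_one, one_mul, hz, hstep]
        simp
      rw [h1]
      exact Submodule.neg_mem _ (Submodule.subset_span ⟨_, _, rfl⟩)
    have hall : ∀ j, wedge k A n (j + 1) ∈ Submodule.span k {x | ∃ a b, x = ρ a *
        (wedgeOp A (fun _ _ => (-1 : k)) 0 * ρ b - ρ b * wedgeOp A (fun _ _ => (-1 : k)) 0)} := by
      intro j
      induction j with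
      | zero => exact h0
      | succ j ih =>
        have h := hstep (j + 1)
        rw [← sub_eq_of_eq_add' h]
        exact Submodule.sub_mem _ (mul_span_commutator_mem _ _ ih _)
          (span_commutator_mul_mem _ _ ih _)
    intro i
    rw [hsucc]
    exact hall i
  · intro a
    change (ρ a * orderedForm (fun i : Fin n => wedgeOp A (fun _ _ => (-1 : k))
      (Fin.succOrderEmb n i)) Finset.univ) (Pi.single ∅ 1) (Finset.univ.map (Fin.succEmb n)) = _
    rw [Module.End.mul_apply, orderedForm_single]
    refine (congrFun (jetHom_vol n _ δ hδ hc a) _).trans ?_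
    rw [Pi.single_eq_same, algEquiv_pow_apply]

end JetModel

/-! ### Calculi from an eigenvector of an automorphism -/

namespace EigenModel

open FormModel

variable {k : Type v} [Field k] {A : Type u} [Ring A] [Algebra k A] (n : ℕ)

/-- The commutation coefficients in `ωᵢ ωⱼ = -t ^ (i - j) ωⱼ ωᵢ`; only their values for `j < i` are
used. -/
def skew (t : k) (i j : Fin n) : k := -t ^ ((i : ℕ) - j)

variable (t : k) (σ : A ≃ₐ[k] A)

/-- Multiplication by elements of `A`, where the `i`-th generator is twisted by `σ ^ (i + 1)`. -/
def coeff : A →ₐ[k] Module.End k (Finset (Fin n) → A) :=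
  coeffHom (powersHom (A →ₐ[k] A) (σ : A →ₐ[k] A)) (fun i => Multiplicative.ofAdd ((i : ℕ) + 1))

theorem coeff_mul_wedgeOp (x : A) (i : Fin n) :
    coeff n σ x * wedgeOp A (skew n t) i =
      wedgeOp A (skew n t) i * coeff n σ ((σ ^ ((i : ℕ) + 1)) x) := by
  rw [coeff, coeffHom_mul_wedgeOp, JetModel.algEquiv_pow_apply]
  simp

theorem wedgeOp_mul_coeff (x : A) (i : Fin n) : wedgeOp A (skew n t) i * coeff n σ x =
    coeff n σ ((σ ^ ((i : ℕ) + 1)).symm x) * wedgeOp A (skew n t) i := by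
  rw [coeff_mul_wedgeOp, AlgEquiv.apply_symm_apply]

theorem wedgeOp_mul_coeff_vacuum (x : A) (i j : Fin n) :
    (wedgeOp A (skew n t) i * coeff n σ x) (Pi.single ∅ 1) {j} = if i = j then x else 0 := by
  rw [Module.End.mul_apply, coeff, coeffHom_vacuum, wedgeOp_single _ (by simp)]
  by_cases h : i = j
  · subst h
    simp
  · rw [if_neg h, Pi.single_eq_of_ne]
    simpa using fun h' => h h'.symm

variable {t σ} in
theorem pow_apply_of_eigen {c : A} (hc : σ c = t • c) (i : ℕ) : (σ ^ i) c = t ^ i • c := by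
  induction i with
  | zero => simp
  | succ i ih =>
    rw [pow_succ, pow_succ]
    change (σ ^ i) (σ c) = _
    rw [hc, map_smul, ih, smul_smul, mul_comm]

/-- The form `∑ ωᵢ c`. -/
def connection (c : A) : Module.End k (Finset (Fin n) → A) :=
  ∑ i, wedgeOp A (skew n t) i * coeff n σ c

theorem connection_comm (c a : A) :
    connection n t σ c * coeff n σ a - coeff n σ a * connection n t σ c =
      ∑ i : Fin n, wedgeOp A (skew n t) i * coeff n σ (c * a - (σ ^ ((i : ℕ) + 1)) a * c) := by
  rw [connection, Finset.sum_mul, Finset.mul_sum, ← Finset.sum_sub_distrib]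
  refine Finset.sum_congr rfl fun i _ => ?_
  rw [← mul_assoc (coeff n σ a), coeff_mul_wedgeOp, mul_assoc, mul_assoc, ← mul_sub, ← map_mul,
    ← map_mul, ← map_sub]

/-- As `c ωⱼ c = t ^ (j + 1) ωⱼ c ^ 2`, the terms `ωᵢ c ωⱼ c` and `ωⱼ c ωᵢ c` cancel by the choice
of the commutation coefficients. -/
theorem connection_sq {c : A} (hc : σ c = t • c) :
    connection n t σ c * connection n t σ c = 0 := by
  have hterm : ∀ i j : Fin n, wedgeOp A (skew n t) i * coeff n σ c *
      (wedgeOp A (skew n t) j * coeff n σ c) =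
      t ^ ((j : ℕ) + 1) •
        (wedgeOp A (skew n t) i * wedgeOp A (skew n t) j * coeff n σ (c * c)) := by
    intro i j
    rw [mul_assoc, ← mul_assoc (coeff n σ c), coeff_mul_wedgeOp, pow_apply_of_eigen hc, map_smul,
      mul_smul_comm, smul_mul_assoc, mul_smul_comm, map_mul]
    simp only [mul_assoc]
  rw [connection, Finset.sum_mul_sum, ← Finset.sum_product']
  -- the terms for `(i, j)` and `(j, i)` cancel
  refine Finset.sum_involution (fun p _ => p.swap) ?_ ?_ ?_ ?_
  · rintro ⟨i, j⟩ -
    have key : ∀ i j : Fin n, i < j →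
        t ^ ((j : ℕ) + 1) • (wedgeOp A (skew n t) i * wedgeOp A (skew n t) j *
          coeff n σ (c * c)) +
        t ^ ((i : ℕ) + 1) • (wedgeOp A (skew n t) j * wedgeOp A (skew n t) i *
          coeff n σ (c * c)) = 0 := by
      intro i j h
      rw [wedgeOp_mul_wedgeOp _ h, smul_mul_assoc, smul_smul, ← add_smul]
      have hij : t ^ ((i : ℕ) + 1) * skew n t j i = -t ^ ((j : ℕ) + 1) := by
        have h' : (j : ℕ) + 1 = ((i : ℕ) + 1) + ((j : ℕ) - i) := by
          have : (i : ℕ) < j := h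
          omega
        rw [skew, mul_neg, ← pow_add, ← h']
      rw [hij, add_neg_cancel, zero_smul]
    dsimp only [Prod.swap_prod_mk]
    rw [hterm, hterm]
    rcases lt_trichotomy i j with h | h | h
    · exact key i j h
    · subst h
      simp [wedgeOp_mul_self]
    · rw [add_comm]
      exact key j i h
  · rintro ⟨i, j⟩ - hne h
    have : j = i := congrArg Prod.fst h
    subst this
    exact hne (by dsimp only; rw [hterm, wedgeOp_mul_self, zero_mul, smul_zero])
  · intro p _
    exact Finset.mem_univ _
  · intro p _
    exact Prod.swap_swap p

/-- Elimination of one-forms: passing from `Ω` to `c Ω - t ^ (j + 1) Ω c` removes the summand with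
`ωⱼ` from a combination of the `ωᵢ c ^ r` and keeps the others, up to scalars.  The starting point
is the differential of `c`. -/
theorem prod_sub_mem_span_commutator {c : A} (hc : σ c = t • c) (J : Finset (Fin n)) :
    ∑ i : Fin n, ((1 - t ^ ((i : ℕ) + 1)) * ∏ j ∈ J, (t ^ ((i : ℕ) + 1) - t ^ ((j : ℕ) + 1))) •
      (wedgeOp A (skew n t) i * coeff n σ (c ^ (J.card + 2))) ∈
    Submodule.span k {x | ∃ a b, x = coeff n σ a *
      (connection n t σ c * coeff n σ b - coeff n σ b * connection n t σ c)} := by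
  induction J using Finset.induction_on with
  | empty =>
    have h : ∑ i : Fin n, ((1 - t ^ ((i : ℕ) + 1)) * ∏ j ∈ (∅ : Finset (Fin n)),
        (t ^ ((i : ℕ) + 1) - t ^ ((j : ℕ) + 1))) •
        (wedgeOp A (skew n t) i * coeff n σ (c ^ ((∅ : Finset (Fin n)).card + 2))) =
        coeff n σ 1 *
        (connection n t σ c * coeff n σ c - coeff n σ c * connection n t σ c) := by
      rw [map_one, one_mul, connection_comm]
      refine Finset.sum_congr rfl fun i _ => ?_
      rw [pow_apply_of_eigen hc, Finset.prod_empty, mul_one, Finset.card_empty, zero_add,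
        smul_mul_assoc, ← mul_smul_comm, ← map_smul, sub_smul, one_smul, pow_two]
    rw [h]
    exact Submodule.subset_span ⟨_, _, rfl⟩
  | insert l J hl ih =>
    have h1 := mul_span_commutator_mem _ _ ih c
    have h2 := Submodule.smul_mem _ (t ^ ((l : ℕ) + 1)) (span_commutator_mul_mem _ _ ih c)
    refine (congrArg (· ∈ _) ?_).mp (Submodule.sub_mem _ h1 h2)
    rw [Finset.mul_sum, Finset.sum_mul, Finset.smul_sum, ← Finset.sum_sub_distrib]
    refine Finset.sum_congr rfl fun i _ => ?_
    rw [Finset.prod_insert hl, Finset.card_insert_of_notMem hl, mul_smul_comm, ← mul_assoc,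
      coeff_mul_wedgeOp, pow_apply_of_eigen hc, map_smul, mul_smul_comm, smul_mul_assoc,
      smul_mul_assoc, mul_assoc, mul_assoc, ← map_mul, ← map_mul, ← pow_succ, ← pow_succ',
      smul_smul, smul_smul, ← sub_smul]
    congr 1
    · ring

/-- An automorphism `σ` with a regular eigenvector `c`, whose eigenvalue `t` has distinct powers and
whose powers generate the unit ideal, gives an integrable calculus, provided that only the scalars
are both fixed by `σ` and commute with `c`.  The differential is the graded commutator with
`∑ ωᵢ c`, where `a ωᵢ = ωᵢ σ ^ (i + 1) a`. -/
theorem exists_calculus [Nontrivial A] (hn : 2 ≤ n) (ht0 : t ≠ 0)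
    (ht : ∀ i : ℕ, i ≠ 0 → t ^ i ≠ 1) {c : A} (hc : σ c = t • c)
    (hreg : ∀ a, a * c = 0 → a = 0)
    (hker : ∀ a, σ a = a → c * a = a * c → ∃ r : k, a = algebraMap k A r)
    (hideal : ∀ (r : ℕ) (Z : Submodule k A), (∀ a, ∀ z ∈ Z, a * z ∈ Z) → (∀ z ∈ Z, ∀ a, z * a ∈ Z) →
      c ^ r ∈ Z → (1 : A) ∈ Z) :
    ∃ C : DifferentialCalculus k A, C.HasDimension n ∧ C.IsConnected ∧ C.IsIntegrable n := by
  have hmemW : ∀ i, wedgeOp A (skew n t) i ∈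
      Submodule.span k (Set.range fun i => wedgeOp A (skew n t) i) :=
    fun i => Submodule.subset_span ⟨i, rfl⟩
  have hmemR : ∀ a, coeff n σ a ∈ LinearMap.range (coeff n σ).toLinearMap := fun a => ⟨a, rfl⟩
  have hinj : ∀ i j : ℕ, i < j → t ^ i ≠ t ^ j := by
    intro i j hij h
    refine ht (j - i) (by omega) ?_
    have h' : t ^ j = t ^ i * t ^ (j - i) := by
      rw [← pow_add]
      congr 1
      omega
    rw [h'] at h
    exact (mul_eq_left₀ (pow_ne_zero _ ht0)).1 h.symm
  refine FormFrame.exists_calculus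
    { ρ := coeff n σ
      parity := parityHom k A n
      w := fun i => wedgeOp A (skew n t) i
      θ := connection n t σ c
      ev := coeffAtVacuum (RelEmbedding.refl _)
      ν := σ ^ (∑ s : Fin n, ((s : ℕ) + 1))
      parity_ρ := parityHom_coeffHom _ _
      parity_w := fun i => parityHom_wedgeOp _ _
      parity_θ := ?_
      θ_sq := connection_sq n t σ hc
      w_sq := fun i => wedgeOp_mul_self _ _
      w_swap := fun i j h => ⟨skew n t j i, neg_ne_zero.2 (pow_ne_zero _ ht0),
        wedgeOp_mul_wedgeOp _ h⟩
      ev_form := fun S a => coeffAtVacuum_orderedForm _ (RelEmbedding.refl _)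
        (coeffHom_vacuum _ _ a) S
      ρ_mul_w := ?_
      w_mul_ρ := ?_
      comm_θ := ?_
      θ_w := ?_
      scalar_of_comm := ?_
      dense := ?_
      ev_ρ_mul_vol := ?_ } (by omega)
  · rw [connection, map_sum, ← Finset.sum_neg_distrib]
    refine Finset.sum_congr rfl fun i _ => ?_
    rw [map_mul, parityHom_wedgeOp, coeff, parityHom_coeffHom]
    exact LinearMap.neg_comp _ _
  · intro a i
    rw [coeff_mul_wedgeOp]
    exact Submodule.mul_mem_mul (hmemW i) (hmemR _)
  · intro a i
    rw [wedgeOp_mul_coeff]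
    exact Submodule.mul_mem_mul (hmemR _) (hmemW i)
  · intro a
    rw [connection_comm]
    exact Submodule.sum_mem _ fun i _ => Submodule.mul_mem_mul (hmemW i) (hmemR _)
  · intro i
    rw [connection, Finset.sum_mul, Finset.mul_sum]
    refine Submodule.add_mem _ (Submodule.sum_mem _ fun j _ => ?_)
      (Submodule.sum_mem _ fun j _ => ?_)
    · rw [mul_assoc (wedgeOp A (skew n t) j), coeff_mul_wedgeOp,
        ← mul_assoc (wedgeOp A (skew n t) j)]
      exact Submodule.mul_mem_mul (Submodule.mul_mem_mul (hmemW j) (hmemW i)) (hmemR _)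
    · rw [← mul_assoc (wedgeOp A (skew n t) i)]
      exact Submodule.mul_mem_mul (Submodule.mul_mem_mul (hmemW i) (hmemW j)) (hmemR _)
  · intro a ha
    have h := connection_comm n t σ c a
    rw [ha, sub_self] at h
    have hcoef : ∀ j : Fin n, c * a = (σ ^ ((j : ℕ) + 1)) a * c := by
      intro j
      have h2 := congrFun (LinearMap.congr_fun h (Pi.single ∅ 1)) {j}
      rw [LinearMap.sum_apply, Finset.sum_apply] at h2
      simp only [wedgeOp_mul_coeff_vacuum, Finset.sum_ite_eq', Finset.mem_univ, if_true] at h2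
      exact sub_eq_zero.1 h2.symm
    -- the first two components give `σ a * c = c * a = σ (σ a) * c`
    have h0 := hcoef ⟨0, by omega⟩
    have h1 := hcoef ⟨1, by omega⟩
    have h01 : σ (σ a) = σ a := by
      refine sub_eq_zero.1 (hreg _ ?_)
      rw [sub_mul, sub_eq_zero]
      exact h1.symm.trans h0
    have hσ : σ a = a := σ.injective h01
    refine hker a hσ (h0.trans ?_)
    exact congrArg (· * c) hσ
  · intro i
    -- eliminate all one-forms but `ωᵢ`, then remove the power of `c`
    have hmem := prod_sub_mem_span_commutator n t σ hc (Finset.univ.erase i)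
    rw [Finset.sum_eq_single i] at hmem
    · have hne : (1 - t ^ ((i : ℕ) + 1)) * ∏ j ∈ Finset.univ.erase i,
          (t ^ ((i : ℕ) + 1) - t ^ ((j : ℕ) + 1)) ≠ 0 := by
        refine mul_ne_zero (sub_ne_zero.2 (ht _ (by omega)).symm) (Finset.prod_ne_zero_iff.2 ?_)
        intro j hj
        have hji : (j : ℕ) ≠ i := fun h => (Finset.mem_erase.1 hj).1 (Fin.ext h)
        rcases lt_or_gt_of_ne hji with h | h
        · exact sub_ne_zero.2 (hinj _ _ (by omega)).symm
        · exact sub_ne_zero.2 (hinj _ _ (by omega))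
      have hmem' := (Submodule.smul_mem_iff _ hne).1 hmem
      have h1 := hideal _ ((Submodule.span k {x | ∃ a b, x = coeff n σ a *
          (connection n t σ c * coeff n σ b - coeff n σ b * connection n t σ c)}).comap
          (LinearMap.mulLeft k (wedgeOp A (skew n t) i) ∘ₗ (coeff n σ).toLinearMap)) ?_ ?_ hmem'
      · simpa using h1
      · intro a z hz
        simp only [Submodule.mem_comap, LinearMap.comp_apply, LinearMap.mulLeft_apply,
          AlgHom.toLinearMap_apply] at hz ⊢
        rw [map_mul, ← mul_assoc, wedgeOp_mul_coeff, mul_assoc]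
        exact mul_span_commutator_mem _ _ hz _
      · intro z hz a
        simp only [Submodule.mem_comap, LinearMap.comp_apply, LinearMap.mulLeft_apply,
          AlgHom.toLinearMap_apply] at hz ⊢
        rw [map_mul, ← mul_assoc]
        exact span_commutator_mul_mem _ _ hz _
    · intro j _ hj
      rw [Finset.prod_eq_zero (Finset.mem_erase.2 ⟨hj, Finset.mem_univ j⟩) (sub_self _), mul_zero,
        zero_smul]
    · simp
  · intro a
    change (coeff n σ a * orderedForm (fun i : Fin n => wedgeOp A (skew n t)
      ((RelEmbedding.refl (· ≤ ·) : Fin n ↪o Fin n) i)) Finset.univ) (Pi.single ∅ 1)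
      (Finset.univ.map (RelEmbedding.refl (· ≤ ·) : Fin n ↪o Fin n).toEmbedding) = _
    rw [Module.End.mul_apply, orderedForm_single, coeff, coeffHom_apply, Pi.single_eq_same, mul_one,
      JetModel.algEquiv_pow_apply, ← ofAdd_sum]
    have : Finset.univ.map (RelEmbedding.refl (· ≤ ·) : Fin n ↪o Fin n).toEmbedding =
        Finset.univ := Finset.map_refl
    rw [this]
    simp

end EigenModel

/-! ### Calculi from skew derivations dual to the generators -/

namespace QuantumAffineModel

open FormModel

variable {k : Type v} [Field k] {A : Type u} [Ring A] [Algebra k A] {n : ℕ}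

/-- The commutation coefficients of the one-forms `ω₁, …, ωₙ` and of the auxiliary generator `ω₀`,
which anticommutes with all of them. -/
def skew (q : Fin n → Fin n → k) (i j : Fin (n + 1)) : k :=
  Fin.cases (-1) (fun i' => Fin.cases (-1) (fun j' => -q i' j') j) i

theorem skew_succ_succ (q : Fin n → Fin n → k) (i j : Fin n) :
    skew q i.succ j.succ = -q i j := rfl

theorem skew_succ_zero (q : Fin n → Fin n → k) (i : Fin n) :
    skew q i.succ 0 = -1 := rfl

theorem wedgeOp_succ_swap {q : Fin n → Fin n → k} (hq : ∀ i j, i ≠ j → q i j * q j i = 1)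
    (i j : Fin n) : wedgeOp A (skew q) i.succ * wedgeOp A (skew q) j.succ =
      -(q i j) • (wedgeOp A (skew q) j.succ * wedgeOp A (skew q) i.succ) := by
  rcases lt_trichotomy j i with h | h | h
  · rw [wedgeOp_mul_wedgeOp _ (Fin.succ_lt_succ_iff.2 h), skew_succ_succ]
  · subst h
    rw [wedgeOp_mul_self, smul_zero]
  · rw [wedgeOp_mul_wedgeOp _ (Fin.succ_lt_succ_iff.2 h), skew_succ_succ, smul_smul, neg_mul_neg,
      hq i j h.ne, one_smul]

theorem wedgeOp_succ_mul_zero (q : Fin n → Fin n → k) (i : Fin n) :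
    wedgeOp A (skew q) i.succ * wedgeOp A (skew q) 0 =
      (-1 : k) • (wedgeOp A (skew q) 0 * wedgeOp A (skew q) i.succ) := by
  rw [wedgeOp_mul_wedgeOp _ (Fin.succ_pos i), skew_succ_zero]

theorem contractOp_zero_mul_succ (q : Fin n → Fin n → k) (i : Fin n) :
    contractOp A (skew q) 0 * wedgeOp A (skew q) i.succ =
      (-1 : k) • (wedgeOp A (skew q) i.succ * contractOp A (skew q) 0) := by
  rw [contractOp_mul_wedgeOp_of_lt _ (Fin.succ_pos i), skew_succ_zero]

theorem contractOp_zero_mul_zero (q : Fin n → Fin n → k) :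
    contractOp A (skew q) 0 * wedgeOp A (skew q) 0 =
      1 - wedgeOp A (skew q) 0 * contractOp A (skew q) 0 :=
  eq_sub_of_add_eq (contractOp_mul_wedgeOp_self _ (by simp))

variable (q : Fin n → Fin n → k) {G : Type*} [CommGroup G] (τ : G →* (A →ₐ[k] A)) (γ : Fin n → G)
  (δ : Fin n → A →ₗ[k] A)

/-- Multiplication by elements of `A`; the generator `ω₀` is not twisted. -/
def coeff : A →ₐ[k] Module.End k (Finset (Fin (n + 1)) → A) :=
  coeffHom (m := n + 1) τ (Fin.cons 1 γ : Fin (n + 1) → G)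

theorem coeff_mul_succ (x : A) (i : Fin n) : coeff τ γ x * wedgeOp A (skew q) i.succ =
    wedgeOp A (skew q) i.succ * coeff τ γ (τ (γ i) x) := by
  rw [coeff, coeffHom_mul_wedgeOp, Fin.cons_succ]

theorem coeff_mul_zero (x : A) : coeff τ γ x * wedgeOp A (skew q) 0 =
    wedgeOp A (skew q) 0 * coeff τ γ x := by
  rw [coeff, coeffHom_mul_wedgeOp, Fin.cons_zero, map_one, AlgHom.one_apply]

theorem coeff_mul_contractOp (x : A) : coeff τ γ x * contractOp A (skew q) 0 =
    contractOp A (skew q) 0 * coeff τ γ x := by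
  rw [coeff, contractOp_mul_coeffHom, Fin.cons_zero, map_one, AlgHom.one_apply]

/-- The nilpotent part `∑ ωᵢ ι₀ δᵢ(x)` of left multiplication by `x`, where `ι₀` is the contraction
with the dual of `ω₀`. -/
def nilPart : A →ₗ[k] Module.End k (Finset (Fin (n + 1)) → A) :=
  ∑ i, LinearMap.mulLeft k (wedgeOp A (skew q) i.succ * contractOp A (skew q) 0) ∘ₗ
    (coeff τ γ).toLinearMap ∘ₗ δ i

theorem nilPart_apply (x : A) : nilPart q τ γ δ x =
    ∑ i, wedgeOp A (skew q) i.succ * contractOp A (skew q) 0 * coeff τ γ (δ i x) := by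
  simp [nilPart, mul_assoc]

theorem nilPart_mul_nilPart (x y : A) : nilPart q τ γ δ x * nilPart q τ γ δ y = 0 := by
  rw [nilPart_apply, nilPart_apply, Finset.sum_mul_sum]
  refine Finset.sum_eq_zero fun i _ => Finset.sum_eq_zero fun j _ => ?_
  calc _ = wedgeOp A (skew q) i.succ * contractOp A (skew q) 0 *
        (coeff τ γ (δ i x) * wedgeOp A (skew q) j.succ) * contractOp A (skew q) 0 *
        coeff τ γ (δ j y) := by simp only [mul_assoc]
    _ = wedgeOp A (skew q) i.succ * (contractOp A (skew q) 0 * wedgeOp A (skew q) j.succ) *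
        (coeff τ γ (τ (γ j) (δ i x)) * contractOp A (skew q) 0) *
        coeff τ γ (δ j y) := by rw [coeff_mul_succ]; simp only [mul_assoc]
    _ = (-1 : k) • (wedgeOp A (skew q) i.succ * wedgeOp A (skew q) j.succ *
        (contractOp A (skew q) 0 * contractOp A (skew q) 0) *
        coeff τ γ (τ (γ j) (δ i x)) * coeff τ γ (δ j y)) := by
      rw [coeff_mul_contractOp, contractOp_zero_mul_succ]
      simp only [mul_smul_comm, smul_mul_assoc, mul_assoc]
    _ = 0 := by rw [contractOp_mul_self]; simp

/-- Left multiplication by `x`, whose graded commutator with `ω₀` is `-∑ ωᵢ δᵢ(x)`. -/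
def frameHom (hδ : ∀ i x y, δ i (x * y) = δ i x * y + τ (γ i) x * δ i y) :
    A →ₐ[k] Module.End k (Finset (Fin (n + 1)) → A) :=
  AlgHom.ofLinearMap ((coeff τ γ).toLinearMap + nilPart q τ γ δ)
    (by
      have h1 : ∀ i, δ i 1 = 0 := by
        intro i
        have := hδ i 1 1
        simpa using this
      rw [LinearMap.add_apply, nilPart_apply]
      simp [h1])
    (by
      intro x y
      have h : nilPart q τ γ δ (x * y) =
          nilPart q τ γ δ x * coeff τ γ y + coeff τ γ x * nilPart q τ γ δ y := by
        simp only [nilPart_apply, Finset.sum_mul, Finset.mul_sum]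
        rw [← Finset.sum_add_distrib]
        refine Finset.sum_congr rfl fun i _ => ?_
        rw [hδ, map_add, map_mul, map_mul, mul_add, ← mul_assoc (coeff τ γ x),
          ← mul_assoc (coeff τ γ x), coeff_mul_succ, mul_assoc _ (coeff τ γ _) (contractOp _ _ _),
          coeff_mul_contractOp]
        simp only [mul_assoc]
      simp only [LinearMap.add_apply, AlgHom.toLinearMap_apply]
      rw [h, map_mul, add_mul, mul_add, mul_add, nilPart_mul_nilPart]
      abel)

variable (hδ : ∀ i x y, δ i (x * y) = δ i x * y + τ (γ i) x * δ i y)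

theorem frameHom_apply (x : A) :
    frameHom q τ γ δ hδ x = coeff τ γ x + nilPart q τ γ δ x := rfl

theorem frameHom_mul_succ (hq : ∀ i j, i ≠ j → q i j * q j i = 1)
    (hτδ : ∀ i j, i ≠ j → ∀ x, τ (γ i) (δ j x) = q i j • δ j (τ (γ i) x)) (x : A) (i : Fin n) :
    frameHom q τ γ δ hδ x * wedgeOp A (skew q) i.succ =
      wedgeOp A (skew q) i.succ * frameHom q τ γ δ hδ (τ (γ i) x) := by
  rw [frameHom_apply, frameHom_apply, add_mul, mul_add, coeff_mul_succ, nilPart_apply,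
    nilPart_apply, Finset.sum_mul, Finset.mul_sum]
  congr 1
  refine Finset.sum_congr rfl fun j _ => ?_
  calc _ = wedgeOp A (skew q) j.succ * contractOp A (skew q) 0 *
        (coeff τ γ (δ j x) * wedgeOp A (skew q) i.succ) := by simp only [mul_assoc]
    _ = wedgeOp A (skew q) j.succ * (contractOp A (skew q) 0 * wedgeOp A (skew q) i.succ) *
        coeff τ γ (τ (γ i) (δ j x)) := by rw [coeff_mul_succ]; simp only [mul_assoc]
    _ = (-1 : k) • (wedgeOp A (skew q) j.succ * wedgeOp A (skew q) i.succ *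
        (contractOp A (skew q) 0 * coeff τ γ (τ (γ i) (δ j x)))) := by
      rw [contractOp_zero_mul_succ]
      simp only [mul_smul_comm, smul_mul_assoc, mul_assoc]
    _ = _ := ?_
  rw [← mul_assoc (wedgeOp A (skew q) i.succ), ← mul_assoc (wedgeOp A (skew q) i.succ)]
  by_cases hij : i = j
  · subst hij
    rw [wedgeOp_mul_self]
    simp
  · rw [hτδ i j hij, wedgeOp_succ_swap hq i j, map_smul, mul_smul_comm, mul_smul_comm,
      smul_mul_assoc, smul_mul_assoc, smul_smul, mul_assoc, mul_assoc, mul_assoc]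
    module

theorem sum_mul_frameHom (hq : ∀ i j, i ≠ j → q i j * q j i = 1)
    (hδδ : ∀ i j, i ≠ j → ∀ x, δ i (δ j x) = q i j • δ j (δ i x)) (x : A) :
    ∑ i, wedgeOp A (skew q) i.succ * frameHom q τ γ δ hδ (δ i x) =
      ∑ i, wedgeOp A (skew q) i.succ * coeff τ γ (δ i x) := by
  simp only [frameHom_apply, mul_add, Finset.sum_add_distrib]
  refine add_eq_left.2 ?_
  simp only [nilPart_apply, Finset.mul_sum]
  rw [← Finset.sum_product']
  have hterm : ∀ i j, wedgeOp A (skew q) i.succ * (wedgeOp A (skew q) j.succ *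
      contractOp A (skew q) 0 * coeff τ γ (δ j (δ i x))) +
      wedgeOp A (skew q) j.succ * (wedgeOp A (skew q) i.succ *
      contractOp A (skew q) 0 * coeff τ γ (δ i (δ j x))) = 0 := by
    intro i j
    simp only [← mul_assoc]
    by_cases hij : i = j
    · subst hij
      rw [wedgeOp_mul_self]
      simp
    · rw [hδδ i j hij, wedgeOp_succ_swap hq i j, map_smul, mul_smul_comm, smul_mul_assoc,
        smul_mul_assoc]
      module
  refine Finset.sum_involution (fun p _ => p.swap) ?_ ?_ ?_ ?_
  · rintro ⟨i, j⟩ -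
    exact hterm i j
  · rintro ⟨i, j⟩ - hne h
    have : j = i := congrArg Prod.fst h
    subst this
    refine hne ?_
    dsimp only
    simp only [← mul_assoc]
    rw [wedgeOp_mul_self]
    simp
  · intro p _
    exact Finset.mem_univ _
  · intro p _
    exact Prod.swap_swap p

theorem commutator_frameHom (hq : ∀ i j, i ≠ j → q i j * q j i = 1)
    (hδδ : ∀ i j, i ≠ j → ∀ x, δ i (δ j x) = q i j • δ j (δ i x)) (x : A) :
    wedgeOp A (skew q) 0 * frameHom q τ γ δ hδ x - frameHom q τ γ δ hδ x * wedgeOp A (skew q) 0 =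
      -∑ i, wedgeOp A (skew q) i.succ * frameHom q τ γ δ hδ (δ i x) := by
  rw [sum_mul_frameHom q τ γ δ hδ hq hδδ, frameHom_apply, mul_add, add_mul, coeff_mul_zero,
    add_sub_add_left_eq_sub, nilPart_apply, Finset.sum_mul, Finset.mul_sum,
    ← Finset.sum_sub_distrib, ← Finset.sum_neg_distrib]
  refine Finset.sum_congr rfl fun i _ => ?_
  rw [mul_assoc _ (coeff τ γ _), coeff_mul_zero, ← mul_assoc, ← mul_assoc, ← mul_assoc,
    mul_assoc (wedgeOp A (skew q) i.succ), contractOp_zero_mul_zero, mul_sub, mul_one, ← mul_assoc,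
    wedgeOp_succ_mul_zero, smul_mul_assoc, sub_mul, smul_mul_assoc]
  module

theorem frameHom_vacuum (x : A) :
    frameHom q τ γ δ hδ x (Pi.single ∅ 1) = Pi.single ∅ x := by
  rw [frameHom_apply, LinearMap.add_apply, nilPart_apply, LinearMap.sum_apply,
    Finset.sum_eq_zero, add_zero, coeff, coeffHom_vacuum]
  intro i _
  rw [Module.End.mul_apply, coeff, coeffHom_vacuum, Module.End.mul_apply, contractOp_vacuum,
    map_zero]

/-- Skew derivations `δᵢ` dual to elements `yᵢ`, twisted by commuting automorphisms and
`q`-commuting with them and with one another, give an integrable calculus in which the `dyᵢ` are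
free generators of the one-forms.  The differential is the graded commutator with `ω₀`. -/
theorem exists_calculus [Nontrivial A] (hn : 1 ≤ n)
    (hδ : ∀ i x y, δ i (x * y) = δ i x * y + τ (γ i) x * δ i y)
    (hq : ∀ i j, i ≠ j → q i j * q j i = 1)
    (hτδ : ∀ i j, i ≠ j → ∀ x, τ (γ i) (δ j x) = q i j • δ j (τ (γ i) x))
    (hδδ : ∀ i j, i ≠ j → ∀ x, δ i (δ j x) = q i j • δ j (δ i x))
    (hker : ∀ a, (∀ i, δ i a = 0) → ∃ c : k, a = algebraMap k A c)
    (y : Fin n → A) (hy : ∀ i j, δ i (y j) = if i = j then 1 else 0) :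
    ∃ C : DifferentialCalculus k A, C.HasDimension n ∧ C.IsConnected ∧ C.IsIntegrable n := by
  have hmemW : ∀ i, wedgeOp A (skew q) (Fin.succ i) ∈
      Submodule.span k (Set.range fun i : Fin n => wedgeOp A (skew q) i.succ) :=
    fun i => Submodule.subset_span ⟨i, rfl⟩
  have hmemR : ∀ a, frameHom q τ γ δ hδ a ∈ LinearMap.range (frameHom q τ γ δ hδ).toLinearMap :=
    fun a => ⟨a, rfl⟩
  have hinv : ∀ (g : G) x, τ g (τ g⁻¹ x) = x := by
    intro g x
    rw [← AlgHom.mul_apply, ← map_mul, mul_inv_cancel, map_one, AlgHom.one_apply]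
  refine FormFrame.exists_calculus
    { ρ := frameHom q τ γ δ hδ
      parity := parityHom k A (n + 1)
      w := fun i => wedgeOp A (skew q) i.succ
      θ := wedgeOp A (skew q) 0
      ev := coeffAtVacuum (Fin.succOrderEmb n)
      ν := AlgEquiv.ofAlgHom (τ (∏ i, γ i)) (τ (∏ i, γ i)⁻¹) (AlgHom.ext (hinv _))
        (AlgHom.ext fun x => by
          have := hinv (∏ i, γ i)⁻¹ x
          rwa [inv_inv] at this)
      parity_ρ := ?_
      parity_w := fun i => parityHom_wedgeOp _ _
      parity_θ := parityHom_wedgeOp _ _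
      θ_sq := wedgeOp_mul_self _ _
      w_sq := fun i => wedgeOp_mul_self _ _
      w_swap := fun i j h => ⟨-q j i, neg_ne_zero.2 (left_ne_zero_of_mul_eq_one (hq j i h.ne')),
        wedgeOp_succ_swap hq j i⟩
      ev_form := fun S a => coeffAtVacuum_orderedForm _ (Fin.succOrderEmb n)
        (frameHom_vacuum q τ γ δ hδ a) S
      ρ_mul_w := ?_
      w_mul_ρ := ?_
      comm_θ := ?_
      θ_w := ?_
      scalar_of_comm := ?_
      dense := ?_
      ev_ρ_mul_vol := ?_ } hn
  · intro a
    rw [frameHom_apply, map_add, coeff, parityHom_coeffHom, nilPart_apply, map_sum]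
    congr 1
    refine Finset.sum_congr rfl fun i _ => ?_
    rw [map_mul, map_mul, parityHom_wedgeOp, parityHom_contractOp, coeff, parityHom_coeffHom]
    refine LinearMap.ext fun y => ?_
    simp only [Module.End.mul_apply, LinearMap.neg_apply, map_neg, neg_neg]
  · intro a i
    rw [frameHom_mul_succ q τ γ δ hδ hq hτδ]
    exact Submodule.mul_mem_mul (hmemW i) (hmemR _)
  · intro a i
    have h := frameHom_mul_succ q τ γ δ hδ hq hτδ (τ (γ i)⁻¹ a) i
    rw [hinv] at h
    rw [← h]
    exact Submodule.mul_mem_mul (hmemR _) (hmemW i)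
  · intro a
    rw [commutator_frameHom q τ γ δ hδ hq hδδ]
    exact Submodule.neg_mem _ (Submodule.sum_mem _ fun i _ =>
      Submodule.mul_mem_mul (hmemW i) (hmemR _))
  · intro i
    rw [wedgeOp_succ_mul_zero]
    have h0 : ∀ X : Module.End k (Finset (Fin (n + 1)) → A), X + (-1 : k) • X = 0 := fun X => by
      module
    rw [h0]
    exact zero_mem _
  · intro a ha
    refine hker a fun i => ?_
    have h := commutator_frameHom q τ γ δ hδ hq hδδ a
    rw [ha, sub_self, sum_mul_frameHom q τ γ δ hδ hq hδδ, eq_comm, neg_eq_zero] at h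
    have h2 := congrFun (LinearMap.congr_fun h (Pi.single ∅ 1)) {i.succ}
    rw [LinearMap.sum_apply, Finset.sum_apply, Finset.sum_eq_single i] at h2
    · rw [Module.End.mul_apply, coeff, coeffHom_vacuum, wedgeOp_single _ (by simp)] at h2
      simpa using h2
    · intro j _ hj
      rw [Module.End.mul_apply, coeff, coeffHom_vacuum, wedgeOp_single _ (by simp),
        Pi.single_eq_of_ne]
      simpa using hj.symm
    · simp
  · intro i
    have h : wedgeOp A (skew q) i.succ = -(frameHom q τ γ δ hδ 1 *
        (wedgeOp A (skew q) 0 * frameHom q τ γ δ hδ (y i) -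
          frameHom q τ γ δ hδ (y i) * wedgeOp A (skew q) 0)) := by
      rw [commutator_frameHom q τ γ δ hδ hq hδδ, map_one, one_mul, neg_neg,
        Finset.sum_eq_single i]
      · rw [hy, if_pos rfl, map_one, mul_one]
      · intro j _ hj
        rw [hy, if_neg hj, map_zero, mul_zero]
      · simp
    rw [h]
    exact Submodule.neg_mem _ (Submodule.subset_span ⟨_, _, rfl⟩)
  · intro a
    change (frameHom q τ γ δ hδ a * orderedForm (fun i : Fin n => wedgeOp A (skew q)
      (Fin.succOrderEmb n i)) Finset.univ) (Pi.single ∅ 1) (Finset.univ.map (Fin.succEmb n)) = _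
    rw [Module.End.mul_apply, orderedForm_single, frameHom_apply, LinearMap.add_apply,
      Pi.add_apply, nilPart_apply, LinearMap.sum_apply, Finset.sum_eq_zero, Pi.zero_apply,
      add_zero]
    · refine (coeffHom_apply τ _ a _ _).trans ?_
      refine (congrArg (_ * ·) (Pi.single_eq_same _ _)).trans ?_
      rw [Finset.prod_map]
      simp
    · intro i _
      rw [mul_assoc, ← coeff_mul_contractOp, ← mul_assoc, Module.End.mul_apply]
      have h0 : contractOp A (skew q) 0
          (Pi.single (Finset.univ.map (Fin.succOrderEmb n).toEmbedding) (1 : A)) = 0 := by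
        funext S
        rw [contractOp_apply]
        split_ifs
        · rfl
        · rw [Pi.single_eq_of_ne, smul_zero]
          · rfl
          · intro h
            have h0 : (0 : Fin (n + 1)) ∈ Finset.univ.map (Fin.succOrderEmb n).toEmbedding := by
              rw [← h]
              exact Finset.mem_insert_self _ _
            simp at h0
      rw [h0, map_zero]

end QuantumAffineModel

/-! ### Ordered monomials and straightening relations -/

/-- The ordered monomial `y_{N-1} ^ e_{N-1} * ⋯ * y_0 ^ e_0`. -/
def ordMonomial {N : ℕ} {B : Type*} [Monoid B] (y : Fin N → B) (e : Fin N → ℕ) : B :=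
  ((List.finRange N).reverse.map fun a => y a ^ e a).prod

theorem ordMonomial_eq_last_mul {N : ℕ} {B : Type*} [Monoid B] (y : Fin (N + 1) → B)
    (e : Fin (N + 1) → ℕ) : ordMonomial y e = y (Fin.last N) ^ e (Fin.last N) *
      ordMonomial (fun a => y a.castSucc) (fun a => e a.castSucc) := by
  simp [ordMonomial, List.finRange_succ_last, ← List.map_reverse, Function.comp_def]

theorem ordMonomial_eq_mul_zero {N : ℕ} {B : Type*} [Monoid B] (y : Fin (N + 1) → B)
    (e : Fin (N + 1) → ℕ) : ordMonomial y e =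
      ordMonomial (fun a => y a.succ) (fun a => e a.succ) * y 0 ^ e 0 := by
  simp [ordMonomial, List.finRange_succ, ← List.map_reverse, Function.comp_def]

@[simp] theorem ordMonomial_zero {N : ℕ} {B : Type*} [Monoid B] (y : Fin N → B) :
    ordMonomial y 0 = 1 := by
  simp [ordMonomial]

theorem mul_ordMonomial {N : ℕ} {B : Type*} [Monoid B] (y : Fin N → B) (e : Fin N → ℕ) (b : Fin N)
    (h : ∀ a, b < a → e a = 0) : y b * ordMonomial y e = ordMonomial y (e + Pi.single b 1) := by
  induction N with
  | zero => exact b.elim0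
  | succ N ih =>
    rw [ordMonomial_eq_last_mul, ordMonomial_eq_last_mul]
    induction b using Fin.lastCases with
    | last =>
      have h1 : (fun a : Fin N => (e + Pi.single (Fin.last N) 1 : Fin (N + 1) → ℕ) a.castSucc) =
          fun a => e a.castSucc := by
        funext a
        simp
      rw [h1, ← mul_assoc, ← pow_succ']
      simp
    | cast b =>
      have h1 : (fun a : Fin N => (e + Pi.single b.castSucc 1 : Fin (N + 1) → ℕ) a.castSucc) =
          (fun a => e a.castSucc) + Pi.single b 1 := by
        funext a
        by_cases hab : a = b
        · subst hab
          simp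
        · simp [Pi.single_eq_of_ne hab,
            Pi.single_eq_of_ne (fun h' => hab (Fin.castSucc_injective N h'))]
      rw [h1, ← ih (fun a => y a.castSucc) (fun a => e a.castSucc) b
        (fun a ha => h _ (Fin.castSucc_lt_castSucc_iff.2 ha))]
      have h2 := h (Fin.last N) (Fin.castSucc_lt_last b)
      simp [h2]

theorem ordMonomial_mul_zero {N : ℕ} {B : Type*} [Monoid B] (y : Fin (N + 1) → B)
    (e : Fin (N + 1) → ℕ) : ordMonomial y e * y 0 = ordMonomial y (e + Pi.single 0 1) := by
  rw [ordMonomial_eq_mul_zero, ordMonomial_eq_mul_zero, mul_assoc, ← pow_succ]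
  simp [Fin.succ_ne_zero]

/-- Ordered monomials are built from `1` by left multiplications with the generators. -/
theorem ordMonomial_induction_exponent {N : ℕ} {B : Type*} [Monoid B] (y : Fin N → B)
    {p : (Fin N → ℕ) → B → Prop} (h1 : p 0 1)
    (hm : ∀ a e x, p e x → p (e + Pi.single a 1) (y a * x)) (e : Fin N → ℕ) :
    p e (ordMonomial y e) := by
  have hpow : ∀ a r e x, p e x → p (e + Pi.single a r) (y a ^ r * x) := by
    intro a r e x hx
    induction r with
    | zero => simpa using hx
    | succ r ih =>
      rw [pow_succ', mul_assoc, Pi.single_add, ← add_assoc]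
      exact hm _ _ _ ih
  have hlist : ∀ l : List (Fin N),
      p (l.map fun a => Pi.single a (e a)).sum (l.map fun a => y a ^ e a).prod := by
    intro l
    induction l with
    | nil => simpa using h1
    | cons a l ih =>
      rw [List.map_cons, List.sum_cons, List.map_cons, List.prod_cons, add_comm]
      exact hpow a (e a) _ _ ih
  have := hlist (List.finRange N).reverse
  rwa [List.map_reverse, List.sum_reverse, ← List.ofFn_eq_map, List.sum_ofFn,
    Finset.univ_sum_single] at this

theorem sum_add_single {N : ℕ} (e : Fin N → ℕ) (m : Fin N) :
    ∑ a, (e + Pi.single m 1 : Fin N → ℕ) a = ∑ a, e a + 1 := by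
  simp [Finset.sum_add_distrib]

theorem ordMonomial_induction {N : ℕ} {B : Type*} [Monoid B] (y : Fin N → B)
    {p : ℕ → B → Prop} (h1 : p 0 1) (hm : ∀ a n x, p n x → p (n + 1) (y a * x)) (e : Fin N → ℕ) :
    p (∑ a, e a) (ordMonomial y e) := by
  refine ordMonomial_induction_exponent y (p := fun e x => p (∑ a, e a) x) (by simpa using h1) ?_ e
  intro a e x hx
  rw [sum_add_single]
  exact hm _ _ _ hx

/-- The generator with the largest index that occurs in a monomial can be split off on the left. -/
theorem exists_max_exponent {N : ℕ} {e : Fin N → ℕ} (he : e ≠ 0) :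
    ∃ (m : Fin N) (e' : Fin N → ℕ), e = e' + Pi.single m 1 ∧ ∀ a, m < a → e' a = 0 := by
  have hne : (Finset.univ.filter fun a => e a ≠ 0).Nonempty := by
    by_contra h
    refine he (funext fun a => ?_)
    by_contra ha
    exact h ⟨a, by simpa using ha⟩
  obtain ⟨m, hm, hmax⟩ := Finset.exists_max_image _ id hne
  have hm0 : e m ≠ 0 := (Finset.mem_filter.1 hm).2
  refine ⟨m, e - Pi.single m 1, ?_, fun a ha => ?_⟩
  · funext a
    by_cases ham : a = m
    · subst ham
      simp
      omega
    · simp [Pi.single_eq_of_ne ham]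
  · have : e a = 0 := by
      by_contra h
      exact absurd (hmax a (Finset.mem_filter.2 ⟨Finset.mem_univ _, h⟩)) (not_le.2 ha)
    simp [this]

section straightening

variable {k : Type v} [Field k] {N : ℕ}

/-- The coefficients of straightening relations
`y_a y_b = swap y_b y_a + left y_a + right y_b + const`, one for each pair `a < b`. -/
structure Straightening (k : Type v) (N : ℕ) where
  swap : Fin N → Fin N → k
  left : Fin N → Fin N → k
  right : Fin N → Fin N → k
  const : Fin N → Fin N → k

/-- The elements `y_a` satisfy the given straightening relations. -/
def Straightening.Holds (Q : Straightening k N) {B : Type*} [Ring B] [Algebra k B]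
    (y : Fin N → B) : Prop :=
  ∀ a b, a < b → y a * y b =
    Q.swap a b • (y b * y a) + Q.left a b • y a + Q.right a b • y b + Q.const a b • 1

/-- The span of the ordered monomials of degree at most `n` in the generators with index below
`b`. -/
def monomialSpan (k : Type v) [Field k] {B : Type*} [Ring B] [Algebra k B] (y : Fin N → B)
    (n b : ℕ) : Submodule k B :=
  Submodule.span k (ordMonomial y '' {e | ∑ a, e a ≤ n ∧ ∀ a : Fin N, b ≤ a → e a = 0})

/-- The span of `1` and the generators. -/
def generatorSpan (k : Type v) [Field k] {B : Type*} [Ring B] [Algebra k B] (y : Fin N → B) :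
    Submodule k B :=
  Submodule.span k (insert 1 (Set.range y))

variable {B : Type*} [Ring B] [Algebra k B] {y : Fin N → B}

theorem ordMonomial_mem {n b : ℕ} {e : Fin N → ℕ} (h : ∑ a, e a ≤ n)
    (h' : ∀ a : Fin N, b ≤ a → e a = 0) : ordMonomial y e ∈ monomialSpan k y n b :=
  Submodule.subset_span ⟨e, ⟨h, h'⟩, rfl⟩

theorem monomialSpan_mono {n n' b b' : ℕ} (h : n ≤ n') (h' : b ≤ b') :
    monomialSpan k y n b ≤ monomialSpan k y n' b' :=
  Submodule.span_mono (Set.image_mono fun _ he =>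
    ⟨he.1.trans h, fun a ha => he.2 a (h'.trans ha)⟩)

theorem mul_mem_monomialSpan_of_max {n : ℕ} {x : B} (m : Fin N)
    (hx : x ∈ monomialSpan k y n (m + 1)) : y m * x ∈ monomialSpan k y (n + 1) (m + 1) := by
  refine (Submodule.span_le (p := (monomialSpan k y (n + 1) (m + 1)).comap
    (LinearMap.mulLeft k (y m)))).2 ?_ hx
  rintro _ ⟨e, ⟨h1, h2⟩, rfl⟩
  change y m * ordMonomial y e ∈ monomialSpan k y _ _
  rw [mul_ordMonomial y e m fun a ha => h2 a ha]
  refine ordMonomial_mem (by rw [sum_add_single]; omega) fun a ha => ?_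
  have ham : a ≠ m := by
    rintro rfl
    omega
  simp [h2 a ha, Pi.single_eq_of_ne ham]

variable {Q : Straightening k N}

/-- Straightening: multiplication by a generator raises the degree of an ordered monomial by at most
one, and introduces no generators of larger index. -/
theorem mul_mem_monomialSpan (hy : Q.Holds y) (n b : ℕ) (a : Fin N)
    (hab : (a : ℕ) < b) {x : B} (hx : x ∈ monomialSpan k y n b) :
    y a * x ∈ monomialSpan k y (n + 1) b := by
  induction n generalizing b a x with
  | zero =>
    refine (Submodule.span_le (p := (monomialSpan k y (0 + 1) b).comap
      (LinearMap.mulLeft k (y a)))).2 ?_ hx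
    rintro _ ⟨e, ⟨h1, h2⟩, rfl⟩
    change y a * ordMonomial y e ∈ monomialSpan k y _ _
    have he : e = 0 := by
      funext i
      exact Finset.sum_eq_zero_iff.1 (Nat.le_zero.1 h1) i (Finset.mem_univ i)
    rw [mul_ordMonomial y e a (by simp [he])]
    refine ordMonomial_mem (by rw [sum_add_single]; omega) fun i hi => ?_
    have : i ≠ a := by
      rintro rfl
      omega
    simp [he, Pi.single_eq_of_ne this]
  | succ n ih =>
    refine (Submodule.span_le (p := (monomialSpan k y (n + 1 + 1) b).comap
      (LinearMap.mulLeft k (y a)))).2 ?_ hx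
    rintro _ ⟨e, ⟨h1, h2⟩, rfl⟩
    change y a * ordMonomial y e ∈ monomialSpan k y _ _
    by_cases hlead : ∀ i, a < i → e i = 0
    · rw [mul_ordMonomial y e a hlead]
      refine ordMonomial_mem (by rw [sum_add_single]; omega) fun i hi => ?_
      have : i ≠ a := by
        rintro rfl
        omega
      simp [h2 i hi, Pi.single_eq_of_ne this]
    · have he : e ≠ 0 := by
        rintro rfl
        exact hlead fun i _ => rfl
      obtain ⟨m, e', rfl, hm⟩ := exists_max_exponent he
      have ham : a < m := by
        by_contra h
        refine hlead fun i hi => ?_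
        have him : m < i := lt_of_le_of_lt (not_lt.1 h) hi
        simp [hm i him, Pi.single_eq_of_ne him.ne']
      have hmb : (m : ℕ) < b := by
        by_contra h
        have := h2 m (not_lt.1 h)
        simp at this
      rw [sum_add_single] at h1
      have hM : ordMonomial y e' ∈ monomialSpan k y n (m + 1) :=
        ordMonomial_mem (by omega) fun i hi => hm i hi
      have ha := ih (m + 1) a (Nat.lt_succ_of_lt ham) hM
      have hm' := ih (m + 1) m (Nat.lt_succ_self _) hM
      rw [← mul_ordMonomial y e' m hm, ← mul_assoc, hy a m ham]
      simp only [add_mul, smul_mul_assoc, one_mul, mul_assoc]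
      refine monomialSpan_mono le_rfl hmb (Submodule.add_mem _ (Submodule.add_mem _
        (Submodule.add_mem _ (Submodule.smul_mem _ _ ?_) (Submodule.smul_mem _ _ ?_))
        (Submodule.smul_mem _ _ ?_)) (Submodule.smul_mem _ _ ?_))
      · exact mul_mem_monomialSpan_of_max m ha
      · exact monomialSpan_mono (Nat.le_succ _) le_rfl ha
      · exact monomialSpan_mono (Nat.le_succ _) le_rfl hm'
      · exact monomialSpan_mono (by omega) le_rfl hM

theorem one_mem_generatorSpan : (1 : B) ∈ generatorSpan k y :=
  Submodule.subset_span (Set.mem_insert _ _)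

theorem mem_generatorSpan (a : Fin N) : y a ∈ generatorSpan k y :=
  Submodule.subset_span (Set.mem_insert_of_mem _ ⟨a, rfl⟩)

theorem pow_mono_of_one_mem {V : Submodule k B} (h : (1 : B) ∈ V) : Monotone fun n => V ^ n := by
  refine monotone_nat_of_le_succ fun n x hx => ?_
  change x ∈ V ^ (n + 1)
  rw [pow_succ, ← mul_one x]
  exact Submodule.mul_mem_mul hx h

/-- The powers of the span of `1` and the generators are spanned by the ordered monomials of bounded
degree. -/
theorem generatorSpan_pow (hy : Q.Holds y) (n : ℕ) :
    generatorSpan k y ^ n = monomialSpan k y n N := by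
  apply le_antisymm
  · induction n with
    | zero =>
      rw [pow_zero, Submodule.one_eq_span, Submodule.span_le, Set.singleton_subset_iff,
        ← ordMonomial_zero y]
      exact ordMonomial_mem (by simp) (by simp)
    | succ n ih =>
      rw [pow_succ', Submodule.mul_le]
      intro v hv x hx
      refine (Submodule.span_le (p := (monomialSpan k y (n + 1) N).comap
        (LinearMap.mulRight k x))).2 ?_ hv
      rintro _ (rfl | ⟨a, rfl⟩)
      · simpa using monomialSpan_mono (Nat.le_succ n) le_rfl (ih hx)
      · exact mul_mem_monomialSpan hy n N a a.2 (ih hx)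
  · rw [monomialSpan, Submodule.span_le]
    rintro _ ⟨e, ⟨h1, -⟩, rfl⟩
    refine pow_mono_of_one_mem one_mem_generatorSpan h1 ?_
    refine ordMonomial_induction y (p := fun n x => x ∈ generatorSpan k y ^ n) ?_ ?_ e
    · rw [pow_zero]
      exact Submodule.one_le.1 le_rfl
    · intro a n x hx
      rw [pow_succ']
      exact Submodule.mul_mem_mul (mem_generatorSpan a) hx

/-- The ordered monomials span if and only if the generators generate. -/
theorem span_ordMonomial_eq_top_iff (hy : Q.Holds y) :
    Submodule.span k (Set.range (ordMonomial y)) = ⊤ ↔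
      ∀ x : B, ∃ n, x ∈ generatorSpan k y ^ n := by
  have hsup : Submodule.span k (Set.range (ordMonomial y)) = ⨆ n, generatorSpan k y ^ n := by
    apply le_antisymm
    · rw [Submodule.span_le]
      rintro _ ⟨e, rfl⟩
      refine Submodule.mem_iSup_of_mem (∑ a, e a) ?_
      rw [generatorSpan_pow hy]
      exact ordMonomial_mem le_rfl fun a ha => absurd a.2 (not_lt.2 ha)
    · refine iSup_le fun n => ?_
      rw [generatorSpan_pow hy]
      exact Submodule.span_mono (Set.image_subset_range _ _)
  rw [hsup, Submodule.eq_top_iff']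
  refine forall_congr' fun x => ?_
  exact Submodule.mem_iSup_of_directed _
    (pow_mono_of_one_mem one_mem_generatorSpan).directed_le

end straightening

/-! ### Algebras with a basis of ordered monomials -/

/-- The exponents of total degree at most `n`. -/
def degreeLE (N n : ℕ) : Finset (Fin N → ℕ) :=
  (Fintype.piFinset fun _ => Finset.range (n + 1)).filter fun e => ∑ a, e a ≤ n

theorem mem_degreeLE {N n : ℕ} {e : Fin N → ℕ} : e ∈ degreeLE N n ↔ ∑ a, e a ≤ n := by
  rw [degreeLE, Finset.mem_filter, Fintype.mem_piFinset]
  refine ⟨fun h => h.2, fun h => ⟨fun a => Finset.mem_range.2 (Nat.lt_succ_of_le ?_), h⟩⟩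
  exact (Finset.single_le_sum (fun _ _ => Nat.zero_le _) (Finset.mem_univ a)).trans h

theorem card_degreeLE_le (N n : ℕ) : (degreeLE N n).card ≤ (n + 1) ^ N := by
  refine (Finset.card_filter_le _ _).trans ?_
  simp

theorem le_card_degreeLE (N n : ℕ) : (n / N + 1) ^ N ≤ (degreeLE N n).card := by
  have h : (Fintype.piFinset fun _ : Fin N => Finset.range (n / N + 1)) ⊆ degreeLE N n := by
    intro e he
    rw [Fintype.mem_piFinset] at he
    rw [mem_degreeLE]
    calc ∑ a, e a ≤ ∑ _a : Fin N, n / N :=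
          Finset.sum_le_sum fun a _ => Nat.lt_succ_iff.1 (Finset.mem_range.1 (he a))
      _ = N * (n / N) := by simp
      _ ≤ n := Nat.mul_div_le n N
  simpa using Finset.card_le_card h

section

variable {k : Type v} [Field k] {N : ℕ} {B : Type*} [Ring B] [Algebra k B]

theorem monomialSpan_eq_span_degreeLE (y : Fin N → B) (n : ℕ) :
    monomialSpan k y n N =
      Submodule.span k (Set.range fun e : degreeLE N n => ordMonomial y (e : Fin N → ℕ)) := by
  rw [monomialSpan]
  congr 1
  ext x
  constructor
  · rintro ⟨e, ⟨h, -⟩, rfl⟩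
    exact ⟨⟨e, mem_degreeLE.2 h⟩, rfl⟩
  · rintro ⟨⟨e, h⟩, rfl⟩
    exact ⟨e, ⟨mem_degreeLE.1 h, fun a ha => absurd a.2 (not_lt.2 ha)⟩, rfl⟩

/-- The elements `y` satisfy straightening relations, and the ordered monomials in `y` are a
linear basis of the algebra. -/
structure IsPBW (Q : Straightening k N) (y : Fin N → B) : Prop where
  rel : Q.Holds y
  linInd : LinearIndependent k (ordMonomial y)
  span_eq : Submodule.span k (Set.range (ordMonomial y)) = ⊤

theorem linearIndependent_ordMonomial_iff {y : Fin N → B} : LinearIndependent k (ordMonomial y) ↔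
    ∀ n, LinearIndependent k fun e : degreeLE N n => ordMonomial y (e : Fin N → ℕ) := by
  constructor
  · intro h n
    exact h.comp _ Subtype.val_injective
  · intro h
    rw [linearIndependent_iff_finset_linearIndependent]
    intro s
    have hs : ∀ e ∈ s, e ∈ degreeLE N (∑ e ∈ s, ∑ a, e a) := fun e he =>
      mem_degreeLE.2 (Finset.single_le_sum (f := fun e : Fin N → ℕ => ∑ a, e a)
        (fun _ _ => Nat.zero_le _) he)
    exact (h (∑ e ∈ s, ∑ a, e a)).comp (fun e : s => ⟨e, hs e e.2⟩) fun e e' h =>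
      Subtype.ext (congrArg Subtype.val h :)

variable {Q : Straightening k N} {y : Fin N → B}

theorem IsPBW.finrank_pow (h : IsPBW Q y) (n : ℕ) :
    Module.finrank k (generatorSpan k y ^ n : Submodule k B) = (degreeLE N n).card := by
  rw [generatorSpan_pow h.rel, monomialSpan_eq_span_degreeLE,
    finrank_span_eq_card (linearIndependent_ordMonomial_iff.1 h.linInd n), Fintype.card_coe]

/-- A change of generators preserves the basis property: the ordered monomials of degree at most `n`
in the new generators span a space of the right dimension. -/
theorem IsPBW.of_generatorSpan_eq {Q' : Straightening k N} {y' : Fin N → B} (h : IsPBW Q y)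
    (hy : Q'.Holds y') (heq : generatorSpan k y' = generatorSpan k y) : IsPBW Q' y' where
  rel := hy
  linInd := by
    rw [linearIndependent_ordMonomial_iff]
    intro n
    rw [linearIndependent_iff_card_eq_finrank_span, Set.finrank, ← monomialSpan_eq_span_degreeLE,
      ← generatorSpan_pow hy, heq, h.finrank_pow, Fintype.card_coe]
  span_eq := by
    rw [span_ordMonomial_eq_top_iff hy, heq, ← span_ordMonomial_eq_top_iff h.rel]
    exact h.span_eq

theorem ordMonomial_map {B' : Type*} [Ring B'] [Algebra k B'] (φ : B →ₐ[k] B') (y : Fin N → B)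
    (e : Fin N → ℕ) : φ (ordMonomial y e) = ordMonomial (fun a => φ (y a)) e := by
  simp [ordMonomial, map_list_prod, Function.comp_def]

/-- The straightening relations as a relation on the free algebra. -/
inductive Straightening.Rel (Q : Straightening k N) :
    FreeAlgebra k (Fin N) → FreeAlgebra k (Fin N) → Prop
  | rel (a b : Fin N) (h : a < b) : Straightening.Rel Q
      (FreeAlgebra.ι k a * FreeAlgebra.ι k b)
      (Q.swap a b • (FreeAlgebra.ι k b * FreeAlgebra.ι k a) + Q.left a b • FreeAlgebra.ι k a +
        Q.right a b • FreeAlgebra.ι k b + Q.const a b • 1)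

theorem Straightening.Holds.lift_eq (h : Q.Holds y) {r s : FreeAlgebra k (Fin N)}
    (hrs : Q.Rel r s) : FreeAlgebra.lift k y r = FreeAlgebra.lift k y s := by
  obtain ⟨a, b, hab⟩ := hrs
  simpa using h a b hab

theorem IsPBW.exists_sum (h : IsPBW Q y) (x : B) :
    ∃ f : (Fin N → ℕ) →₀ k, f.sum (fun e r => r • ordMonomial y e) = x := by
  have hx : x ∈ Submodule.span k (Set.range (ordMonomial y)) := by
    rw [h.span_eq]
    trivial
  exact Finsupp.mem_span_range_iff_exists_finsupp.1 hx

/-- An algebra with a basis of ordered monomials is presented by its straightening relations: the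
ordered monomials span the presented algebra, and their images are linearly independent. -/
theorem IsPBW.exists_lift (h : IsPBW Q y) {B' : Type*} [Ring B'] [Algebra k B'] {y' : Fin N → B'}
    (hy' : Q.Holds y') : ∃ φ : B →ₐ[k] B', ∀ a, φ (y a) = y' a := by
  let P := RingQuot Q.Rel
  let Y : Fin N → P := fun a => RingQuot.mkAlgHom k Q.Rel (FreeAlgebra.ι k a)
  have hlift : FreeAlgebra.lift k Y = RingQuot.mkAlgHom k Q.Rel := by
    ext a
    simp [Y]
  have hY : Q.Holds Y := by
    intro a b hab
    have := RingQuot.mkAlgHom_rel k (Straightening.Rel.rel (Q := Q) a b hab)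
    simpa [Y] using this
  let π : P →ₐ[k] B := RingQuot.liftAlgHom k
    ⟨FreeAlgebra.lift k y, fun _ _ hrs => h.rel.lift_eq hrs⟩
  have hπ : ∀ a, π (Y a) = y a := by
    intro a
    exact (RingQuot.liftAlgHom_mkAlgHom_apply k _ _ _).trans (FreeAlgebra.lift_ι_apply _ _)
  let ψ : P →ₐ[k] B' := RingQuot.liftAlgHom k
    ⟨FreeAlgebra.lift k y', fun _ _ hrs => hy'.lift_eq hrs⟩
  have hψ : ∀ a, ψ (Y a) = y' a := by
    intro a
    exact (RingQuot.liftAlgHom_mkAlgHom_apply k _ _ _).trans (FreeAlgebra.lift_ι_apply _ _)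
  have htop : Submodule.span k (Set.range (ordMonomial Y)) = ⊤ := by
    rw [span_ordMonomial_eq_top_iff hY]
    intro p
    obtain ⟨r, rfl⟩ := RingQuot.mkAlgHom_surjective k Q.Rel p
    rw [← hlift]
    induction r with
    | grade0 t =>
      refine ⟨0, ?_⟩
      rw [AlgHom.commutes, pow_zero]
      exact Submodule.algebraMap_mem t
    | grade1 a => exact ⟨1, by simpa using mem_generatorSpan a⟩
    | mul r s hr hs =>
      obtain ⟨n, hn⟩ := hr
      obtain ⟨m, hm⟩ := hs
      refine ⟨n + m, ?_⟩
      rw [map_mul, pow_add]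
      exact Submodule.mul_mem_mul hn hm
    | add r s hr hs =>
      obtain ⟨n, hn⟩ := hr
      obtain ⟨m, hm⟩ := hs
      refine ⟨max n m, ?_⟩
      rw [map_add]
      exact Submodule.add_mem _ (pow_mono_of_one_mem one_mem_generatorSpan (le_max_left n m) hn)
        (pow_mono_of_one_mem one_mem_generatorSpan (le_max_right n m) hm)
  have hmon : ∀ e, π (ordMonomial Y e) = ordMonomial y e := by
    intro e
    rw [ordMonomial_map]
    simp only [hπ]
  have hbij : Function.Bijective π := by
    constructor
    · rw [injective_iff_map_eq_zero]
      intro p hp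
      have hmem : p ∈ Submodule.span k (Set.range (ordMonomial Y)) := by
        rw [htop]
        trivial
      obtain ⟨f, rfl⟩ := Finsupp.mem_span_range_iff_exists_finsupp.1 hmem
      have hf : f = 0 := by
        refine linearIndependent_iff.1 h.linInd f ?_
        rw [Finsupp.linearCombination_apply, ← hp, Finsupp.sum, Finsupp.sum, map_sum]
        refine Finset.sum_congr rfl fun e _ => ?_
        rw [map_smul, hmon]
      rw [hf, Finsupp.sum_zero_index]
    · intro x
      obtain ⟨f, rfl⟩ := h.exists_sum x
      refine ⟨f.sum fun e r => r • ordMonomial Y e, ?_⟩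
      rw [Finsupp.sum, Finsupp.sum, map_sum]
      refine Finset.sum_congr rfl fun e _ => ?_
      rw [map_smul, hmon]
  let φ := AlgEquiv.ofBijective π hbij
  refine ⟨ψ.comp (φ.symm : B →ₐ[k] P), fun a => ?_⟩
  have : φ.symm (y a) = Y a := by
    rw [AlgEquiv.symm_apply_eq]
    exact (hπ a).symm
  simp [this, hψ]

/-- Induction over an algebra generated by the `y a`. -/
theorem IsPBW.induction (h : IsPBW Q y) {p : B → Prop} (h1 : p 1)
    (hy : ∀ a x, p x → p (y a * x)) (hadd : ∀ x x', p x → p x' → p (x + x'))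
    (hsmul : ∀ (r : k) x, p x → p (r • x)) (x : B) : p x := by
  have hmon : ∀ e, p (ordMonomial y e) := fun e =>
    ordMonomial_induction y (p := fun _ x => p x) h1 (fun a _ x hx => hy a x hx) e
  have hx : x ∈ Submodule.span k (Set.range (ordMonomial y)) := by
    rw [h.span_eq]
    trivial
  induction hx using Submodule.span_induction with
  | mem x hx =>
    obtain ⟨e, rfl⟩ := hx
    exact hmon e
  | zero =>
    have := hsmul 0 1 h1
    rwa [zero_smul] at this
  | add x x' _ _ hx hx' => exact hadd x x' hx hx'
  | smul r x _ hx => exact hsmul r x hx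

theorem IsPBW.algHom_ext (h : IsPBW Q y) {B' : Type*} [Ring B'] [Algebra k B']
    {φ ψ : B →ₐ[k] B'} (hφ : ∀ a, φ (y a) = ψ (y a)) : φ = ψ := by
  refine AlgHom.ext fun x => h.induction (p := fun x => φ x = ψ x) (by simp) ?_ ?_ ?_ x
  · intro a x hx
    rw [map_mul, map_mul, hφ, hx]
  · intro x x' hx hx'
    rw [map_add, map_add, hx, hx']
  · intro r x hx
    rw [map_smul, map_smul, hx]

/-- Rescalings of the generators which respect the relations extend to automorphisms. -/
theorem IsPBW.exists_scaling (h : IsPBW Q y) {s : Fin N → k} (hs : ∀ a, s a ≠ 0)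
    (h1 : Q.Holds fun a => s a • y a) (h2 : Q.Holds fun a => (s a)⁻¹ • y a) :
    ∃ σ : B ≃ₐ[k] B, ∀ a, σ (y a) = s a • y a := by
  obtain ⟨φ, hφ⟩ := h.exists_lift h1
  obtain ⟨ψ, hψ⟩ := h.exists_lift h2
  refine ⟨AlgEquiv.ofAlgHom φ ψ (h.algHom_ext fun a => ?_) (h.algHom_ext fun a => ?_), hφ⟩
  · simp [hφ, hψ, smul_smul, hs a]
  · simp [hφ, hψ, smul_smul, hs a]

/-- Values on the generators which are compatible with the relations extend to a twisted derivation
`δ`: the map `x ↦ !![σ x, δ x; 0, x]` is a homomorphism. -/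
theorem IsPBW.exists_twistedDerivation (h : IsPBW Q y) (σ : B →ₐ[k] B) (d : Fin N → B)
    (hd : ∀ a b, a < b → d a * y b + σ (y a) * d b =
      Q.swap a b • (d b * y a + σ (y b) * d a) + Q.left a b • d a + Q.right a b • d b) :
    ∃ δ : B →ₗ[k] B, (∀ x x', δ (x * x') = δ x * x' + σ x * δ x') ∧ ∀ a, δ (y a) = d a := by
  have hrel : Q.Holds fun a => (!![σ (y a), d a; 0, y a] : Matrix (Fin 2) (Fin 2) B) := by
    intro a b hab
    have h1 := congrArg σ (h.rel a b hab)
    simp only [map_mul, map_add, map_smul, map_one] at h1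
    have h2 := hd a b hab
    rw [add_comm (d a * y b), add_comm (d b * y a)] at h2
    rw [Matrix.one_fin_two, Matrix.mul_fin_two, Matrix.mul_fin_two]
    simp only [Matrix.smul_of, Matrix.smul_cons, Matrix.smul_empty, Matrix.of_add_of,
      Matrix.add_cons, Matrix.head_cons, Matrix.tail_cons, Matrix.empty_add_empty, mul_zero,
      zero_mul, add_zero, zero_add, smul_zero, h1, h2, h.rel a b hab]
  obtain ⟨φ, hφ⟩ := h.exists_lift hrel
  have hform : ∀ x, φ x = !![σ x, φ x 0 1; 0, x] := by
    refine h.induction ?_ ?_ ?_ ?_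
    · rw [map_one, map_one, Matrix.one_fin_two]
      simp
    · intro a x hx
      rw [map_mul, hφ, hx]
      simp
    · intro x x' hx hx'
      rw [map_add, hx, hx']
      simp
    · intro r x hx
      rw [map_smul, hx]
      simp
  let δ : B →ₗ[k] B :=
    { toFun := fun x => φ x 0 1
      map_add' := fun x x' => by simp
      map_smul' := fun r x => by simp }
  refine ⟨δ, fun x x' => ?_, fun a => ?_⟩
  · change φ (x * x') 0 1 = φ x 0 1 * x' + σ x * φ x' 0 1
    rw [map_mul, hform x, hform x']
    simp [add_comm]
  · change φ (y a) 0 1 = d a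
    rw [hφ]
    simp

/-- A twisted derivation commutes with its twist as soon as it does so on the generators. -/
theorem IsPBW.comm_twistedDerivation (h : IsPBW Q y) {σ : B →ₐ[k] B} {δ : B →ₗ[k] B}
    (hδ : ∀ x x', δ (x * x') = δ x * x' + σ x * δ x') (hc : ∀ a, σ (δ (y a)) = δ (σ (y a)))
    (x : B) : σ (δ x) = δ (σ x) := by
  refine h.induction (p := fun x => σ (δ x) = δ (σ x)) ?_ ?_ ?_ ?_ x
  · have h1 : δ 1 = 0 := by simpa using hδ 1 1
    rw [h1, map_zero, map_one σ, h1]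
  · intro a x hx
    rw [hδ, map_mul, map_add, map_mul, map_mul, hδ, hc, hx]
  · intro x x' hx hx'
    rw [map_add, map_add, map_add, map_add, hx, hx']
  · intro r x hx
    rw [map_smul, map_smul, map_smul, map_smul, hx]

end

/-! ### Gelfand–Kirillov dimension -/

theorem tendsto_log_bound (N : ℕ) (C : ℝ) :
    Tendsto (fun n : ℕ => ((N * (C / Real.log n + 1) : ℝ) : EReal)) atTop (nhds (N : EReal)) := by
  have h1 : Tendsto (fun n : ℕ => C / Real.log n) atTop (nhds 0) :=
    tendsto_const_nhds.div_atTop (Real.tendsto_log_atTop.comp tendsto_natCast_atTop_atTop)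
  have h2 : Tendsto (fun n : ℕ => (N * (C / Real.log n + 1) : ℝ)) atTop (nhds (N : ℝ)) := by
    simpa using (h1.add_const 1).const_mul (N : ℝ)
  exact (continuous_coe_real_ereal.tendsto (N : ℝ)).comp h2

variable {k : Type v} [Field k] {N : ℕ} {A : Type u} [Ring A] [Algebra k A]
  {Q : Straightening k N} {y : Fin N → A}

theorem IsPBW.exists_le_pow (h : IsPBW Q y) {V : Submodule k A} (hV : V.FG) :
    ∃ m, V ≤ generatorSpan k y ^ m := by
  obtain ⟨s, rfl⟩ := hV
  have hx := (span_ordMonomial_eq_top_iff h.rel).1 h.span_eq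
  choose f hf using hx
  refine ⟨s.sup f, Submodule.span_le.2 fun x hxs => ?_⟩
  exact pow_mono_of_one_mem one_mem_generatorSpan (Finset.le_sup hxs) (hf x)

theorem generatorSpan_fg : (generatorSpan k y).FG :=
  Submodule.fg_span ((Set.finite_range y).insert 1)

/-- The upper bound `dim Vⁿ ≤ ((m + 1) n) ^ N` for a subspace `V` of the `m`-th power of the span of
the generators, in logarithmic form. -/
theorem IsPBW.log_finrank_le (h : IsPBW Q y) {V : Submodule k A} {m : ℕ}
    (hm : V ≤ generatorSpan k y ^ m) {n : ℕ} (hn : 2 ≤ n) :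
    Real.log (Module.finrank k (V ^ n : Submodule k A)) / Real.log n ≤
      N * (Real.log (m + 1) / Real.log n + 1) := by
  have hn0 : (0 : ℝ) < n := by
    have : 0 < n := by omega
    exact_mod_cast this
  have hlog : 0 < Real.log n := Real.log_pos (by exact_mod_cast (by omega : 1 < n))
  have hle : V ^ n ≤ generatorSpan k y ^ (m * n) := by
    rw [pow_mul]
    exact pow_le_pow_left' hm n
  have hfin : Module.Finite k (generatorSpan k y ^ (m * n) : Submodule k A) :=
    Module.Finite.iff_fg.2 (generatorSpan_fg.pow _)
  have h1 : Module.finrank k (V ^ n : Submodule k A) ≤ (m * n + 1) ^ N :=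
    (Submodule.finrank_mono hle).trans ((h.finrank_pow _).le.trans (card_degreeLE_le _ _))
  have h2 : Real.log (Module.finrank k (V ^ n : Submodule k A)) ≤
      N * (Real.log (m + 1) + Real.log n) := by
    rw [← Real.log_mul (by positivity) hn0.ne', ← Real.log_pow]
    rcases Nat.eq_zero_or_pos (Module.finrank k (V ^ n : Submodule k A)) with h0 | h0
    · rw [h0, Nat.cast_zero, Real.log_zero]
      refine Real.log_nonneg (one_le_pow₀ ?_)
      have : (1 : ℝ) ≤ n := by exact_mod_cast (by omega : 1 ≤ n)
      nlinarith [Nat.cast_nonneg (α := ℝ) m]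
    · refine Real.log_le_log (by exact_mod_cast h0) ?_
      calc (Module.finrank k (V ^ n : Submodule k A) : ℝ) ≤ ((m * n + 1) ^ N : ℕ) := by
            exact_mod_cast h1
        _ ≤ ((m + 1) * n) ^ N := by
            push_cast
            gcongr
            have : (1 : ℝ) ≤ n := by exact_mod_cast (by omega : 1 ≤ n)
            linarith
  calc _ ≤ N * (Real.log (m + 1) + Real.log n) / Real.log n := by gcongr
    _ = _ := by field_simp

/-- The lower bound `(n / N) ^ N` for the dimension of the `n`-th power of the span of the
generators, in logarithmic form. -/
theorem IsPBW.le_log_finrank (h : IsPBW Q y) (hN : 1 ≤ N) {n : ℕ} (hn : 2 ≤ n) :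
    N * (-Real.log N / Real.log n + 1) ≤
      Real.log (Module.finrank k (generatorSpan k y ^ n : Submodule k A)) / Real.log n := by
  have hn0 : (0 : ℝ) < n := by
    have : 0 < n := by omega
    exact_mod_cast this
  have hN0 : (0 : ℝ) < N := by exact_mod_cast hN
  have hlog : 0 < Real.log n := Real.log_pos (by exact_mod_cast (by omega : 1 < n))
  have h1 : ((n : ℝ) / N) ^ N ≤ Module.finrank k (generatorSpan k y ^ n : Submodule k A) := by
    rw [h.finrank_pow]
    calc ((n : ℝ) / N) ^ N ≤ ((n / N + 1 : ℕ) : ℝ) ^ N := by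
          gcongr
          rw [div_le_iff₀ hN0]
          have := (Nat.lt_mul_div_succ n hN).le
          calc (n : ℝ) ≤ ((N * (n / N + 1) : ℕ) : ℝ) := by exact_mod_cast this
            _ = _ := by push_cast; ring
      _ ≤ _ := by exact_mod_cast le_card_degreeLE N n
  have h2 : N * (Real.log n - Real.log N) ≤
      Real.log (Module.finrank k (generatorSpan k y ^ n : Submodule k A)) := by
    rw [← Real.log_div hn0.ne' hN0.ne', ← Real.log_pow]
    exact Real.log_le_log (by positivity) h1
  calc _ = N * (Real.log n - Real.log N) / Real.log n := by field_simp; ring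
    _ ≤ _ := by gcongr

/-- The Gelfand–Kirillov dimension of an algebra with a basis of ordered monomials is the number of
generators. -/
theorem IsPBW.gkDim_eq (h : IsPBW Q y) (hN : 1 ≤ N) : gkDim k A = (N : EReal) := by
  apply le_antisymm
  · refine iSup₂_le fun V hV => ?_
    obtain ⟨m, hm⟩ := h.exists_le_pow hV.1
    rw [← (tendsto_log_bound N (Real.log (m + 1))).limsup_eq]
    refine limsup_le_limsup ?_
    filter_upwards [eventually_ge_atTop 2] with n hn
    exact_mod_cast h.log_finrank_le hm hn
  · refine le_trans ?_ (le_iSup₂_of_le (generatorSpan k y)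
      ⟨generatorSpan_fg, one_mem_generatorSpan⟩ le_rfl)
    rw [← (tendsto_log_bound N (-Real.log N)).limsup_eq]
    refine limsup_le_limsup ?_
    filter_upwards [eventually_ge_atTop 2] with n hn
    exact_mod_cast h.le_log_finrank hN hn

theorem IsPBW.finiteType (h : IsPBW Q y) : Algebra.FiniteType k A := by
  classical
  refine ⟨⟨Finset.univ.image y, eq_top_iff.2 fun x _ => ?_⟩⟩
  have hy : ∀ a, y a ∈ Algebra.adjoin k ((Finset.univ.image y : Finset A) : Set A) := fun a =>
    Algebra.subset_adjoin (by simp)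
  exact h.induction (p := fun x => x ∈ Algebra.adjoin k ((Finset.univ.image y : Finset A) : Set A))
    (one_mem _) (fun a x hx => mul_mem (hy a) hx) (fun x x' hx hx' => add_mem hx hx')
    (fun r x hx => Subalgebra.smul_mem _ hx r) x

theorem IsPBW.nontrivial (h : IsPBW Q y) : Nontrivial A :=
  ⟨⟨ordMonomial y 0, 0, h.linInd.ne_zero 0⟩⟩

theorem IsPBW.differentiallySmooth (h : IsPBW Q y) (hN : 1 ≤ N)
    (hC : ∃ C : DifferentialCalculus k A, C.HasDimension N ∧ C.IsConnected ∧ C.IsIntegrable N) :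
    DifferentiallySmooth k A :=
  ⟨h.finiteType, N, h.gkDim_eq hN, hC⟩

/-! ### Kernels of linear maps in terms of the monomial basis -/

/-- The basis of ordered monomials. -/
def IsPBW.basis (h : IsPBW Q y) : Module.Basis (Fin N → ℕ) k A :=
  Module.Basis.mk h.linInd h.span_eq.ge

theorem IsPBW.basis_apply (h : IsPBW Q y) (e : Fin N → ℕ) : h.basis e = ordMonomial y e :=
  Module.Basis.mk_apply _ _ _

theorem IsPBW.repr_ordMonomial (h : IsPBW Q y) (e : Fin N → ℕ) :
    h.basis.repr (ordMonomial y e) = Finsupp.single e 1 := by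
  rw [← h.basis_apply, Module.Basis.repr_self]

theorem IsPBW.repr_ordMonomial_apply (h : IsPBW Q y) (e e' : Fin N → ℕ) :
    h.basis.repr (ordMonomial y e) e' = if e = e' then 1 else 0 := by
  rw [h.repr_ordMonomial, Finsupp.single_apply]

theorem IsPBW.exists_algebraMap (h : IsPBW Q y) {x : A}
    (hx : ∀ e, e ≠ 0 → h.basis.repr x e = 0) : ∃ r : k, x = algebraMap k A r := by
  refine ⟨h.basis.repr x 0, ?_⟩
  apply h.basis.repr.injective
  rw [Algebra.algebraMap_eq_smul_one, map_smul, ← ordMonomial_zero y, h.repr_ordMonomial]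
  ext e
  by_cases he : e = 0
  · subst he
    simp
  · simp [hx e he, Ne.symm he]

/-- A triangularity criterion: an element of the kernel of `T` has no coordinate in `s` if every
index `i ∈ s` has an index `j` which occurs in `T (b i)`, but in no other `T (b i')` with `i'` in
the support of the element and of degree at most that of `i` if `i' ∈ s`. -/
theorem Module.Basis.repr_eq_zero_of_triangular {ι M : Type*} [AddCommGroup M] [Module k M]
    (b : Module.Basis ι k M) (T : M →ₗ[k] M) {x : M} (hx : T x = 0) (s : Set ι) (deg : ι → ℕ)
    (H : ∀ i ∈ s, ∃ j, b.repr (T (b i)) j ≠ 0 ∧ ∀ i', i' ≠ i → b.repr x i' ≠ 0 →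
      (i' ∈ s → deg i' ≤ deg i) → b.repr (T (b i')) j = 0) {i : ι} (hi : i ∈ s) :
    b.repr x i = 0 := by
  classical
  by_contra hne
  have hS : ((b.repr x).support.filter (· ∈ s)).Nonempty :=
    ⟨i, by simp [hi, hne]⟩
  obtain ⟨m, hm, hmax⟩ := Finset.exists_max_image _ deg hS
  rw [Finset.mem_filter, Finsupp.mem_support_iff] at hm
  obtain ⟨j, hj, hj'⟩ := H m hm.2
  have hsum : b.repr (T x) j = ∑ i' ∈ (b.repr x).support, b.repr x i' * b.repr (T (b i')) j := by
    conv_lhs => rw [← b.linearCombination_repr x, Finsupp.linearCombination_apply, Finsupp.sum,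
      map_sum, map_sum, Finsupp.finsetSum_apply]
    simp
  rw [hx, map_zero, Finsupp.zero_apply, Finset.sum_eq_single m] at hsum
  · exact mul_ne_zero hm.1 hj hsum.symm
  · intro i' hi' hi'm
    rw [hj' i' hi'm (Finsupp.mem_support_iff.1 hi') fun his =>
      hmax i' (Finset.mem_filter.2 ⟨hi', his⟩), mul_zero]
  · intro h
    exact absurd (Finsupp.mem_support_iff.2 hm.1) h

/-- An element of the kernel of an operator which is diagonal in the basis has no coordinate at an
index with a nonzero eigenvalue. -/
theorem Module.Basis.repr_eq_zero_of_diagonal {ι M : Type*} [AddCommGroup M] [Module k M]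
    (b : Module.Basis ι k M) (T : M →ₗ[k] M) {x : M} (hx : T x = 0) (lam : ι → k)
    (hT : ∀ i, T (b i) = lam i • b i) {i : ι} (hi : lam i ≠ 0) : b.repr x i = 0 := by
  refine b.repr_eq_zero_of_triangular T hx {i | lam i ≠ 0} (fun _ => 0) ?_ hi
  intro i hi
  refine ⟨i, by simpa [hT] using hi, fun i' hne _ _ => ?_⟩
  simp [hT, hne]

theorem ordMonomial_smul (y : Fin N → A) (s : Fin N → k) (e : Fin N → ℕ) :
    ordMonomial (fun a => s a • y a) e = (∏ a, s a ^ e a) • ordMonomial y e := by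
  have : ∀ l : List (Fin N), (l.map fun a => (s a • y a) ^ e a).prod =
      (l.map fun a => s a ^ e a).prod • (l.map fun a => y a ^ e a).prod := by
    intro l
    induction l with
    | nil => simp
    | cons a l ih =>
      simp only [List.map_cons, List.prod_cons]
      rw [ih, smul_pow, smul_mul_smul_comm]
  rw [ordMonomial, this, List.map_reverse, List.prod_reverse, ← List.ofFn_eq_map, List.prod_ofFn]
  rfl

/-! ### Quantum affine spaces -/

namespace QuantumAffineSpace

variable {k : Type v} [Field k] {N : ℕ} {A : Type u} [Ring A] [Algebra k A]
  {c : Fin N → Fin N → k} {y : Fin N → A}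

/-- The relations `y_a y_b = c_{ab} y_b y_a` for `a < b`. -/
def straightening (c : Fin N → Fin N → k) : Straightening k N := ⟨c, 0, 0, 0⟩

theorem holds_iff : (straightening c).Holds y ↔ ∀ a b, a < b → y a * y b = c a b • (y b * y a) := by
  simp [Straightening.Holds, straightening]

/-- The coefficients in `y_a y_b = q_{ab} y_b y_a`, for all `a` and `b`. -/
def coeff (c : Fin N → Fin N → k) (a b : Fin N) : k :=
  if a < b then c a b else if b < a then (c b a)⁻¹ else 1

theorem coeff_ne_zero (hc : ∀ a b, a < b → c a b ≠ 0) (a b : Fin N) : coeff c a b ≠ 0 := by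
  unfold coeff
  split_ifs with h1 h2
  · exact hc _ _ h1
  · exact inv_ne_zero (hc _ _ h2)
  · exact one_ne_zero

theorem coeff_mul_coeff (hc : ∀ a b, a < b → c a b ≠ 0) (a b : Fin N) :
    coeff c a b * coeff c b a = 1 := by
  unfold coeff
  rcases lt_trichotomy a b with h | h | h
  · simp [h, h.not_gt, hc _ _ h]
  · simp [h]
  · simp [h, h.not_gt, hc _ _ h]

theorem mul_eq (h : IsPBW (straightening c) y) (hc : ∀ a b, a < b → c a b ≠ 0) (a b : Fin N) :
    y a * y b = coeff c a b • (y b * y a) := by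
  unfold coeff
  rcases lt_trichotomy a b with hab | hab | hab
  · simpa [hab] using holds_iff.1 h.rel a b hab
  · simp [hab]
  · have := holds_iff.1 h.rel b a hab
    rw [if_neg hab.not_gt, if_pos hab, this, smul_smul, inv_mul_cancel₀ (hc _ _ hab), one_smul]

/-- The action of the torus on a quantum affine space by rescaling the generators. -/
theorem exists_torus (h : IsPBW (straightening c) y) :
    ∃ τ : (Fin N → kˣ) →* (A →ₐ[k] A), ∀ s a, τ s (y a) = (s a : k) • y a := by
  have hex : ∀ s : Fin N → kˣ, ∃ φ : A →ₐ[k] A, ∀ a, φ (y a) = (s a : k) • y a := by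
    intro s
    refine h.exists_lift (y' := fun a => (s a : k) • y a) (holds_iff.2 fun a b hab => ?_)
    have := holds_iff.1 h.rel a b hab
    rw [smul_mul_smul_comm, smul_mul_smul_comm, this, smul_smul, smul_smul]
    congr 1
    ring
  choose φ hφ using hex
  refine ⟨⟨⟨φ, h.algHom_ext fun a => by simp [hφ]⟩, fun s t => h.algHom_ext fun a => ?_⟩, hφ⟩
  change φ (s * t) (y a) = φ s (φ t (y a))
  rw [hφ, hφ, map_smul, hφ, smul_smul, mul_comm]
  rfl

/-- The calculus of the partial derivatives `δᵢ` with `δᵢ yⱼ = 0` for `i ≠ j` and `δᵢ yᵢ = 1`, where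
`δᵢ` is twisted by the element of the torus that rescales `y_a` by `q_{ai}`. -/
theorem exists_calculus [CharZero k] (hN : 1 ≤ N) (h : IsPBW (straightening c) y)
    (hc : ∀ a b, a < b → c a b ≠ 0) :
    ∃ C : DifferentialCalculus k A, C.HasDimension N ∧ C.IsConnected ∧ C.IsIntegrable N := by
  have hA := h.nontrivial
  obtain ⟨τ, hτ⟩ := exists_torus h
  set q := coeff c with hq
  have hqq : ∀ a b, q a b * q b a = 1 := coeff_mul_coeff hc
  have hyy : ∀ a b, y a * y b = q a b • (y b * y a) := mul_eq h hc
  let γ : Fin N → Fin N → kˣ := fun i a => Units.mk0 (q a i) (coeff_ne_zero hc a i)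
  have hγ : ∀ i a, τ (γ i) (y a) = q a i • y a := fun i a => hτ _ a
  have hex : ∀ i, ∃ δ : A →ₗ[k] A, (∀ x x', δ (x * x') = δ x * x' + τ (γ i) x * δ x') ∧
      ∀ a, δ (y a) = if i = a then 1 else 0 := by
    intro i
    refine h.exists_twistedDerivation (τ (γ i)) _ fun a b hab => ?_
    have hcab : c a b = q a b := by simp [hq, coeff, hab]
    simp only [straightening, hcab, hγ, Pi.zero_apply, zero_smul, add_zero]
    by_cases ha : i = a
    · subst ha
      simp [hab.ne, smul_smul, hqq]
    · by_cases hb : i = b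
      · subst hb
        simp [ha]
      · simp [ha, hb]
  choose δ hδ hδy using hex
  have hδ1 : ∀ i, δ i 1 = 0 := fun i => by simpa using hδ i 1 1
  refine QuantumAffineModel.exists_calculus q τ γ δ hN hδ (fun i j _ => hqq i j) ?_ ?_ ?_ y hδy
  · intro i j hij x
    refine h.induction (p := fun x => τ (γ i) (δ j x) = q i j • δ j (τ (γ i) x)) ?_ ?_ ?_ ?_ x
    · rw [hδ1, map_zero, map_one (τ (γ i)), hδ1, smul_zero]
    · intro a x hx
      rw [hδ, map_mul, map_add, map_mul, map_mul, hδ, hx, hγ, hγ, hδy, map_smul, map_smul, map_smul,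
        hγ, hγ, hδy]
      by_cases ha : j = a
      · subst ha
        simp only [if_true, map_one, one_mul, smul_mul_assoc, mul_smul_comm]
        linear_combination (norm := module) -(hqq i j) • τ (γ i) x
      · simp only [if_neg ha, map_zero, zero_mul, smul_zero, smul_mul_assoc, mul_smul_comm]
        module
    · intro x x' hx hx'
      simp only [map_add, smul_add, hx, hx']
    · intro r x hx
      simp only [map_smul, hx, smul_comm r]
  · intro i j hij x
    refine h.induction (p := fun x => δ i (δ j x) = q i j • δ j (δ i x)) ?_ ?_ ?_ ?_ x
    · rw [hδ1, hδ1, map_zero, map_zero, smul_zero]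
    · intro a x hx
      rw [hδ, hδ, map_add, map_add, hδy, hδy, hγ, hγ, smul_mul_assoc, smul_mul_assoc, map_smul,
        map_smul, hδ i (y a), hδ j (y a), hδy, hδy, hγ, hγ, hx]
      by_cases ha : j = a
      · subst ha
        simp only [if_true, if_neg hij, one_mul, zero_mul, map_zero, smul_mul_assoc, mul_smul_comm]
        linear_combination (norm := module) -(hqq i j) • δ i x
      · by_cases hb : i = a
        · subst hb
          simp only [if_true, if_neg ha, one_mul, zero_mul, map_zero, smul_mul_assoc, mul_smul_comm]
          module
        · simp only [if_neg ha, if_neg hb, zero_mul, map_zero, smul_mul_assoc, mul_smul_comm]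
          module
    · intro x x' hx hx'
      simp only [map_add, smul_add, hx, hx']
    · intro r x hx
      simp only [map_smul, hx, smul_comm r]
  · -- the operators `y_i δ_i` are derivations, diagonal in the basis of ordered monomials
    intro x hx
    refine h.exists_algebraMap fun e he => ?_
    obtain ⟨i, hi⟩ : ∃ i, e i ≠ 0 := by
      by_contra hcon
      exact he (funext fun i => by_contra fun hi => hcon ⟨i, hi⟩)
    refine h.basis.repr_eq_zero_of_diagonal (LinearMap.mulLeft k (y i) ∘ₗ δ i) (x := x)
      (by simp [hx i]) (fun e => (e i : k)) (fun e => ?_) (Nat.cast_ne_zero.2 hi)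
    rw [h.basis_apply]
    refine ordMonomial_induction_exponent y (p := fun e x =>
      (LinearMap.mulLeft k (y i) ∘ₗ δ i) x = (e i : k) • x) (by simp [hδ1]) ?_ e
    intro a e x hx
    simp only [LinearMap.comp_apply, LinearMap.mulLeft_apply] at hx ⊢
    rw [hδ, hδy, hγ, mul_add, ← mul_assoc, ← mul_assoc, mul_smul_comm, ← hyy, mul_assoc, mul_assoc,
      hx]
    by_cases ha : i = a
    · subst ha
      simp [add_smul, add_comm]
    · simp [ha]

end QuantumAffineSpace

/-! ### Algebras of nilpotent type -/

namespace NilpotentType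

variable {k : Type v} [Field k] {n : ℕ} {A : Type u} [Ring A] [Algebra k A]
  {c : Fin (n + 1) → k} {y : Fin (n + 1) → A}

/-- The relations `(c_a - c_b) y_a y_b = y_a - y_b` for `a < b`. -/
def straightening (c : Fin (n + 1) → k) : Straightening k (n + 1) :=
  ⟨0, fun a b => (c a - c b)⁻¹, fun a b => -(c a - c b)⁻¹, 0⟩

theorem holds_iff : (straightening c).Holds y ↔
    ∀ a b, a < b → y a * y b = (c a - c b)⁻¹ • (y a - y b) := by
  simp [Straightening.Holds, straightening, sub_eq_add_neg]

variable (c y) in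
/-- The contribution of one factor `y_a` to the derivative of an ordered monomial, for the
derivation with `y_a ↦ (1 + c_a y_a) ^ 2`.  The last exponent is truncated, but only terms with
`e a ≠ 0` contribute. -/
def derivTerm (e : Fin (n + 1) → ℕ) (a : Fin (n + 1)) : A :=
  (c a * c a) • ordMonomial y (e + Pi.single a 1) + (2 * c a) • ordMonomial y e +
    ordMonomial y (e - Pi.single a 1)

/-- In the derivative of an ordered monomial every factor `y_a` is replaced by its derivative
`(1 + c_a y_a) ^ 2`, which commutes with `y_a`, so that no straightening is needed. -/
theorem deriv_ordMonomial {δ : A →ₗ[k] A} (hδ : ∀ x x', δ (x * x') = δ x * x' + x * δ x')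
    (hy : ∀ a, δ (y a) = (c a * c a) • (y a * y a) + (2 * c a) • y a + 1) (e : Fin (n + 1) → ℕ) :
    δ (ordMonomial y e) = ∑ a, (e a : k) • derivTerm c y e a := by
  induction hd : ∑ a, e a generalizing e with
  | zero =>
    have he : e = 0 := by
      funext i
      exact Finset.sum_eq_zero_iff.1 hd i (Finset.mem_univ i)
    have h1 : δ 1 = 0 := by simpa using hδ 1 1
    subst he
    simp [h1]
  | succ d ih =>
    have he : e ≠ 0 := by
      rintro rfl
      simp at hd
    obtain ⟨m, e, rfl, hm⟩ := exists_max_exponent he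
    rw [sum_add_single] at hd
    have hmul : ∀ e', (∀ a, m < a → e' a = 0) →
        y m * ordMonomial y e' = ordMonomial y (e' + Pi.single m 1) :=
      fun e' => mul_ordMonomial y e' m
    have hterm : ∀ a, (e a : k) • (y m * derivTerm c y e a) =
        (e a : k) • derivTerm c y (e + Pi.single m 1) a := by
      intro a
      by_cases ha : e a = 0
      · simp [ha]
      · have ham : a ≤ m := not_lt.1 fun h => ha (hm a h)
        congr 1
        rw [derivTerm, derivTerm, mul_add, mul_add, mul_smul_comm, mul_smul_comm, hmul e hm, hmul,
          hmul, add_right_comm e]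
        · congr 2
          funext i
          by_cases hi : i = a
          · subst hi
            simp
            omega
          · simp [Pi.single_eq_of_ne hi]
        · intro i hi
          simp [hm i hi]
        · intro i hi
          simp [hm i hi, Pi.single_eq_of_ne (lt_of_le_of_lt ham hi).ne']
    have hlast : δ (y m) * ordMonomial y e = derivTerm c y (e + Pi.single m 1) m := by
      rw [hy, derivTerm, add_mul, add_mul, smul_mul_assoc, smul_mul_assoc, mul_assoc, hmul e hm,
        hmul, one_mul, add_tsub_cancel_right]
      intro i hi
      simp [hm i hi, Pi.single_eq_of_ne hi.ne']
    rw [← hmul e hm, hδ, ih e (by omega), hlast, Finset.mul_sum]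
    simp only [mul_smul_comm, hterm, Pi.add_apply, Nat.cast_add, add_smul, Finset.sum_add_distrib]
    rw [add_comm]
    congr 1
    rw [Finset.sum_eq_single m]
    · simp
    · intro a _ ha
      simp [Pi.single_eq_of_ne ha]
    · simp

theorem repr_deriv (h : IsPBW (straightening c) y) {δ : A →ₗ[k] A}
    (hδ : ∀ x x', δ (x * x') = δ x * x' + x * δ x')
    (hy : ∀ a, δ (y a) = (c a * c a) • (y a * y a) + (2 * c a) • y a + 1)
    (e j : Fin (n + 1) → ℕ) : h.basis.repr (δ (h.basis e)) j = ∑ a, (e a : k) *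
      (c a * c a * (if e + Pi.single a 1 = j then 1 else 0) +
        2 * c a * (if e = j then 1 else 0) + if e - Pi.single a 1 = j then 1 else 0) := by
  rw [h.basis_apply, deriv_ordMonomial hδ hy, map_sum, Finsupp.finsetSum_apply]
  refine Finset.sum_congr rfl fun a _ => ?_
  simp only [derivTerm, map_smul, map_add, Finsupp.smul_apply, Finsupp.add_apply,
    h.repr_ordMonomial_apply, smul_eq_mul]

/-- The kernel of the derivation consists of the scalars: if `c_b ≠ 0`, a monomial containing `y_b`
is detected by the monomial with the exponent of `y_b` raised by one, and on the powers of the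
remaining generator `y_0` the derivation is `d / dy_0`. -/
theorem scalar_of_deriv_eq_zero [CharZero k] (h : IsPBW (straightening c) y)
    (hc : Function.Injective c) (hc0 : c 0 = 0)
    {δ : A →ₗ[k] A} (hδ : ∀ x x', δ (x * x') = δ x * x' + x * δ x')
    (hy : ∀ a, δ (y a) = (c a * c a) • (y a * y a) + (2 * c a) • y a + 1)
    {x : A} (hx : δ x = 0) : ∃ r : k, x = algebraMap k A r := by
  have hrepr := repr_deriv h hδ hy
  -- a generator other than `y 0` does not occur: the leading term raises its exponent
  have hb : ∀ b : Fin (n + 1), b ≠ 0 → ∀ e, e b ≠ 0 → h.basis.repr x e = 0 := by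
    intro b hb e he
    have hcb : c b ≠ 0 := fun h0 => hb (hc (h0.trans hc0.symm))
    refine h.basis.repr_eq_zero_of_triangular δ hx {e | e b ≠ 0} (fun e => e b)
      (fun e he => ⟨e + Pi.single b 1, ?_, fun e' hne _ hle => ?_⟩) he
    · rw [hrepr, Finset.sum_eq_single b]
      · have h1 : e ≠ e + Pi.single b 1 := fun h' => by simpa using congrFun h' b
        have h2 : e - Pi.single b 1 ≠ e + Pi.single b 1 := fun h' => by
          have := congrFun h' b
          simp at this
        rw [if_pos rfl, if_neg h1, if_neg h2]
        simp only [mul_one, mul_zero, add_zero]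
        exact mul_ne_zero (Nat.cast_ne_zero.2 he) (mul_ne_zero hcb hcb)
      · intro a _ hab
        have h0 : e + Pi.single a 1 ≠ e + Pi.single b 1 := fun h' => by
          have := congrFun h' b
          simp [Pi.single_eq_of_ne hab.symm] at this
        have h1 : e ≠ e + Pi.single b 1 := fun h' => by simpa using congrFun h' b
        have h2 : e - Pi.single a 1 ≠ e + Pi.single b 1 := fun h' => by
          have := congrFun h' b
          simp [Pi.single_eq_of_ne hab.symm] at this
        rw [if_neg h0, if_neg h1, if_neg h2]
        simp
      · simp
    · have hle' : e' b ≤ e b := by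
        by_cases h0 : e' b = 0
        · omega
        · exact hle h0
      rw [hrepr]
      refine Finset.sum_eq_zero fun a _ => ?_
      have h0 : e' + Pi.single a 1 ≠ e + Pi.single b 1 := fun h' => by
        by_cases hab : a = b
        · subst hab
          exact hne (add_right_cancel h')
        · have := congrFun h' b
          simp [Pi.single_eq_of_ne (Ne.symm hab)] at this
          omega
      have h1 : e' ≠ e + Pi.single b 1 := fun h' => by
        have := congrFun h' b
        simp at this
        omega
      have h2 : e' - Pi.single a 1 ≠ e + Pi.single b 1 := fun h' => by
        have := congrFun h' b
        simp at this
        omega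
      rw [if_neg h0, if_neg h1, if_neg h2]
      simp
  -- only powers of `y 0` remain
  refine h.exists_algebraMap fun e he => ?_
  by_cases hrest : ∃ b, b ≠ 0 ∧ e b ≠ 0
  · obtain ⟨b, hb0, heb⟩ := hrest
    exact hb b hb0 e heb
  have hvan : ∀ b, b ≠ 0 → e b = 0 := fun b hb0 => by_contra fun heb => hrest ⟨b, hb0, heb⟩
  refine h.basis.repr_eq_zero_of_triangular δ hx {e | e ≠ 0 ∧ ∀ b, b ≠ 0 → e b = 0} (fun _ => 0)
    (fun e he => ⟨e - Pi.single 0 1, ?_, fun e' hne hsupp _ => ?_⟩) ⟨he, hvan⟩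
  · have he0 : e 0 ≠ 0 := fun h0 => he.1 (funext fun b => by
      by_cases hb0 : b = 0
      · rw [hb0, h0]
        rfl
      · exact he.2 b hb0)
    rw [hrepr, Finset.sum_eq_single 0]
    · simpa [hc0] using he0
    · intro a _ ha
      simp [he.2 a ha]
    · simp
  · have hvan' : ∀ b, b ≠ 0 → e' b = 0 := fun b hb0 =>
      by_contra fun heb => hsupp (hb b hb0 e' heb)
    rw [hrepr, Finset.sum_eq_single 0]
    · by_cases h0 : e' 0 = 0
      · simp [h0]
      · have h1 : e' - Pi.single 0 1 ≠ e - Pi.single 0 1 := fun h' => by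
          have h2 := congrFun h' 0
          simp only [Pi.sub_apply, Pi.single_eq_same] at h2
          refine hne (funext fun b => ?_)
          by_cases hb0 : b = 0
          · subst hb0
            have h3 : e 0 ≠ 0 := fun h0 => he.1 (funext fun b => by
              by_cases hb0 : b = 0
              · rw [hb0, h0]
                rfl
              · exact he.2 b hb0)
            omega
          · rw [hvan' b hb0, he.2 b hb0]
        simp [hc0, h1]
    · intro a _ ha
      simp [hvan' a ha]
    · simp

/-- The calculus of jets of the derivation with `y_a ↦ (1 + c_a y_a) ^ 2`, for which `y_0 ↦ 1`. -/
theorem exists_calculus [CharZero k] (hc : Function.Injective c) (hc0 : c 0 = 0)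
    (h : IsPBW (straightening c) y) :
    ∃ C : DifferentialCalculus k A, C.HasDimension (n + 1) ∧ C.IsConnected ∧
      C.IsIntegrable (n + 1) := by
  have hA := h.nontrivial
  obtain ⟨δ, hδ, hy⟩ := h.exists_twistedDerivation (AlgHom.id k A)
    (fun a => (c a * c a) • (y a * y a) + (2 * c a) • y a + 1) (by
      intro a b hab
      have hg : c a - c b ≠ 0 := sub_ne_zero.2 fun h' => hab.ne (hc h')
      have h1 := holds_iff.1 h.rel a b hab
      have h2 : y a * (y a * y b) = (c a - c b)⁻¹ • (y a * y a - y a * y b) := by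
        rw [h1, mul_smul_comm, mul_sub, h1]
      have h3 : y a * y b * y b = (c a - c b)⁻¹ • (y a * y b - y b * y b) := by
        rw [h1, smul_mul_assoc, sub_mul, h1]
      simp only [straightening, AlgHom.id_apply, Pi.zero_apply, zero_smul, zero_add]
      simp only [add_mul, mul_add, smul_mul_assoc, mul_smul_comm, mul_assoc, one_mul, mul_one] at *
      rw [h2, h3, h1]
      match_scalars <;> field_simp <;> ring)
  simp only [AlgHom.id_apply] at hδ
  refine JetModel.exists_calculus (n + 1) (by omega) AlgEquiv.refl δ hδ (fun x => rfl)
    (fun a ha => scalar_of_deriv_eq_zero h hc hc0 hδ hy ha) (y 0) ?_ rfl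
  rw [hy, hc0]
  simp

end NilpotentType

/-! ### Algebras of Ore type -/

namespace OreType

open Polynomial

variable {n : ℕ} {A : Type u} [Ring A] [Algebra ℂ A] {p : Fin n → ℝ} {w : Fin n → ℂ}
  {q : Fin n → Fin n → ℂ} {y : Fin (n + 1) → A}

/-- The relations `y_0 z_k = z_k (p_k y_0 - w_k)` and `z_k z_l = q_{kl} z_l z_k` for `k < l`, where
`z_k = y_{k+1}`.  The `q_{kl}` may vanish. -/
def straightening (p : Fin n → ℝ) (w : Fin n → ℂ) (q : Fin n → Fin n → ℂ) :
    Straightening ℂ (n + 1) where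
  swap := Fin.cons (Fin.cons 0 fun l => (p l : ℂ)) fun k => Fin.cons 0 (q k)
  left := 0
  right := Fin.cons (Fin.cons 0 fun l => -w l) fun _ => 0
  const := 0

theorem holds_iff : (straightening p w q).Holds y ↔
    (∀ k : Fin n, y 0 * y k.succ = (p k : ℂ) • (y k.succ * y 0) - w k • y k.succ) ∧
    ∀ k l : Fin n, k < l → y k.succ * y l.succ = q k l • (y l.succ * y k.succ) := by
  simp [Straightening.Holds, straightening, Fin.forall_fin_succ, sub_eq_add_neg]

/-- To check a property of the pairs `a < b` it suffices to treat `(y_0, z_k)` and `(z_k, z_l)`. -/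
theorem forall_compat {P : Fin (n + 1) → Fin (n + 1) → Prop} (h0 : ∀ k : Fin n, P 0 k.succ)
    (h1 : ∀ k l : Fin n, k < l → P k.succ l.succ) (a b : Fin (n + 1)) (hab : a < b) : P a b := by
  induction b using Fin.cases with
  | zero => exact absurd hab (Fin.not_lt_zero a)
  | succ b =>
    induction a using Fin.cases with
    | zero => exact h0 b
    | succ a => exact h1 a b (Fin.succ_lt_succ_iff.1 hab)

theorem exists_automorphism (h : IsPBW (straightening p w q) y) (hp : ∀ k, p k ≠ 0) :
    ∃ σ : A ≃ₐ[ℂ] A, σ (y 0) = y 0 ∧ ∀ k : Fin n, σ (y k.succ) = (p k : ℂ)⁻¹ • y k.succ := by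
  have hrel := holds_iff.1 h.rel
  have hs : ∀ s : Fin (n + 1) → ℂ, s 0 = 1 →
      (straightening p w q).Holds fun a => s a • y a := by
    intro s hs0
    refine holds_iff.2 ⟨fun k => ?_, fun k l hkl => ?_⟩
    · rw [hs0, one_smul, mul_smul_comm, hrel.1, smul_mul_assoc]
      module
    · rw [smul_mul_smul_comm, smul_mul_smul_comm, hrel.2 k l hkl]
      module
  obtain ⟨σ, hσ⟩ := h.exists_scaling (s := Fin.cons 1 fun k => (p k : ℂ)⁻¹)
    (Fin.cases (by simp) fun k => by simpa using hp k) (hs _ rfl) (hs _ (by simp))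
  exact ⟨σ, by simpa using hσ 0, fun k => by simpa using hσ k.succ⟩

/-- The twisted derivation with `y_0 ↦ 1` and `z_k ↦ p_k z_k y_0 ^ m`, where `m` is `0` or `1`. -/
theorem exists_derivation (h : IsPBW (straightening p w q) y) {σ : A ≃ₐ[ℂ] A} {m : ℕ}
    (hp : ∀ k, p k ≠ 0) (hσ0 : σ (y 0) = y 0)
    (hσ : ∀ k : Fin n, σ (y k.succ) = (p k : ℂ)⁻¹ • y k.succ)
    (hm : m = 0 ∨ m = 1 ∧ ∀ k l, w k = w l) (hpq : ∀ k l, k < l → q k l ≠ 0 → p k = p l) :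
    ∃ δ : A →ₗ[ℂ] A, (∀ x x', δ (x * x') = δ x * x' + σ x * δ x') ∧ δ (y 0) = 1 ∧
      ∀ k : Fin n, δ (y k.succ) = (p k : ℂ) • (y k.succ * y 0 ^ m) := by
  have hrel := holds_iff.1 h.rel
  refine Exists.imp (fun δ hδ => ⟨hδ.1, by simpa using hδ.2 0,
    fun k => by simpa using hδ.2 k.succ⟩) (h.exists_twistedDerivation (σ : A →ₐ[ℂ] A)
    (Fin.cons 1 fun k => (p k : ℂ) • (y k.succ * y 0 ^ m)) (forall_compat (fun k => ?_)
      fun k l hkl => ?_))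
  · have hpk : (p k : ℂ) ≠ 0 := by exact_mod_cast hp k
    simp only [straightening, AlgEquiv.coe_toAlgHom, hσ0, hσ, Fin.cons_zero, Fin.cons_succ,
      Pi.zero_apply, zero_smul, add_zero, one_mul, mul_one, mul_smul_comm,
      smul_mul_assoc]
    rw [← mul_assoc, hrel.1, sub_mul, smul_mul_assoc, smul_mul_assoc, mul_assoc, mul_assoc,
      ← pow_succ, ← pow_succ']
    match_scalars <;> field_simp
  · have hpk : (p k : ℂ) ≠ 0 := by exact_mod_cast hp k
    have hpl : (p l : ℂ) ≠ 0 := by exact_mod_cast hp l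
    simp only [straightening, AlgEquiv.coe_toAlgHom, hσ, Fin.cons_succ, Pi.zero_apply, zero_smul,
      add_zero, mul_smul_comm, smul_mul_assoc]
    have h1 := hrel.2 k l hkl
    by_cases hq : q k l = 0
    · rw [hq, zero_smul] at h1 ⊢
      rcases hm with rfl | ⟨rfl, -⟩
      · simp [h1]
      · simp only [pow_one, mul_assoc, hrel.1, mul_sub, mul_smul_comm]
        simp only [← mul_assoc, h1]
        simp
    · have hpp := hpq k l hkl hq
      rcases hm with rfl | ⟨rfl, hw⟩
      · simp only [pow_zero, mul_one, h1, hpp]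
        module
      · simp only [pow_one, mul_assoc, hrel.1, mul_sub, mul_smul_comm]
        simp only [← mul_assoc, h1, hpp, hw k l, smul_mul_assoc]
        module

/-- The coordinates of `z ^ t f(y_0)` in the basis of the ordered monomials `z ^ t y_0 ^ s`. -/
theorem repr_mul_aeval (h : IsPBW (straightening p w q) y) (t : Fin n → ℕ) (f : ℂ[X])
    (e : Fin (n + 1) → ℕ) :
    h.basis.repr (ordMonomial (fun k => y k.succ) t * aeval (y 0) f) e =
      if (fun k => e k.succ) = t then f.coeff (e 0) else 0 := by
  induction f using Polynomial.induction_on' with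
  | add f g hf hg =>
    rw [map_add, mul_add, map_add, Finsupp.add_apply, hf, hg, coeff_add]
    split_ifs <;> simp
  | monomial r a =>
    have h1 : ordMonomial (fun k : Fin n => y k.succ) t * y 0 ^ r =
        ordMonomial y (Fin.cons r t) := by
      simp [ordMonomial_eq_mul_zero y]
    rw [aeval_monomial, ← Algebra.smul_def, mul_smul_comm, h1, map_smul, Finsupp.smul_apply,
      h.repr_ordMonomial_apply, coeff_monomial]
    have h2 : (Fin.cons r t : Fin (n + 1) → ℕ) = e ↔ r = e 0 ∧ (fun k => e k.succ) = t := by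
      constructor
      · rintro rfl
        exact ⟨rfl, rfl⟩
      · rintro ⟨rfl, rfl⟩
        exact Fin.cons_self_tail e
    simp only [h2, smul_eq_mul]
    by_cases h3 : r = e 0 <;> by_cases h4 : (fun k => e k.succ) = t <;> simp [h3, h4]

/-- The derivative of an ordered monomial `x` in the `z_k` is `x H(y_0)`, where the coefficient of
`H` in degree `m` does not vanish unless `x = 1`.  It is a positive multiple `P r` of the eigenvalue
`P`, as multiplication by `z_k` replaces `r` by `1 + p_k⁻² r`; this uses that the `p_k` are real. -/
theorem deriv_ordMonomial (h : IsPBW (straightening p w q) y) {σ : A ≃ₐ[ℂ] A} {δ : A →ₗ[ℂ] A}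
    {m : ℕ} (hp : ∀ k, p k ≠ 0) (hσ : ∀ k : Fin n, σ (y k.succ) = (p k : ℂ)⁻¹ • y k.succ)
    (hm : m = 0 ∧ (∀ k, p k = 1) ∨ m = 1)
    (hδ : ∀ x x', δ (x * x') = δ x * x' + σ x * δ x')
    (hδy : ∀ k : Fin n, δ (y k.succ) = (p k : ℂ) • (y k.succ * y 0 ^ m)) (t : Fin n → ℕ) :
    ∃ (P r : ℝ) (H : ℂ[X]), P ≠ 0 ∧ (∑ k, t k ≠ 0 → 0 < r) ∧
      σ (ordMonomial (fun k => y k.succ) t) = (P : ℂ)⁻¹ • ordMonomial (fun k => y k.succ) t ∧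
      δ (ordMonomial (fun k => y k.succ) t) =
        ordMonomial (fun k => y k.succ) t * aeval (y 0) H ∧
      H.natDegree ≤ m ∧ H.coeff m = ((P * r : ℝ) : ℂ) := by
  have hrel := holds_iff.1 h.rel
  -- induction over the degree `d` of the monomial also needs its commutation rule with `y 0`
  let S : ℕ → A → Prop := fun d x => ∃ (P r : ℝ) (v : ℂ) (H : ℂ[X]), P ≠ 0 ∧ 0 ≤ r ∧
    (d ≠ 0 → 0 < r) ∧ (m = 0 → P = 1) ∧ (σ x = (P : ℂ)⁻¹ • x) ∧ (δ x = x * aeval (y 0) H ∧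
      H.natDegree ≤ m ∧ H.coeff m = ((P * r : ℝ) : ℂ)) ∧ y 0 * x = (P : ℂ) • (x * y 0) - v • x
  suffices hS : S (∑ k, t k) (ordMonomial (fun k : Fin n => y k.succ) t) by
    obtain ⟨P, r, v, H, h1, -, h2, -, h3, h4, -⟩ := hS
    exact ⟨P, r, H, h1, h2, h3, h4⟩
  refine ordMonomial_induction _ (p := S) ?_ ?_ t
  · have hδ1 : δ 1 = 0 := by simpa using hδ 1 1
    exact ⟨1, 0, 0, 0, by simp [hδ1]⟩
  · rintro k d x ⟨P, r, v, H, hP, hr, -, hmP, hσx, ⟨hδx, hdeg, hcoeff⟩, hyx⟩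
    have hpk : (p k : ℂ) ≠ 0 := by exact_mod_cast hp k
    have hr' : 0 < 1 + (p k)⁻¹ ^ 2 * r := by positivity
    refine ⟨p k * P, 1 + (p k)⁻¹ ^ 2 * r, p k * v + w k,
      C (p k : ℂ) * (C (P : ℂ) * X - C v) ^ m + C (p k : ℂ)⁻¹ * H, mul_ne_zero (hp k) hP,
      hr'.le, fun _ => hr', ?_, ?_, ⟨?_, ?_, ?_⟩, ?_⟩
    · intro hm0
      rcases hm with ⟨-, hp1⟩ | hm1
      · rw [hp1, hmP hm0, one_mul]
      · omega
    · rw [map_mul, hσ, hσx, smul_mul_smul_comm]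
      push_cast
      rw [mul_inv]
    · have hpow : y 0 ^ m * x = x * aeval (y 0) ((C (P : ℂ) * X - C v) ^ m) := by
        rcases hm with ⟨rfl, -⟩ | rfl
        · simp
        · rw [pow_one, pow_one, hyx]
          simp only [map_sub, map_mul, aeval_C, aeval_X, Algebra.algebraMap_eq_smul_one, mul_sub,
            smul_mul_assoc, one_mul, mul_smul_comm, mul_one]
      rw [hδ, hδy, hσ, hδx, smul_mul_assoc, mul_assoc, hpow]
      simp only [map_add, map_mul, aeval_C, Algebra.algebraMap_eq_smul_one, mul_add,
        smul_mul_assoc, one_mul, mul_smul_comm, mul_assoc]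
    · refine (natDegree_add_le _ _).trans (max_le ?_ ((natDegree_C_mul_le _ _).trans hdeg))
      refine (natDegree_C_mul_le _ _).trans
        ((natDegree_pow_le_of_le (m := 1) m ?_).trans (by rw [mul_one]))
      exact (natDegree_sub_le _ _).trans (max_le ((natDegree_C_mul_le _ _).trans natDegree_X_le)
        (by simp))
    · have hlead : ((C (P : ℂ) * X - C v) ^ m).coeff m = (P : ℂ) := by
        rcases hm with ⟨rfl, -⟩ | rfl
        · simp [hmP rfl]
        · simp
      rw [coeff_add, coeff_C_mul, coeff_C_mul, hlead, hcoeff]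
      push_cast
      field_simp
    · rw [← mul_assoc, hrel.1, sub_mul, smul_mul_assoc, smul_mul_assoc, mul_assoc, hyx]
      simp only [mul_sub, mul_smul_comm, mul_assoc]
      push_cast
      module

/-- The calculus of jets of the twisted derivation with `y_0 ↦ 1` and `z_k ↦ p_k z_k y_0 ^ m`.  The
exponent `m = 0` requires all `p_k = 1`, while `m = 1` requires that all `w_k` agree. -/
theorem exists_calculus (h : IsPBW (straightening p w q) y) (hp : ∀ k, p k ≠ 0)
    (hpq : ∀ k l, k < l → q k l ≠ 0 → p k = p l)
    (hcase : (∀ k, p k = 1) ∨ ∀ k l, w k = w l) :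
    ∃ C : DifferentialCalculus ℂ A, C.HasDimension (n + 1) ∧ C.IsConnected ∧
      C.IsIntegrable (n + 1) := by
  have hA := h.nontrivial
  obtain ⟨m, hm, hm'⟩ : ∃ m : ℕ, (m = 0 ∧ (∀ k, p k = 1) ∨ m = 1) ∧
      (m = 0 ∨ m = 1 ∧ ∀ k l, w k = w l) := by
    rcases hcase with hc | hc
    · exact ⟨0, Or.inl ⟨rfl, hc⟩, Or.inl rfl⟩
    · exact ⟨1, Or.inr rfl, Or.inr ⟨rfl, hc⟩⟩
  obtain ⟨σ, hσ0, hσ⟩ := exists_automorphism h hp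
  obtain ⟨δ, hδ, hδ0, hδy⟩ := exists_derivation h hp hσ0 hσ hm' hpq
  choose P r H hP hr hσt hδt hdeg hcoeff using deriv_ordMonomial h hp hσ hm hδ hδy
  have hδ1 : δ 1 = 0 := by simpa using hδ 1 1
  have hδpow : ∀ s : ℕ, δ (y 0 ^ s) = aeval (y 0) (C (s : ℂ) * X ^ (s - 1)) := by
    intro s
    induction s with
    | zero => simp [hδ1]
    | succ s ih =>
      rw [pow_succ', hδ, hδ0, hσ0, ih]
      rcases Nat.eq_zero_or_pos s with rfl | hs
      · simp
      · obtain ⟨s, rfl⟩ := Nat.exists_eq_add_of_le' hs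
        simp only [map_mul, aeval_C, map_pow, aeval_X, Nat.add_sub_cancel, one_mul,
          Algebra.algebraMap_eq_smul_one, smul_mul_assoc, mul_smul_comm]
        rw [← pow_succ']
        push_cast
        module
  have hmono : ∀ e : Fin (n + 1) → ℕ, δ (h.basis e) =
      ordMonomial (fun k => y k.succ) (fun k => e k.succ) * aeval (y 0)
        (H (fun k => e k.succ) * X ^ e 0 +
          C ((P (fun k => e k.succ) : ℂ)⁻¹ * e 0) * X ^ (e 0 - 1)) := by
    intro e
    rw [h.basis_apply, ordMonomial_eq_mul_zero, hδ, hδt, hσt, hδpow]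
    simp only [map_add, map_mul, mul_add, aeval_C, Algebra.algebraMap_eq_smul_one, mul_assoc,
      map_pow, aeval_X, smul_mul_assoc, mul_smul_comm, one_mul, smul_smul]
  have hrepr : ∀ e j : Fin (n + 1) → ℕ, h.basis.repr (δ (h.basis e)) j =
      if (fun k : Fin n => j k.succ) = (fun k => e k.succ) then
        (H (fun k => e k.succ) * X ^ e 0 +
          C ((P (fun k => e k.succ) : ℂ)⁻¹ * e 0) * X ^ (e 0 - 1)).coeff (j 0) else 0 := by
    intro e j
    rw [hmono, repr_mul_aeval]
  have hH0 : H 0 = 0 := by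
    ext i
    have h1 := repr_mul_aeval h 0 (H 0) (Fin.cons i 0)
    rw [← hδt, ordMonomial_zero, hδ1, map_zero, Finsupp.zero_apply, if_pos (by rfl)] at h1
    exact h1.symm
  refine JetModel.exists_calculus (n + 1) (by omega) σ δ hδ
    (h.comm_twistedDerivation (σ := (σ : A →ₐ[ℂ] A)) hδ ?_)
    (fun a ha => h.exists_algebraMap fun e he => ?_) (y 0) hδ0 hσ0
  · refine Fin.cases ?_ fun k => ?_
    · simp [hδ0, hσ0]
    · change σ (δ _) = δ (σ _)
      rw [hδy, hσ, map_smul, map_smul, map_mul, map_pow, hσ, hσ0, hδy, smul_mul_assoc]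
      module
  refine h.basis.repr_eq_zero_of_triangular δ ha {e | e ≠ 0} (fun e => e 0)
    (fun e he => ?_) he
  by_cases ht : (fun k => e k.succ) = (0 : Fin n → ℕ)
  · -- a power of `y 0`
    have he0 : e 0 ≠ 0 := fun h0 => he (funext (Fin.cases h0 fun k => congrFun ht k))
    refine ⟨Fin.cons (e 0 - 1) 0, ?_, fun e' hne _ _ => ?_⟩
    · rw [hrepr, ht, if_pos (show (fun k : Fin n =>
        (Fin.cons (e 0 - 1) 0 : Fin (n + 1) → ℕ) k.succ) = 0 from rfl), hH0]
      rw [zero_mul, zero_add, Fin.cons_zero, coeff_C_mul, coeff_X_pow, if_pos rfl, mul_one]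
      exact mul_ne_zero (inv_ne_zero (by exact_mod_cast hP 0)) (Nat.cast_ne_zero.2 he0)
    · rw [hrepr]
      split_ifs with hte
      · have hte0 : (fun k => e' k.succ) = (0 : Fin n → ℕ) := hte.symm
        have hne0 : e' 0 ≠ e 0 := fun h0 => hne (funext (Fin.cases h0 fun k =>
          (congrFun hte0 k).trans (congrFun ht k).symm))
        rw [hte0, hH0]
        by_cases h0 : e' 0 = 0
        · simp [h0]
        · rw [zero_mul, zero_add, coeff_C_mul, coeff_X_pow, Fin.cons_zero, if_neg (by omega),
            mul_zero]
      · rfl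
  · -- a monomial `z ^ t * y 0 ^ s` with `t ≠ 0`: the leading term is `z ^ t * y 0 ^ (s + m)`
    have htsum : ∑ k, e (Fin.succ k) ≠ 0 := fun h0 => ht (funext fun k =>
      Finset.sum_eq_zero_iff.1 h0 k (Finset.mem_univ k))
    have hdeg' : ∀ (t : Fin n → ℕ) (s i : ℕ), s < i → (H t * X ^ s).coeff (i + m) = 0 := by
      intro t s i hsi
      refine coeff_eq_zero_of_natDegree_lt (lt_of_le_of_lt natDegree_mul_le ?_)
      have h1 := hdeg t
      have h2 := natDegree_X_pow_le (R := ℂ) s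
      omega
    refine ⟨Fin.cons (e 0 + m) fun k => e k.succ, ?_, fun e' hne _ hle => ?_⟩
    · rw [hrepr, if_pos (show (fun k : Fin n =>
        (Fin.cons (e 0 + m) fun k => e k.succ : Fin (n + 1) → ℕ) k.succ) = fun k => e k.succ
        from rfl), coeff_add, Fin.cons_zero, add_comm (e 0) m, coeff_mul_X_pow, hcoeff]
      have h1 : (C ((P (fun k => e k.succ) : ℂ)⁻¹ * e 0) * X ^ (e 0 - 1)).coeff (m + e 0) = 0 := by
        rcases Nat.eq_zero_or_pos (e 0) with h0 | h0
        · simp [h0]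
        · rw [coeff_C_mul, coeff_X_pow, if_neg (by omega), mul_zero]
      rw [h1, add_zero]
      exact_mod_cast mul_ne_zero (hP _) (hr _ htsum).ne'
    · rw [hrepr]
      split_ifs with hte
      · have hte' : ∀ k : Fin n, e k.succ = e' k.succ := fun k => by
          simpa using congrFun hte k
        have hne0 : e' 0 ≠ e 0 := fun h0 => hne (funext (Fin.cases h0 fun k => (hte' k).symm))
        have he' : e' ≠ 0 := by
          rintro rfl
          exact ht (funext fun k => hte' k)
        have hlt : e' 0 < e 0 := lt_of_le_of_ne (hle he') hne0
        rw [coeff_add, Fin.cons_zero, hdeg' _ _ _ hlt, coeff_C_mul, coeff_X_pow,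
          if_neg (by omega), mul_zero, add_zero]
      · rfl

end OreType

/-! ### Algebras of Weyl type -/

namespace WeylType

variable {n : ℕ} {A : Type u} [Ring A] [Algebra ℂ A] {q p : ℝ} {κ : ℂ}
  {r : Fin n → Fin n → ℂ} {y : Fin (n + 2) → A}

/-- The relations `y_0 y_1 = q y_1 y_0 - κ`, `y_0 z_k = p z_k y_0`, `y_1 z_k = p⁻¹ z_k y_1` and
`z_k z_l = r_{kl} z_l z_k` for `k < l`, where `z_k = y_{k+2}`. -/
def straightening (q : ℝ) (κ : ℂ) (p : ℝ) (r : Fin n → Fin n → ℂ) : Straightening ℂ (n + 2) where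
  swap := Fin.cons (Fin.cons 0 (Fin.cons (q : ℂ) fun _ => (p : ℂ)))
    (Fin.cons (Fin.cons 0 (Fin.cons 0 fun _ => (p : ℂ)⁻¹))
      fun k => Fin.cons 0 (Fin.cons 0 (r k)))
  left := 0
  right := 0
  const := Fin.cons (Fin.cons 0 (Fin.cons (-κ) fun _ => 0)) fun _ => 0

theorem forall_compat {P : Fin (n + 2) → Fin (n + 2) → Prop} (h01 : P 0 1)
    (h0 : ∀ k : Fin n, P 0 k.succ.succ) (h1 : ∀ k : Fin n, P 1 k.succ.succ)
    (h2 : ∀ k l : Fin n, k < l → P k.succ.succ l.succ.succ) (a b : Fin (n + 2)) (hab : a < b) :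
    P a b := by
  refine OreType.forall_compat (P := P) (Fin.cases h01 h0) (fun k l hkl => ?_) a b hab
  exact OreType.forall_compat (P := fun a b => P a.succ b.succ) h1 h2 k l hkl

theorem holds_iff : (straightening q κ p r).Holds y ↔
    y 0 * y 1 = (q : ℂ) • (y 1 * y 0) - κ • 1 ∧
    (∀ k : Fin n, y 0 * y k.succ.succ = (p : ℂ) • (y k.succ.succ * y 0)) ∧
    (∀ k : Fin n, y 1 * y k.succ.succ = (p : ℂ)⁻¹ • (y k.succ.succ * y 1)) ∧
    ∀ k l : Fin n, k < l →
      y k.succ.succ * y l.succ.succ = r k l • (y l.succ.succ * y k.succ.succ) := by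
  constructor
  · intro h
    refine ⟨?_, fun k => ?_, fun k => ?_, fun k l hkl => ?_⟩
    · simpa [straightening, Fin.cons_one, sub_eq_add_neg] using h 0 1 (by simp)
    · simpa [straightening] using h 0 k.succ.succ (Fin.succ_pos _)
    · simpa [straightening, Fin.cons_one] using
        h 1 k.succ.succ (Fin.succ_lt_succ_iff.2 (Fin.succ_pos _))
    · simpa [straightening] using h k.succ.succ l.succ.succ (by simpa using hkl)
  · rintro ⟨h01, h0, h1, h2⟩
    refine forall_compat ?_ (fun k => ?_) (fun k => ?_) fun k l hkl => ?_
    · simpa [straightening, Fin.cons_one, sub_eq_add_neg] using h01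
    · simpa [straightening] using h0 k
    · simpa [straightening, Fin.cons_one] using h1 k
    · simpa [straightening] using h2 k l hkl

theorem forall_fin {P : Fin (n + 2) → Prop} (h0 : P 0) (h1 : P 1)
    (h2 : ∀ k : Fin n, P k.succ.succ) (a : Fin (n + 2)) : P a :=
  Fin.cases h0 (Fin.cases h1 h2) a

theorem ordMonomial_eq {B : Type*} [Monoid B] (y : Fin (n + 2) → B) (e : Fin (n + 2) → ℕ) :
    ordMonomial y e =
    ordMonomial (fun k : Fin n => y k.succ.succ) (fun k => e k.succ.succ) *
      (y 1 ^ e 1 * y 0 ^ e 0) := by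
  rw [ordMonomial_eq_mul_zero, ordMonomial_eq_mul_zero, mul_assoc]
  rfl

/-- The scaling of `y_0`, `y_1` and `z_k` by `a`, `a⁻¹` and `b` is an automorphism. -/
theorem exists_automorphism (h : IsPBW (straightening q κ p r) y) {a b : ℂ} (ha : a ≠ 0)
    (hb : b ≠ 0) : ∃ σ : A ≃ₐ[ℂ] A, σ (y 0) = a • y 0 ∧ σ (y 1) = a⁻¹ • y 1 ∧
      (∀ k : Fin n, σ (y k.succ.succ) = b • y k.succ.succ) ∧
      ∀ e, σ (ordMonomial y e) =
        (b ^ (∑ k : Fin n, e k.succ.succ) * (a⁻¹ ^ e 1 * a ^ e 0)) • ordMonomial y e := by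
  obtain ⟨h01, h0, h1, h2⟩ := holds_iff.1 h.rel
  have hs : ∀ s : Fin (n + 2) → ℂ, s 0 * s 1 = 1 →
      (straightening q κ p r).Holds fun a => s a • y a := by
    intro s hs0
    refine holds_iff.2 ⟨?_, fun k => ?_, fun k => ?_, fun k l hkl => ?_⟩
    · rw [smul_mul_smul_comm, smul_mul_smul_comm, hs0, mul_comm, hs0, one_smul, one_smul, h01]
    · rw [smul_mul_smul_comm, smul_mul_smul_comm, h0]
      module
    · rw [smul_mul_smul_comm, smul_mul_smul_comm, h1]
      module
    · rw [smul_mul_smul_comm, smul_mul_smul_comm, h2 k l hkl]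
      module
  obtain ⟨σ, hσ⟩ := h.exists_scaling (s := Fin.cons a (Fin.cons a⁻¹ fun _ => b))
    (forall_fin (by simpa using ha) (by simpa [Fin.cons_one] using ha) fun k => by simpa using hb)
    (hs _ (by simp [Fin.cons_one, ha])) (hs (fun i => _) (by simp [Fin.cons_one, ha]))
  have hσ0 : σ (y 0) = a • y 0 := hσ 0
  have hσ1 : σ (y 1) = a⁻¹ • y 1 := hσ 1
  have hσ2 : ∀ k : Fin n, σ (y k.succ.succ) = b • y k.succ.succ := fun k => hσ k.succ.succ
  refine ⟨σ, hσ0, hσ1, hσ2, fun e => ?_⟩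
  have hz := ordMonomial_map (σ : A →ₐ[ℂ] A) (fun k : Fin n => y k.succ.succ)
    (fun k => e k.succ.succ)
  simp only [AlgEquiv.coe_toAlgHom, hσ2, ordMonomial_smul, Finset.prod_pow_eq_pow_sum] at hz
  rw [ordMonomial_eq y, map_mul, map_mul, map_pow, map_pow, hσ0, hσ1, hz, smul_pow, smul_pow,
    smul_mul_smul_comm, smul_mul_smul_comm]

/-! ### Algebras of Weyl type: the generic case -/

theorem zero_mul_one_pow (h : IsPBW (straightening q κ p r) y) (s : ℕ) :
    y 0 * y 1 ^ (s + 1) = (q : ℂ) ^ (s + 1) • (y 1 ^ (s + 1) * y 0) -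
      (κ * ∑ i ∈ Finset.range (s + 1), (q : ℂ) ^ i) • y 1 ^ s := by
  have h01 := (holds_iff.1 h.rel).1
  induction s with
  | zero => simpa using h01
  | succ s ih =>
    rw [pow_succ (y 1) (s + 1), ← mul_assoc, ih, sub_mul, smul_mul_assoc, smul_mul_assoc, mul_assoc,
      h01, ← pow_succ, Finset.sum_range_succ _ (s + 1), mul_sub, mul_smul_comm, mul_smul_comm,
      mul_one, ← mul_assoc]
    module

theorem zero_pow_mul_one (h : IsPBW (straightening q κ p r) y) (s : ℕ) :
    y 0 ^ (s + 1) * y 1 = (q : ℂ) ^ (s + 1) • (y 1 * y 0 ^ (s + 1)) -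
      (κ * ∑ i ∈ Finset.range (s + 1), (q : ℂ) ^ i) • y 0 ^ s := by
  have h01 := (holds_iff.1 h.rel).1
  induction s with
  | zero => simpa using h01
  | succ s ih =>
    rw [pow_succ' (y 0) (s + 1), mul_assoc, ih, mul_sub, mul_smul_comm, mul_smul_comm, ← mul_assoc,
      h01, ← pow_succ', Finset.sum_range_succ _ (s + 1), sub_mul, smul_mul_assoc, smul_mul_assoc,
      one_mul, mul_assoc]
    module

theorem mul_zero_injective (h : IsPBW (straightening q κ p r) y) {x : A} (hx : x * y 0 = 0) :
    x = 0 := by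
  have hrepr : ∀ x e, h.basis.repr (x * y 0) (e + Pi.single 0 1) = h.basis.repr x e := by
    intro x e
    have hlin : h.basis.repr.toLinearMap ∘ₗ LinearMap.mulRight ℂ (y 0) =
        (Finsupp.lmapDomain ℂ ℂ fun e : Fin (n + 2) → ℕ => e + Pi.single 0 1) ∘ₗ
          h.basis.repr.toLinearMap := by
      refine h.basis.ext fun e => ?_
      simp [h.basis_apply, ordMonomial_mul_zero, h.repr_ordMonomial, Finsupp.mapDomain_single]
    have h1 := congrArg (fun f : (Fin (n + 2) → ℕ) →₀ ℂ => f (e + Pi.single 0 1))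
      (LinearMap.congr_fun hlin x)
    simp only [LinearMap.comp_apply, LinearEquiv.coe_coe, LinearMap.mulRight_apply,
      Finsupp.lmapDomain_apply] at h1
    rw [h1]
    exact Finsupp.mapDomain_apply (add_left_injective _) _ _
  refine h.basis.repr.injective (Finsupp.ext fun e => ?_)
  rw [← hrepr x e, hx]
  simp

/-- A real number other than `±1` is not a root of unity; `0` is allowed. -/
theorem pow_ne_one (hq1 : q ≠ 1) (hq : q ≠ -1) {s : ℕ} (hs : s ≠ 0) : (q : ℂ) ^ s ≠ 1 := by
  intro h
  have h1 : q ^ s = 1 := by exact_mod_cast h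
  rcases (pow_eq_one_iff_of_ne_zero hs).1 h1 with h2 | h2
  · exact hq1 h2
  · exact hq h2.1

/-- The calculus defined by the eigenvector `y_0` of the automorphism that scales `y_0`, `y_1` and
the `z_k` by `2`, `1 / 2` and `3`.  Multiplicative independence of `2` and `3` leaves only
combinations of the `y_1 ^ s y_0 ^ s` invariant, and of these only the scalars commute with `y_0`,
as `q` is not a root of unity.  Commutation with `y_1` lowers the powers of `y_0` in an ideal, as
`κ ≠ 0`. -/
theorem exists_calculus_of_ne_neg_one (h : IsPBW (straightening q κ p r) y) (hκ : κ ≠ 0)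
    (hq1 : q ≠ 1) (hq : q ≠ -1) :
    ∃ C : DifferentialCalculus ℂ A, C.HasDimension (n + 2) ∧ C.IsConnected ∧
      C.IsIntegrable (n + 2) := by
  have hA := h.nontrivial
  have hgeom : ∀ s : ℕ, ∑ i ∈ Finset.range (s + 1), (q : ℂ) ^ i ≠ 0 := by
    intro s h0
    have h1 := geom_sum_mul (q : ℂ) (s + 1)
    rw [h0, zero_mul] at h1
    exact pow_ne_one hq1 hq s.succ_ne_zero (sub_eq_zero.1 h1.symm)
  obtain ⟨σ, hσ0, -, -, hσ⟩ := exists_automorphism h (a := 2) (b := 3) two_ne_zero three_ne_zero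
  refine EigenModel.exists_calculus (n + 2) (2 : ℂ) σ (by omega) two_ne_zero (fun i hi h2 => ?_) hσ0
    (fun a => mul_zero_injective h) (fun a hσa hca => h.exists_algebraMap ?_)
    (fun s Z hl hr hZ => ?_)
  · have h3 : (2 : ℕ) ^ i = 1 := by exact_mod_cast h2
    simp [hi] at h3
  · -- an invariant element is a combination of the `y_1 ^ s * y_0 ^ s`
    have hsupp : ∀ e, h.basis.repr a e ≠ 0 → e 0 = e 1 ∧ ∀ k : Fin n, e k.succ.succ = 0 := by
      intro e he
      by_contra hne
      refine he (h.basis.repr_eq_zero_of_diagonal (σ.toLinearMap - LinearMap.id)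
        (by simp [hσa]) (fun e => 3 ^ (∑ k : Fin n, e k.succ.succ) * (2⁻¹ ^ e 1 * 2 ^ e 0) - 1)
        (fun e => by simp [h.basis_apply, hσ, sub_smul]) ?_)
      intro h1
      have h2 : (3 : ℕ) ^ (∑ k : Fin n, e k.succ.succ) * 2 ^ e 0 = 2 ^ e 1 := by
        have h3 : (3 : ℂ) ^ (∑ k : Fin n, e k.succ.succ) * 2 ^ e 0 = 2 ^ e 1 := by
          rw [inv_pow] at h1
          field_simp at h1
          linear_combination h1
        exact_mod_cast h3
      have h4 : ∑ k : Fin n, e k.succ.succ = 0 := by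
        by_contra h0
        have h5 : 3 ∣ 2 ^ e 1 := h2 ▸ Dvd.dvd.mul_right (dvd_pow_self 3 h0) _
        exact absurd (Nat.prime_three.dvd_of_dvd_pow h5) (by norm_num)
      rw [h4, pow_zero, one_mul] at h2
      exact hne ⟨Nat.pow_right_injective le_rfl h2,
        fun k => Finset.sum_eq_zero_iff.1 h4 k (Finset.mem_univ k)⟩
    -- the commutator of `y 0` with `y 1 ^ s * y 0 ^ s`
    have hT : ∀ e : Fin (n + 2) → ℕ, e 0 = e 1 → (∀ k : Fin n, e k.succ.succ = 0) → ∀ j,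
        h.basis.repr ((LinearMap.mulLeft ℂ (y 0) - LinearMap.mulRight ℂ (y 0)) (h.basis e)) j =
          ((q : ℂ) ^ e 0 - 1) * (if e + Pi.single 0 1 = j then 1 else 0) -
            κ * (∑ i ∈ Finset.range (e 0), (q : ℂ) ^ i) *
              (if e - Pi.single 1 1 = j then 1 else 0) := by
      intro e h01 h2 j
      have h3 : ordMonomial (fun k : Fin n => y k.succ.succ) (fun k => e k.succ.succ) = 1 := by
        simp only [h2]
        exact ordMonomial_zero _
      rw [h.basis_apply, LinearMap.sub_apply, LinearMap.mulLeft_apply, LinearMap.mulRight_apply,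
        ordMonomial_mul_zero]
      have h4 : y 0 * ordMonomial y e = (q : ℂ) ^ e 0 • ordMonomial y (e + Pi.single 0 1) -
          (κ * (∑ i ∈ Finset.range (e 0), (q : ℂ) ^ i)) • ordMonomial y (e - Pi.single 1 1) := by
        have hsub : ordMonomial (fun k : Fin n => y k.succ.succ)
            (fun k => (e - Pi.single 1 1 : Fin (n + 2) → ℕ) k.succ.succ) = 1 := by
          rw [← ordMonomial_zero fun k : Fin n => y k.succ.succ]
          congr 1
          funext k
          simp [h2]
        have hadd : ordMonomial (fun k : Fin n => y k.succ.succ)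
            (fun k => (e + Pi.single 0 1 : Fin (n + 2) → ℕ) k.succ.succ) = 1 := by
          rw [← ordMonomial_zero fun k : Fin n => y k.succ.succ]
          congr 1
          funext k
          simp [h2]
        rw [ordMonomial_eq y e, ordMonomial_eq y (e + _), ordMonomial_eq y (e - _), h3, hsub, hadd,
          one_mul, one_mul, one_mul]
        rcases Nat.eq_zero_or_pos (e 0) with he | he
        · simp [he, ← h01]
        · obtain ⟨s, hs⟩ : ∃ s, e 0 = s + 1 := Nat.exists_eq_add_of_le' he
          have hs' : e 1 = s + 1 := h01 ▸ hs
          simp only [Pi.add_apply, Pi.sub_apply, Pi.single_eq_same, hs, hs', Nat.add_sub_cancel]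
          rw [Pi.single_eq_of_ne (by simp), Pi.single_eq_of_ne (by simp), add_zero, tsub_zero,
            ← mul_assoc, zero_mul_one_pow h, sub_mul, smul_mul_assoc, smul_mul_assoc,
            mul_assoc, ← pow_succ']
      rw [h4, map_sub, map_sub, map_smul, map_smul, Finsupp.sub_apply, Finsupp.sub_apply,
        Finsupp.smul_apply, Finsupp.smul_apply, h.repr_ordMonomial_apply, h.repr_ordMonomial_apply,
        smul_eq_mul, smul_eq_mul]
      ring
    intro e he
    by_contra hne
    have hsuppe := hsupp e hne
    refine hne (h.basis.repr_eq_zero_of_triangular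
      (LinearMap.mulLeft ℂ (y 0) - LinearMap.mulRight ℂ (y 0)) (by simp [hca])
      {e | e ≠ 0 ∧ e 0 = e 1 ∧ ∀ k : Fin n, e k.succ.succ = 0} (fun e => e 0)
      (fun e hes => ⟨e + Pi.single 0 1, ?_, fun e' hne' hsupp' hle => ?_⟩) ⟨he, hsuppe⟩)
    · obtain ⟨he, h01, h2⟩ := hes
      have he0 : e 0 ≠ 0 := fun h0 => he (funext (forall_fin h0 (h01 ▸ h0) h2))
      have hj : e - Pi.single 1 1 ≠ e + Pi.single 0 1 := fun h' => by
        have := congrFun h' 0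
        simp at this
      rw [hT e h01 h2, if_pos rfl, if_neg hj, mul_one, mul_zero, sub_zero]
      exact sub_ne_zero.2 (pow_ne_one hq1 hq he0)
    · obtain ⟨h01, h2⟩ := hsupp e' hsupp'
      have hle' : e' 0 ≤ e 0 := by
        by_cases h0 : e' = 0
        · simp [h0]
        · exact hle ⟨h0, h01, h2⟩
      have hj : e' + Pi.single 0 1 ≠ e + Pi.single 0 1 := fun h' => hne' (add_right_cancel h')
      have hj' : e' - Pi.single 1 1 ≠ e + Pi.single 0 1 := fun h' => by
        have := congrFun h' 0
        simp at this
        omega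
      rw [hT e' h01 h2, if_neg hj, if_neg hj', mul_zero, mul_zero, sub_zero]
  · -- `y 0 ^ s` is a multiple of a twisted commutator of `y 1` and `y 0 ^ (s + 1)`
    induction s with
    | zero => simpa using hZ
    | succ s ih =>
      refine ih ?_
      have h1 := zero_pow_mul_one h s
      have h2 : (κ * ∑ i ∈ Finset.range (s + 1), (q : ℂ) ^ i) • y 0 ^ s ∈ Z := by
        have h3 : (κ * ∑ i ∈ Finset.range (s + 1), (q : ℂ) ^ i) • y 0 ^ s =
            (q : ℂ) ^ (s + 1) • (y 1 * y 0 ^ (s + 1)) - y 0 ^ (s + 1) * y 1 := by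
          rw [h1]
          abel
        rw [h3]
        exact Z.sub_mem (Z.smul_mem _ (hl _ _ hZ)) (hr _ hZ _)
      exact (Z.smul_mem_iff (mul_ne_zero hκ (hgeom s))).1 h2

/-! ### Algebras of Weyl type: the anticommuting case -/

theorem zero_mul_one (h : IsPBW (straightening (-1) κ p r) y) :
    y 0 * y 1 = -(y 1 * y 0) - κ • 1 := by
  simpa using (holds_iff.1 h.rel).1

/-- The twisted derivation with `y_0 ↦ y_1`, `y_1 ↦ (2 / κ) y_1 ^ 3` and `z_k ↦ z_k`, whose twist
fixes `y_0` and `y_1` and rescales the `z_k` by `p⁻²`. -/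
theorem exists_derivation (h : IsPBW (straightening (-1) κ p r) y) (hκ : κ ≠ 0) (hp : p ≠ 0)
    {σ : A ≃ₐ[ℂ] A} (hσ0 : σ (y 0) = y 0) (hσ1 : σ (y 1) = y 1)
    (hσ2 : ∀ k : Fin n, σ (y k.succ.succ) = ((p⁻¹ ^ 2 : ℝ) : ℂ) • y k.succ.succ) :
    ∃ δ : A →ₗ[ℂ] A, (∀ x x', δ (x * x') = δ x * x' + σ x * δ x') ∧ δ (y 0) = y 1 ∧
      δ (y 1) = (2 / κ) • y 1 ^ 3 ∧ ∀ k : Fin n, δ (y k.succ.succ) = y k.succ.succ := by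
  have h01 := zero_mul_one h
  obtain ⟨-, h0, h1, h2⟩ := holds_iff.1 h.rel
  have hp' : (p : ℂ) ≠ 0 := by exact_mod_cast hp
  refine Exists.imp (fun δ hδ => ⟨hδ.1, hδ.2 0, hδ.2 1, fun k => hδ.2 k.succ.succ⟩)
    (h.exists_twistedDerivation (σ : A →ₐ[ℂ] A)
      (Fin.cons (y 1) (Fin.cons ((2 / κ) • y 1 ^ 3) fun k => y k.succ.succ))
      (forall_compat ?_ (fun k => ?_) (fun k => ?_) fun k l hkl => ?_))
  · have h3 : y 0 * y 1 ^ 3 = -(y 1 ^ 3 * y 0) - κ • y 1 ^ 2 := by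
      simpa [Finset.sum_range_succ, pow_succ] using zero_mul_one_pow h 2
    simp only [straightening, Fin.cons_zero, Fin.cons_one, AlgEquiv.coe_toAlgHom, hσ0, hσ1,
      Pi.zero_apply, zero_smul, add_zero, mul_smul_comm, smul_mul_assoc, h3]
    rw [← pow_two]
    push_cast
    match_scalars <;> field_simp
    ring
  · simp only [straightening, Fin.cons_zero, Fin.cons_succ, AlgEquiv.coe_toAlgHom, hσ0, hσ2,
      Pi.zero_apply, zero_smul, add_zero, smul_mul_assoc, h0, h1]
    push_cast
    match_scalars
    all_goals field_simp
  · have h3 : y 1 ^ 3 * y k.succ.succ = (p : ℂ)⁻¹ ^ 3 • (y k.succ.succ * y 1 ^ 3) := by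
      simp only [pow_succ _ 2, pow_two, mul_assoc, h1, mul_smul_comm]
      simp only [← mul_assoc, h1, mul_smul_comm, smul_mul_assoc]
      match_scalars
      ring
    simp only [straightening, Fin.cons_zero, Fin.cons_one, Fin.cons_succ, AlgEquiv.coe_toAlgHom,
      hσ1, hσ2, Pi.zero_apply, zero_smul, add_zero, mul_smul_comm, smul_mul_assoc, h1, h3]
    push_cast
    match_scalars <;> field_simp
  · simp only [straightening, Fin.cons_succ, AlgEquiv.coe_toAlgHom, hσ2, Pi.zero_apply, zero_smul,
      add_zero, smul_mul_assoc, h2 k l hkl]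
    module

/-- Since `y_0 ^ 2` is mapped to `-κ` and commutes with `y_1`, the derivative of a power of `y_0`
depends on the parity of the exponent `s`: the terms are `y_1 y_0 ^ (s - 1)` for odd `s` and
`-κ (s / 2) y_0 ^ (s - 2)`.  Truncated exponents only occur with coefficient `0`. -/
theorem deriv_zero_pow (h : IsPBW (straightening (-1) κ p r) y) {σ : A ≃ₐ[ℂ] A}
    (hσ0 : σ (y 0) = y 0) {δ : A →ₗ[ℂ] A} (hδ : ∀ x x', δ (x * x') = δ x * x' + σ x * δ x')
    (hδ0 : δ (y 0) = y 1) (s : ℕ) : δ (y 0 ^ s) =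
      ((s % 2 : ℕ) : ℂ) • (y 1 * y 0 ^ (s - 1)) - (κ * (s / 2 : ℕ)) • y 0 ^ (s - 2) := by
  have h01 := zero_mul_one h
  induction s using Nat.twoStepInduction with
  | zero => simpa using hδ 1 1
  | one => simp [hδ0]
  | more s ih _ =>
    have hsq : δ (y 0 ^ 2) = -(κ • 1) := by
      rw [pow_two, hδ, hδ0, hσ0, h01]
      abel
    have hcomm : y 0 ^ 2 * y 1 = y 1 * y 0 ^ 2 := by
      simpa [Finset.sum_range_succ] using zero_pow_mul_one h 1
    rw [add_comm s 2, pow_add, hδ, hsq, map_pow, hσ0, ih, mul_sub, mul_smul_comm, mul_smul_comm,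
      ← mul_assoc, hcomm, mul_assoc, ← pow_add, ← pow_add, Nat.add_mod_left,
      Nat.add_div_left _ two_pos, Nat.add_sub_cancel_left, neg_mul, smul_mul_assoc, one_mul]
    have h1 : ((s % 2 : ℕ) : ℂ) • (y 1 * y 0 ^ (2 + (s - 1))) =
        ((s % 2 : ℕ) : ℂ) • (y 1 * y 0 ^ (2 + s - 1)) := by
      rcases Nat.eq_zero_or_pos s with rfl | hs
      · simp
      · rw [Nat.add_sub_assoc hs]
    have h2 : (κ * (s / 2 : ℕ)) • y 0 ^ (2 + (s - 2)) = (κ * (s / 2 : ℕ)) • y 0 ^ s := by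
      rcases lt_or_ge s 2 with hs | hs
      · simp [Nat.div_eq_of_lt hs]
      · rw [Nat.add_sub_cancel' hs]
    rw [h1, h2]
    push_cast
    module

theorem deriv_one_pow {σ : A ≃ₐ[ℂ] A} (hσ1 : σ (y 1) = y 1) {δ : A →ₗ[ℂ] A}
    (hδ : ∀ x x', δ (x * x') = δ x * x' + σ x * δ x') (hδ1 : δ (y 1) = (2 / κ) • y 1 ^ 3) (s : ℕ) :
    δ (y 1 ^ s) = (2 * s / κ) • y 1 ^ (s + 2) := by
  induction s with
  | zero => simpa using hδ 1 1
  | succ s ih =>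
    rw [pow_succ', hδ, hδ1, hσ1, ih, smul_mul_assoc, mul_smul_comm, ← pow_add, ← pow_succ',
      add_comm 3 s, add_right_comm]
    push_cast
    match_scalars
    ring

/-- The coordinates of the derivative of an ordered monomial.  The contribution `a` of the `z_k` is
a sum of powers of `p⁻² > 0`, hence nonzero if some `z_k` occurs; `b` is the eigenvalue of the twist
on the `z_k`. -/
theorem repr_deriv (h : IsPBW (straightening (-1) κ p r) y) (hp : p ≠ 0) {σ : A ≃ₐ[ℂ] A}
    (hσ0 : σ (y 0) = y 0) (hσ1 : σ (y 1) = y 1)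
    (hσ2 : ∀ k : Fin n, σ (y k.succ.succ) = ((p⁻¹ ^ 2 : ℝ) : ℂ) • y k.succ.succ)
    {δ : A →ₗ[ℂ] A} (hδ : ∀ x x', δ (x * x') = δ x * x' + σ x * δ x') (hδ0 : δ (y 0) = y 1)
    (hδ1 : δ (y 1) = (2 / κ) • y 1 ^ 3)
    (hδ2 : ∀ k : Fin n, δ (y k.succ.succ) = y k.succ.succ) (e : Fin (n + 2) → ℕ) :
    ∃ a b : ℂ, b ≠ 0 ∧ (a = 0 ↔ ∀ k : Fin n, e k.succ.succ = 0) ∧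
      ∀ j, h.basis.repr (δ (h.basis e)) j = a * (if e = j then 1 else 0) +
        b * (2 * e 1 / κ * (if e + Pi.single 1 2 = j then 1 else 0) +
          ((e 0 % 2 : ℕ) * (if e + Pi.single 1 1 - Pi.single 0 1 = j then 1 else 0) -
            κ * (e 0 / 2 : ℕ) * (if e - Pi.single 0 2 = j then 1 else 0))) := by
  -- the derivative and the twist of an ordered monomial in the `z_k`
  have hz : ∀ t : Fin n → ℕ,
      σ (ordMonomial (fun k => y k.succ.succ) t) =
        (((p⁻¹ ^ 2) ^ (∑ k, t k) : ℝ) : ℂ) • ordMonomial (fun k => y k.succ.succ) t ∧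
      δ (ordMonomial (fun k => y k.succ.succ) t) =
        ((∑ i ∈ Finset.range (∑ k, t k), (p⁻¹ ^ 2) ^ i : ℝ) : ℂ) •
          ordMonomial (fun k => y k.succ.succ) t := by
    intro t
    refine ordMonomial_induction (fun k : Fin n => y k.succ.succ)
      (p := fun d x => σ x = (((p⁻¹ ^ 2) ^ d : ℝ) : ℂ) • x ∧
        δ x = ((∑ i ∈ Finset.range d, (p⁻¹ ^ 2) ^ i : ℝ) : ℂ) • x) ?_ ?_ t
    · exact ⟨by simp, by simpa using hδ 1 1⟩
    · rintro k d x ⟨hσx, hδx⟩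
      constructor
      · rw [map_mul, hσ2, hσx, smul_mul_smul_comm, ← Complex.ofReal_mul, ← pow_succ']
      · rw [hδ, hδ2, hσ2, hδx, smul_mul_smul_comm, Finset.sum_range_succ', ← Complex.ofReal_mul,
          Finset.mul_sum]
        simp only [← pow_succ', pow_zero, Complex.ofReal_add, Complex.ofReal_one]
        module
  obtain ⟨hσz, hδz⟩ := hz fun k => e k.succ.succ
  have hu : 0 < p⁻¹ ^ 2 := by positivity
  refine ⟨((∑ i ∈ Finset.range (∑ k : Fin n, e k.succ.succ), (p⁻¹ ^ 2) ^ i : ℝ) : ℂ),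
    (((p⁻¹ ^ 2) ^ (∑ k : Fin n, e k.succ.succ) : ℝ) : ℂ), ?_, ?_, fun j => ?_⟩
  rotate_left 2
  · rw [h.basis_apply, ordMonomial_eq, hδ, hδz, hσz, hδ, map_pow σ, hσ1, deriv_one_pow hσ1 hδ hδ1,
      deriv_zero_pow h hσ0 hδ hδ0]
    have hshift : ∀ e' : Fin (n + 2) → ℕ, (∀ k : Fin n, e' k.succ.succ = e k.succ.succ) →
        ordMonomial (fun k : Fin n => y k.succ.succ) (fun k => e k.succ.succ) *
          (y 1 ^ e' 1 * y 0 ^ e' 0) = ordMonomial y e' := by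
      intro e' he'
      rw [ordMonomial_eq]
      simp only [he']
    have h0 := hshift e fun _ => rfl
    have h1 := hshift (e + Pi.single 1 2) fun k => by
      simp [Pi.single_eq_of_ne (Fin.succ_succ_ne_one k)]
    have h2 := hshift (e + Pi.single 1 1 - Pi.single 0 1) fun k => by
      simp [Pi.single_eq_of_ne (Fin.succ_succ_ne_one k)]
    have h3 := hshift (e - Pi.single 0 2) fun k => by simp
    simp only [Pi.add_apply, Pi.sub_apply, Pi.single_eq_same, ne_eq, zero_ne_one, one_ne_zero,
      not_false_eq_true, Pi.single_eq_of_ne, add_zero, tsub_zero] at h1 h2 h3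
    simp only [mul_add, mul_sub, smul_mul_assoc, mul_smul_comm, smul_smul]
    rw [← mul_assoc (y 1 ^ e 1), ← pow_succ, h0, h1, h2, h3]
    simp only [map_add, map_sub, map_smul, Finsupp.add_apply, Finsupp.sub_apply,
      Finsupp.smul_apply, h.repr_ordMonomial_apply, smul_eq_mul]
    ring
  · exact_mod_cast (pow_pos hu _).ne'
  · rw [Complex.ofReal_eq_zero]
    rw [Finset.sum_eq_zero_iff_of_nonneg fun i _ => (pow_pos hu i).le]
    constructor
    · intro h0 k
      by_contra hk
      have hpos : 0 < ∑ k : Fin n, e k.succ.succ :=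
        (Nat.pos_of_ne_zero hk).trans_le
          (Finset.single_le_sum (f := fun k : Fin n => e k.succ.succ) (fun _ _ => Nat.zero_le _)
            (Finset.mem_univ k))
      exact absurd (h0 0 (Finset.mem_range.2 hpos)) (by simp)
    · intro h0 i hi
      simp [h0] at hi

/-- The calculus of jets of the twisted derivation with `y_0 ↦ y_1`, `y_1 ↦ (2 / κ) y_1 ^ 3` and
`z_k ↦ z_k`, in which `-κ⁻¹ y_0 ^ 2` has derivative `1`.  Here `q = -1` is a root of unity, and
`y_0 ^ 2` commutes with `y_1`, so that `y_0` has too large a centraliser for the method of the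
generic case. -/
theorem exists_calculus_neg_one (h : IsPBW (straightening (-1) κ p r) y) (hκ : κ ≠ 0)
    (hp : p ≠ 0) :
    ∃ C : DifferentialCalculus ℂ A, C.HasDimension (n + 2) ∧ C.IsConnected ∧
      C.IsIntegrable (n + 2) := by
  have hA := h.nontrivial
  have hp2 : p⁻¹ ^ 2 ≠ 0 := pow_ne_zero 2 (inv_ne_zero hp)
  obtain ⟨σ, hσ0, hσ1, hσ2, -⟩ := exists_automorphism h (a := 1) (b := ((p⁻¹ ^ 2 : ℝ) : ℂ))
    one_ne_zero (by exact_mod_cast hp2)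
  rw [one_smul] at hσ0
  rw [inv_one, one_smul] at hσ1
  obtain ⟨δ, hδ, hδ0, hδ1, hδ2⟩ := exists_derivation h hκ hp hσ0 hσ1 hσ2
  choose a b hb ha hrepr using repr_deriv h hp hσ0 hσ1 hσ2 hδ hδ0 hδ1 hδ2
  refine JetModel.exists_calculus (n + 2) (by omega) σ δ hδ
    (h.comm_twistedDerivation (σ := (σ : A →ₐ[ℂ] A)) hδ ?_) (fun x hx => ?_)
    (-κ⁻¹ • y 0 ^ 2) ?_ (by rw [map_smul, map_pow, hσ0])
  · refine forall_fin ?_ ?_ fun k => ?_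
    · change σ (δ _) = δ (σ _)
      rw [hδ0, hσ0, hσ1, hδ0]
    · change σ (δ _) = δ (σ _)
      rw [hδ1, hσ1, map_smul, map_pow, hσ1, hδ1]
    · change σ (δ _) = δ (σ _)
      rw [hδ2, hσ2, map_smul, hδ2]
  · -- `y_1` does not occur in an element of the kernel
    have h1 : ∀ e, e 1 ≠ 0 → h.basis.repr x e = 0 := by
      intro e he
      refine h.basis.repr_eq_zero_of_triangular δ hx {e | e 1 ≠ 0} (fun e => e 1)
        (fun e he => ⟨e + Pi.single 1 2, ?_, fun e' hne _ hle => ?_⟩) he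
      · have hj1 : e ≠ e + Pi.single 1 2 := fun h' => by simpa using congrFun h' 1
        have hj2 : e + Pi.single 1 1 - Pi.single 0 1 ≠ e + Pi.single 1 2 := fun h' => by
          simpa using congrFun h' 1
        have hj3 : e - Pi.single 0 2 ≠ e + Pi.single 1 2 := fun h' => by
          simpa using congrFun h' 1
        rw [hrepr, if_neg hj1, if_pos rfl, if_neg hj2, if_neg hj3]
        simp only [mul_zero, mul_one, zero_add, add_zero, sub_zero]
        exact mul_ne_zero (hb e) (div_ne_zero (mul_ne_zero two_ne_zero (Nat.cast_ne_zero.2 he)) hκ)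
      · have hle' : e' 1 ≤ e 1 := by
          by_cases h0 : e' 1 = 0
          · omega
          · exact hle h0
        have hj0 : e' + Pi.single 1 2 ≠ e + Pi.single 1 2 := fun h' => hne (add_right_cancel h')
        have hj1 : e' ≠ e + Pi.single 1 2 := fun h' => by
          have := congrFun h' 1
          simp at this
          omega
        have hj2 : e' + Pi.single 1 1 - Pi.single 0 1 ≠ e + Pi.single 1 2 := fun h' => by
          have := congrFun h' 1
          simp at this
          omega
        have hj3 : e' - Pi.single 0 2 ≠ e + Pi.single 1 2 := fun h' => by
          have := congrFun h' 1
          simp at this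
          omega
        rw [hrepr, if_neg hj0, if_neg hj1, if_neg hj2, if_neg hj3]
        simp
    -- nor do the `z_k`
    have h2 : ∀ e, (¬ ∀ k : Fin n, e k.succ.succ = 0) → h.basis.repr x e = 0 := by
      intro e he
      by_cases he1 : e 1 = 0
      swap
      · exact h1 e he1
      refine h.basis.repr_eq_zero_of_triangular δ hx
        {e | e 1 = 0 ∧ ¬ ∀ k : Fin n, e k.succ.succ = 0} (fun e => e 0)
        (fun e hes => ⟨e, ?_, fun e' hne hsupp hle => ?_⟩) ⟨he1, he⟩
      · obtain ⟨he1, he2⟩ := hes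
        have hj2 : e + Pi.single 1 1 - Pi.single 0 1 ≠ e := fun h' => by
          simpa using congrFun h' 1
        rw [hrepr, if_pos rfl, if_neg hj2, he1]
        have hj3 : κ * (e 0 / 2 : ℕ) * (if e - Pi.single 0 2 = e then (1 : ℂ) else 0) = 0 := by
          by_cases h0 : e 0 = 0
          · simp [h0]
          · rw [if_neg, mul_zero]
            intro h'
            have := congrFun h' 0
            simp at this
            omega
        rw [hj3]
        simpa using fun h0 => he2 ((ha e).1 h0)
      · have he1' : e' 1 = 0 := by_contra fun h0 => hsupp (h1 e' h0)
        obtain ⟨he1, he2⟩ := hes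
        have hj2 : e' + Pi.single 1 1 - Pi.single 0 1 ≠ e := fun h' => by
          have := congrFun h' 1
          simp at this
          omega
        have hj3 : e' - Pi.single 0 2 ≠ e := by
          intro h'
          have h2 : ∀ k : Fin n, e' k.succ.succ = e k.succ.succ := fun k => by
            simpa using congrFun h' k.succ.succ
          have h0 : e' 0 - 2 = e 0 := by simpa using congrFun h' 0
          have hle' : e' 0 ≤ e 0 := hle ⟨he1', by simpa only [h2] using he2⟩
          exact hne (funext (forall_fin (by omega) (by omega) h2))
        rw [hrepr, if_neg hne, if_neg hj2, if_neg hj3, he1']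
        simp
    -- on powers of `y_0` the leading term depends on the parity of the exponent
    refine h.exists_algebraMap fun e he => ?_
    by_cases he1 : e 1 = 0
    swap
    · exact h1 e he1
    by_cases he2 : ∀ k : Fin n, e k.succ.succ = 0
    swap
    · exact h2 e he2
    refine h.basis.repr_eq_zero_of_triangular δ hx
      {e | e ≠ 0 ∧ e 1 = 0 ∧ ∀ k : Fin n, e k.succ.succ = 0} (fun _ => 0)
      (fun e hes => ?_) ⟨he, he1, he2⟩
    obtain ⟨he, he1, he2⟩ := hes
    have he0 : e 0 ≠ 0 := fun h0 => he (funext (forall_fin h0 he1 he2))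
    have hsupp' : ∀ e', h.basis.repr x e' ≠ 0 → e' 1 = 0 ∧ (∀ k : Fin n, e' k.succ.succ = 0) ∧
        (e' ≠ e → e' 0 ≠ e 0) := by
      intro e' hs
      have h3 : e' 1 = 0 := by_contra fun h0 => hs (h1 e' h0)
      have h4 : ∀ k : Fin n, e' k.succ.succ = 0 := by_contra fun h0 => hs (h2 e' h0)
      exact ⟨h3, h4, fun hne h0 => hne (funext (forall_fin h0 (h3.trans he1.symm)
        fun k => (h4 k).trans (he2 k).symm))⟩
    rcases Nat.mod_two_eq_zero_or_one (e 0) with hmod | hmod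
    · refine ⟨e - Pi.single 0 2, ?_, fun e' hne hsupp _ => ?_⟩
      · rw [hrepr, (ha e).2 he2, he1, hmod, if_pos rfl]
        simp only [Nat.cast_zero, mul_zero, zero_div, zero_mul, zero_add, zero_sub, mul_one]
        exact mul_ne_zero (hb e) (neg_ne_zero.2 (mul_ne_zero hκ (Nat.cast_ne_zero.2 (by omega))))
      · obtain ⟨he1', he2', he0'⟩ := hsupp' e' hsupp
        have hj2 : e' + Pi.single 1 1 - Pi.single 0 1 ≠ e - Pi.single 0 2 := fun h' => by
          have := congrFun h' 1
          simp at this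
          omega
        have hj3 : κ * (e' 0 / 2 : ℕ) *
            (if e' - Pi.single 0 2 = e - Pi.single 0 2 then (1 : ℂ) else 0) = 0 := by
          rcases lt_or_ge (e' 0) 2 with h0 | h0
          · simp [Nat.div_eq_of_lt h0]
          · rw [if_neg, mul_zero]
            intro h'
            have := congrFun h' 0
            simp at this
            have := he0' hne
            omega
        rw [hrepr, (ha e').2 he2', he1', if_neg hj2, hj3]
        simp
    · refine ⟨e + Pi.single 1 1 - Pi.single 0 1, ?_, fun e' hne hsupp _ => ?_⟩
      · have hj3 : e - Pi.single 0 2 ≠ e + Pi.single 1 1 - Pi.single 0 1 := fun h' => by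
          simpa using congrFun h' 1
        rw [hrepr, (ha e).2 he2, he1, hmod, if_pos rfl, if_neg hj3]
        simpa using hb e
      · obtain ⟨he1', he2', he0'⟩ := hsupp' e' hsupp
        have hj3 : e' - Pi.single 0 2 ≠ e + Pi.single 1 1 - Pi.single 0 1 := fun h' => by
          have := congrFun h' 1
          simp at this
          omega
        have hj2 : ((e' 0 % 2 : ℕ) : ℂ) * (if e' + Pi.single 1 1 - Pi.single 0 1 =
            e + Pi.single 1 1 - Pi.single 0 1 then (1 : ℂ) else 0) = 0 := by
          rcases Nat.eq_zero_or_pos (e' 0) with h0 | h0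
          · simp [h0]
          · rw [if_neg, mul_zero]
            intro h'
            have := congrFun h' 0
            simp at this
            have := he0' hne
            omega
        rw [hrepr, (ha e').2 he2', he1', if_neg hj3, hj2]
        simp
  · have h1 := deriv_zero_pow h hσ0 hδ hδ0 2
    rw [map_smul, h1]
    simp [smul_smul, hκ]

theorem exists_calculus (h : IsPBW (straightening q κ p r) y) (hκ : κ ≠ 0) (hq : q ≠ 1)
    (hp : p ≠ 0) :
    ∃ C : DifferentialCalculus ℂ A, C.HasDimension (n + 2) ∧ C.IsConnected ∧
      C.IsIntegrable (n + 2) := by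
  by_cases hq' : q = -1
  · subst hq'
    exact exists_calculus_neg_one h hκ hp
  · exact exists_calculus_of_ne_neg_one h hκ hq hq'

end WeylType

/-! ### Relations between the coefficients of a diffusion algebra -/

namespace DiffusionAlgebra

variable {N : ℕ} {g : Fin N → Fin N → ℝ} {x : Fin N → ℂ} {A : Type u} [Ring A] [Algebra ℂ A]
  {D : Fin N → A}

/-- The relations of a diffusion algebra, solved for `D_a D_b` with `a < b`. -/
def straightening (g : Fin N → Fin N → ℝ) (x : Fin N → ℂ) : Straightening ℂ N :=
  ⟨fun a b => g b a / g a b, fun a b => x b / g a b, fun a b => -x a / g a b, 0⟩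

theorem holds_iff (hg : ∀ a b, a < b → g a b ≠ 0) : (straightening g x).Holds D ↔
    ∀ a b, (g a b : ℂ) • (D a * D b) - (g b a : ℂ) • (D b * D a) = x b • D a - x a • D b := by
  have key : ∀ a b, a < b → ((D a * D b = (g b a / g a b : ℂ) • (D b * D a) +
      (x b / g a b) • D a + (-x a / g a b) • D b + (0 : ℂ) • 1) ↔
      (g a b : ℂ) • (D a * D b) - (g b a : ℂ) • (D b * D a) = x b • D a - x a • D b) := by
    intro a b hab
    have h0 : (g a b : ℂ) ≠ 0 := by exact_mod_cast hg a b hab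
    constructor
    · intro h
      rw [h]
      match_scalars <;> field_simp <;> ring
    · intro h
      rw [sub_eq_iff_eq_add] at h
      rw [← inv_smul_smul₀ h0 (D a * D b), h]
      match_scalars <;> field_simp
  constructor
  · intro h a b
    rcases lt_trichotomy a b with hab | rfl | hab
    · exact (key a b hab).1 (h a b hab)
    · simp
    · have := (key b a hab).1 (h b a hab)
      rw [← neg_inj, neg_sub, neg_sub, this]
  · intro h a b hab
    exact (key a b hab).2 (h a b)

theorem isPBW_gen (hD : IsDiffusionAlgebra g x) : IsPBW (straightening g x) (gen g x) where
  rel := by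
    intro a b hab
    have h0 : (g a b : ℂ) ≠ 0 := by exact_mod_cast hD.1 a b hab
    have h := RingQuot.mkAlgHom_rel ℂ (DiffusionRel.rel (g := g) (x := x) a b hab)
    simp only [map_sub, map_smul, map_mul] at h
    rw [sub_eq_iff_eq_add] at h
    change gen g x a * gen g x b = (g b a / g a b : ℂ) • (gen g x b * gen g x a) +
      (x b / g a b) • gen g x a + (-x a / g a b) • gen g x b + (0 : ℂ) • 1
    change (g a b : ℂ) • (gen g x a * gen g x b) = x b • gen g x a - x a • gen g x b +
      (g b a : ℂ) • (gen g x b * gen g x a) at h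
    rw [← inv_smul_smul₀ h0 (gen g x a * gen g x b), h]
    match_scalars <;> field_simp
  linInd := hD.2.1
  span_eq := hD.2.2

/-- The conditions on the coefficients of straightening relations without constant term that result
from the two ways of reordering `y_a y_b y_c` for `a < b < c`. -/
theorem _root_.IsPBW.overlap {k : Type v} [Field k] {B : Type*} [Ring B] [Algebra k B]
    {Q : Straightening k N} {y : Fin N → B} (h : IsPBW Q y) (hQ : Q.const = 0) {a b c : Fin N}
    (hab : a < b) (hbc : b < c) :
    Q.swap a b * (Q.swap a c * Q.left b c + Q.left a c - Q.swap b c * Q.left a c - Q.left b c) = 0 ∧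
    Q.swap a c * (Q.swap a b * Q.right b c + Q.left a b - Q.swap b c * Q.left a b - Q.right b c) =
      0 ∧
    Q.swap b c * (Q.swap a b * Q.right a c + Q.right a b - Q.swap a c * Q.right a b - Q.right a c) =
      0 ∧
    Q.left a b * Q.left a c - Q.swap b c * Q.left a c * Q.left a b - Q.left b c * Q.left a b -
      Q.right b c * Q.left a c = 0 ∧
    Q.swap a b * Q.right a c * Q.left b c - Q.swap b c * Q.left a c * Q.right a b = 0 ∧
    Q.swap a b * Q.right a c * Q.right b c + Q.left a b * Q.right a c + Q.right a b * Q.right b c -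
      Q.right b c * Q.right a c = 0 := by
  have hac := hab.trans hbc
  have rab := h.rel a b hab
  have rac := h.rel a c hac
  have rbc := h.rel b c hbc
  simp only [hQ, Pi.zero_apply, zero_smul, add_zero] at rab rac rbc
  have hone : ∀ a : Fin N, ordMonomial y (Pi.single a 1) = y a := by
    intro a
    have := mul_ordMonomial y 0 a (by simp)
    rwa [ordMonomial_zero, mul_one, zero_add, eq_comm] at this
  have htwo : ∀ a b : Fin N, a < b → ordMonomial y (Pi.single a 1 + Pi.single b 1) = y b * y a := by
    intro a b hab
    rw [← mul_ordMonomial y (Pi.single a 1) b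
      (fun i hi => Pi.single_eq_of_ne (hab.trans hi).ne' 1), hone]
  let E : Fin 6 → Fin N → ℕ := ![Pi.single a 1 + Pi.single b 1, Pi.single a 1 + Pi.single c 1,
    Pi.single b 1 + Pi.single c 1, Pi.single a 1, Pi.single b 1, Pi.single c 1]
  have hE : Function.Injective E := by
    have hcomp : (fun e : Fin N → ℕ => (e a, e b, e c)) ∘ E =
        ![(1, 1, 0), (1, 0, 1), (0, 1, 1), (1, 0, 0), (0, 1, 0), (0, 0, 1)] := by
      funext i
      fin_cases i <;> simp [E, hab.ne, hab.ne', hbc.ne, hbc.ne', hac.ne, hac.ne']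
    refine Function.Injective.of_comp (f := fun e : Fin N → ℕ => (e a, e b, e c)) ?_
    rw [hcomp]
    decide
  -- the difference of the two reorderings, as a combination of distinct ordered monomials
  have hli := Fintype.linearIndependent_iff.1 (h.linInd.comp E hE)
    ![Q.swap a b * (Q.swap a c * Q.left b c + Q.left a c - Q.swap b c * Q.left a c - Q.left b c),
      Q.swap a c * (Q.swap a b * Q.right b c + Q.left a b - Q.swap b c * Q.left a b - Q.right b c),
      Q.swap b c *
        (Q.swap a b * Q.right a c + Q.right a b - Q.swap a c * Q.right a b - Q.right a c),
      Q.left a b * Q.left a c - Q.swap b c * Q.left a c * Q.left a b - Q.left b c * Q.left a b -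
        Q.right b c * Q.left a c,
      Q.swap a b * Q.right a c * Q.left b c - Q.swap b c * Q.left a c * Q.right a b,
      Q.swap a b * Q.right a c * Q.right b c + Q.left a b * Q.right a c +
        Q.right a b * Q.right b c - Q.right b c * Q.right a c] (by
    have h1 : y a * y b * y c = y a * (y b * y c) := mul_assoc _ _ _
    have h2 : y a * y b * y c = (Q.swap a b * Q.swap a c) •
        ((Q.swap b c • (y c * y b) + Q.left b c • y b + Q.right b c • y c) * y a) +
        (Q.swap a b * Q.left a c) • (y b * y a) + (Q.swap a b * Q.right a c) •
          (Q.swap b c • (y c * y b) + Q.left b c • y b + Q.right b c • y c) +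
        Q.left a b • (Q.swap a c • (y c * y a) + Q.left a c • y a + Q.right a c • y c) +
        Q.right a b • (Q.swap b c • (y c * y b) + Q.left b c • y b + Q.right b c • y c) := by
      rw [rab, add_mul, add_mul, smul_mul_assoc, smul_mul_assoc, smul_mul_assoc, mul_assoc, rac,
        ← rbc]
      simp only [mul_add, mul_smul_comm, ← mul_assoc]
      module
    have h3 : y a * (y b * y c) = (Q.swap b c * Q.swap a c) •
        (y c * (Q.swap a b • (y b * y a) + Q.left a b • y a + Q.right a b • y b)) +
        (Q.swap b c * Q.left a c) •
          (Q.swap a b • (y b * y a) + Q.left a b • y a + Q.right a b • y b) +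
        (Q.swap b c * Q.right a c) • (y c * y b) +
        Q.left b c • (Q.swap a b • (y b * y a) + Q.left a b • y a + Q.right a b • y b) +
        Q.right b c • (Q.swap a c • (y c * y a) + Q.left a c • y a + Q.right a c • y c) := by
      rw [rbc, mul_add, mul_add, mul_smul_comm, mul_smul_comm, mul_smul_comm, ← mul_assoc, rac,
        ← rab]
      simp only [add_mul, smul_mul_assoc, mul_assoc]
      module
    rw [h2, h3] at h1
    simp only [add_mul, mul_add, smul_mul_assoc, mul_smul_comm, mul_assoc] at h1
    simp only [Fin.sum_univ_succ, Function.comp_apply, E]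
    simp only [Fin.isValue, Matrix.cons_val_zero, Matrix.cons_val_succ, Finset.univ_eq_empty,
      Finset.sum_empty, htwo a b hab, htwo a c hac, htwo b c hbc, hone]
    linear_combination (norm := module) h1)
  exact ⟨hli 0, hli 1, hli 2, hli 3, hli 4, hli 5⟩

/-- The overlap conditions for the coefficients of a diffusion algebra, after cancellation of the
nonzero factors. -/
theorem overlap (h : IsPBW (straightening g x) D) (hg : ∀ a b, a < b → g a b ≠ 0) {a b c : Fin N}
    (hab : a < b) (hbc : b < c) :
    (x c ≠ 0 → g b a ≠ 0 → g a c - g c a = g b c - g c b) ∧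
    (x b ≠ 0 → g c a ≠ 0 → g b c - g c b = g b a - g a b) ∧
    (x a ≠ 0 → g c b ≠ 0 → g a b - g b a = g a c - g c a) ∧
    (x b ≠ 0 → x c ≠ 0 → g b c - g c b = g a c - g a b) ∧
    (x a ≠ 0 → x c ≠ 0 → g c b = g b a) ∧
    (x a ≠ 0 → x b ≠ 0 → g a c - g b c = g a b - g b a) := by
  have h1 : (g a b : ℂ) ≠ 0 := by exact_mod_cast hg a b hab
  have h2 : (g a c : ℂ) ≠ 0 := by exact_mod_cast hg a c (hab.trans hbc)
  have h3 : (g b c : ℂ) ≠ 0 := by exact_mod_cast hg b c hbc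
  obtain ⟨e1, e2, e3, e4, e5, e6⟩ := h.overlap rfl hab hbc
  simp only [straightening] at e1 e2 e3 e4 e5 e6
  field_simp at e1 e2 e3 e4 e5 e6
  rw [mul_zero] at e1 e2 e3 e4 e5 e6
  refine ⟨fun hx hx' => ?_, fun hx hx' => ?_, fun hx hx' => ?_, fun hx hx' => ?_, fun hx hx' => ?_,
    fun hx hx' => ?_⟩
  · have e := (mul_eq_zero.1 e1).resolve_left (mul_ne_zero (by exact_mod_cast hx') hx)
    norm_cast at e
    linarith
  · have e := (mul_eq_zero.1 e2).resolve_left (mul_ne_zero (by exact_mod_cast hx') hx)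
    norm_cast at e
    linarith
  · have e := (mul_eq_zero.1 e3).resolve_left (mul_ne_zero (by exact_mod_cast hx') hx)
    norm_cast at e
    linarith
  · have e := (mul_eq_zero.1 e4).resolve_left (mul_ne_zero hx' hx)
    norm_cast at e
    linarith
  · have e := (mul_eq_zero.1 e5).resolve_left (mul_ne_zero hx' hx)
    norm_cast at e
    linarith
  · have e := (mul_eq_zero.1 e6).resolve_left (mul_ne_zero hx' hx)
    norm_cast at e
    linarith

/-- Linked indices have the same difference with an index `c` with `x_c ≠ 0`. -/
theorem diff_eq_of_link (h : IsPBW (straightening g x) D) (hg : ∀ a b, a < b → g a b ≠ 0)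
    {a b c : Fin N} (hac : a ≠ c) (hbc : b ≠ c) (hc : x c ≠ 0) (hl : g a b * g b a ≠ 0) :
    g a c - g c a = g b c - g c b := by
  wlog hab : a < b generalizing a b
  · rcases eq_or_lt_of_le (not_lt.1 hab) with rfl | hab'
    · rfl
    · exact (this hbc hac (by rwa [mul_comm]) hab').symm
  have hl' := right_ne_zero_of_mul hl
  rcases lt_or_gt_of_ne hbc with hbc | hbc
  · exact (overlap h hg hab hbc).1 hc hl'
  · rcases lt_or_gt_of_ne hac with hac | hac
    · have := (overlap h hg hac hbc).2.1 hc hl'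
      linarith
    · have := (overlap h hg hac hab).2.2.1 hc hl'
      linarith

/-- A link from an index with `x ≠ 0` to `r` propagates to the other indices with `x ≠ 0`. -/
theorem coeff_eq_of_link (h : IsPBW (straightening g x) D) (hg : ∀ a b, a < b → g a b ≠ 0)
    {i j r : Fin N} (hi : x i ≠ 0) (hj : x j ≠ 0) (hij : i ≠ j) (hir : i ≠ r) (hjr : j ≠ r)
    (hl : g i r * g r i ≠ 0) :
    g r j = g i r ∧ g j r = g r i ∧ g i r - g r i = g i j - g j i := by
  have hlr := left_ne_zero_of_mul hl
  have hrl := right_ne_zero_of_mul hl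
  have h1 := diff_eq_of_link h hg hij hjr.symm hj hl
  -- it suffices to link `j` and `r`
  suffices h2 : g j r = g r i ∧ g r j ≠ 0 ∨ g r j = g i r ∧ g j r ≠ 0 by
    have hl' : g j r * g r j ≠ 0 := by
      rcases h2 with ⟨h2, h3⟩ | ⟨h2, h3⟩
      · exact mul_ne_zero (h2 ▸ hrl) h3
      · exact mul_ne_zero h3 (h2 ▸ hlr)
    have h3 := diff_eq_of_link h hg hij.symm hir.symm hi hl'
    rcases h2 with ⟨h2, -⟩ | ⟨h2, -⟩
    · exact ⟨by linarith, h2, by linarith⟩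
    · exact ⟨h2, by linarith, by linarith⟩
  rcases lt_or_gt_of_ne hij with hij | hij
  · rcases lt_or_gt_of_ne hjr with hjr | hjr
    · have := (overlap h hg hij hjr).2.2.2.2.2 hi hj
      exact Or.inr ⟨by linarith, hg j r hjr⟩
    · rcases lt_or_gt_of_ne hir with hir | hir
      · exact Or.inl ⟨(overlap h hg hir hjr).2.2.2.2.1 hi hj, hg r j hjr⟩
      · have := (overlap h hg hir hij).2.2.2.1 hi hj
        exact Or.inl ⟨by linarith, hg r j hjr⟩
  · rcases lt_or_gt_of_ne hir with hir | hir
    · have := (overlap h hg hij hir).2.2.2.2.2 hj hi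
      exact Or.inr ⟨by linarith, hg j r (hij.trans hir)⟩
    · rcases lt_or_gt_of_ne hjr with hjr | hjr
      · exact Or.inr ⟨((overlap h hg hjr hir).2.2.2.2.1 hj hi).symm, hg j r hjr⟩
      · have := (overlap h hg hjr hij).2.2.2.1 hj hi
        exact Or.inl ⟨by linarith, hg r j hjr⟩

/-- Three indices with `x ≠ 0`, in increasing order. -/
theorem coeff_of_lt (h : IsPBW (straightening g x) D) (hg : ∀ a b, a < b → g a b ≠ 0)
    {a b c : Fin N} (hab : a < b) (hbc : b < c) (ha : x a ≠ 0) (hb : x b ≠ 0) (hc : x c ≠ 0) :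
    (g b a = g a b ∧ g a c = g a b ∧ g c a = g a b ∧ g b c = g a b ∧ g c b = g a b) ∨
      (g b a = 0 ∧ g c a = 0 ∧ g c b = 0 ∧ g a c = g a b + g b c) := by
  obtain ⟨e1, e2, e3, e4, e5, -⟩ := overlap h hg hab hbc
  have e4 := e4 hb hc
  have e5 := e5 ha hc
  have hac := hg a c (hab.trans hbc)
  have hab' := hg a b hab
  by_cases h0 : g b a = 0
  · right
    by_cases hca : g c a = 0
    · exact ⟨h0, hca, by linarith, by linarith⟩
    · have := e2 hb hca
      exact absurd (by linarith : g a c = 0) hac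
  · left
    have e1 := e1 hc h0
    have e3 := e3 ha (e5.trans_ne h0)
    have hca : g c a ≠ 0 := fun hca => hab' (by linarith)
    have e2 := e2 hb hca
    exact ⟨by linarith, by linarith, by linarith, by linarith, by linarith⟩

/-- Three distinct indices with `x ≠ 0` are pairwise linked or pairwise not linked. -/
theorem coeff_trichotomy (h : IsPBW (straightening g x) D) (hg : ∀ a b, a < b → g a b ≠ 0)
    {a b c : Fin N} (hab : a ≠ b) (hbc : b ≠ c) (hac : a ≠ c) (ha : x a ≠ 0) (hb : x b ≠ 0)
    (hc : x c ≠ 0) :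
    (g b a = g a b ∧ g a c = g a b ∧ g c a = g a b ∧ g b c = g a b ∧ g c b = g a b) ∨
      (g a b * g b a = 0 ∧ g a c * g c a = 0 ∧ g b c * g c b = 0) := by
  have key := @coeff_of_lt _ g x A _ _ D h hg
  rcases lt_or_gt_of_ne hab with hab | hab <;> rcases lt_or_gt_of_ne hbc with hbc | hbc <;>
    rcases lt_or_gt_of_ne hac with hac | hac
  · rcases key hab hbc ha hb hc with ⟨h1, h2, h3, h4, h5⟩ | ⟨h1, h2, h3, -⟩
    · simp [*]
    · simp [*]
  · exact absurd (hab.trans hbc) hac.asymm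
  · rcases key hac hbc ha hc hb with ⟨h1, h2, h3, h4, h5⟩ | ⟨h1, h2, h3, -⟩
    · simp [*]
    · simp [*]
  · rcases key hac hab hc ha hb with ⟨h1, h2, h3, h4, h5⟩ | ⟨h1, h2, h3, -⟩
    · simp [*]
    · simp [*]
  · rcases key hab hac hb ha hc with ⟨h1, h2, h3, h4, h5⟩ | ⟨h1, h2, h3, -⟩
    · simp [*]
    · simp [*]
  · rcases key hbc hac hb hc ha with ⟨h1, h2, h3, h4, h5⟩ | ⟨h1, h2, h3, -⟩
    · simp [*]
    · simp [*]
  · exact absurd (hbc.trans hab) hac.asymm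
  · rcases key hbc hab hc hb ha with ⟨h1, h2, h3, h4, h5⟩ | ⟨h1, h2, h3, -⟩
    · simp [*]
    · simp [*]

end DiffusionAlgebra

/-! ### Change of generators -/

theorem generatorSpan_le {k : Type v} [Field k] {N : ℕ} {B : Type*} [Ring B] [Algebra k B]
    {y : Fin N → B} {W : Submodule k B} (h1 : 1 ∈ W) (hy : ∀ a, y a ∈ W) :
    generatorSpan k y ≤ W := by
  rw [generatorSpan, Submodule.span_le, Set.insert_subset_iff]
  exact ⟨h1, by rintro _ ⟨a, rfl⟩; exact hy a⟩

/-- An algebra which is of Ore type with respect to new generators `E` and `z_k` for `k ≠ i`, where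
`E` replaces `D_i` and the values `z_i`, `p_i`, `w_i`, `q_{ik}`, `q_{ki}` are irrelevant. -/
theorem OreType.exists_calculus_of_isPBW {n : ℕ} {A : Type u} [Ring A] [Algebra ℂ A]
    {Q : Straightening ℂ (n + 1)} {D : Fin (n + 1) → A} (h : IsPBW Q D) (i : Fin (n + 1)) {E : A}
    {z : Fin (n + 1) → A} {p : Fin (n + 1) → ℝ} {w : Fin (n + 1) → ℂ}
    {q : Fin (n + 1) → Fin (n + 1) → ℂ}
    (hEz : ∀ k, k ≠ i → E * z k = (p k : ℂ) • (z k * E) - w k • z k)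
    (hzz : ∀ k l, k ≠ i → l ≠ i → k < l → z k * z l = q k l • (z l * z k))
    (hE : E ∈ generatorSpan ℂ D) (hz : ∀ k, k ≠ i → z k ∈ generatorSpan ℂ D)
    (hD : ∀ W : Submodule ℂ A, 1 ∈ W → E ∈ W → (∀ k, k ≠ i → z k ∈ W) → ∀ k, D k ∈ W)
    (hp : ∀ k, k ≠ i → p k ≠ 0)
    (hpq : ∀ k l, k ≠ i → l ≠ i → k < l → q k l ≠ 0 → p k = p l)
    (hcase : (∀ k, k ≠ i → p k = 1) ∨ ∀ k l, k ≠ i → l ≠ i → w k = w l) :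
    ∃ C : DifferentialCalculus ℂ A, C.HasDimension (n + 1) ∧ C.IsConnected ∧
      C.IsIntegrable (n + 1) := by
  have hne := i.succAbove_ne
  have hlt : ∀ {k l : Fin n}, k < l → i.succAbove k < i.succAbove l := fun hkl =>
    i.strictMono_succAbove hkl
  refine OreType.exists_calculus (y := Fin.cons E fun k => z (i.succAbove k))
    (p := fun k => p (i.succAbove k)) (w := fun k => w (i.succAbove k))
    (q := fun k l => q (i.succAbove k) (i.succAbove l))
    (h.of_generatorSpan_eq (OreType.holds_iff.2 ⟨fun k => ?_, fun k l hkl => ?_⟩)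
      (le_antisymm (generatorSpan_le one_mem_generatorSpan ?_)
        (generatorSpan_le one_mem_generatorSpan (hD _ one_mem_generatorSpan ?_ fun k hk => ?_))))
    (fun k => hp _ (hne k)) (fun k l hkl => hpq _ _ (hne k) (hne l) (hlt hkl))
    (hcase.imp (fun hc k => hc _ (hne k)) fun hc k l => hc _ _ (hne k) (hne l))
  · simpa using hEz _ (hne k)
  · simpa using hzz _ _ (hne k) (hne l) (hlt hkl)
  · exact Fin.cases hE fun k => hz _ (hne k)
  · exact mem_generatorSpan (k := ℂ) (y := Fin.cons E fun k => z (i.succAbove k)) 0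
  · obtain ⟨k, rfl⟩ := Fin.exists_succAbove_eq hk
    exact mem_generatorSpan (k := ℂ) (y := Fin.cons E fun k => z (i.succAbove k)) k.succ

namespace DiffusionAlgebra

variable {N : ℕ} {g : Fin N → Fin N → ℝ} {x : Fin N → ℂ} {A : Type u} [Ring A] [Algebra ℂ A]
  {D : Fin N → A}

/-- The rescaled generator `D_a / x_a`, for `x_a ≠ 0`. -/
def scaled (x : Fin N → ℂ) (D : Fin N → A) (a : Fin N) : A := (x a)⁻¹ • D a

theorem smul_scaled {a : Fin N} (ha : x a ≠ 0) : x a • scaled x D a = D a := smul_inv_smul₀ ha _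

theorem scaled_rel (h : IsPBW (straightening g x) D) (hg : ∀ a b, a < b → g a b ≠ 0) {a b : Fin N}
    (ha : x a ≠ 0) (hb : x b ≠ 0) : (g a b : ℂ) • (scaled x D a * scaled x D b) -
      (g b a : ℂ) • (scaled x D b * scaled x D a) = scaled x D a - scaled x D b := by
  have h1 := congrArg (fun v => ((x a)⁻¹ * (x b)⁻¹) • v) ((holds_iff hg).1 h.rel a b)
  simp only [scaled, smul_mul_smul_comm]
  linear_combination (norm := skip) h1
  match_scalars <;> field_simp <;> ring

theorem scaled_mul_rel (h : IsPBW (straightening g x) D) (hg : ∀ a b, a < b → g a b ≠ 0)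
    {a s : Fin N} (ha : x a ≠ 0) (hs : x s = 0) :
    (g a s : ℂ) • (scaled x D a * D s) - (g s a : ℂ) • (D s * scaled x D a) = -D s := by
  have h1 := congrArg (fun v => (x a)⁻¹ • v) ((holds_iff hg).1 h.rel a s)
  simp only [hs, zero_smul, zero_sub] at h1
  simp only [scaled, smul_mul_assoc, mul_smul_comm]
  linear_combination (norm := skip) h1
  match_scalars <;> field_simp <;> ring

theorem mul_rel (h : IsPBW (straightening g x) D) {s t : Fin N} (hst : s < t)
    (hs : x s = 0) (ht : x t = 0) : D s * D t = (g t s / g s t : ℂ) • (D t * D s) := by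
  simpa [straightening, hs, ht] using h.rel s t hst

theorem scaled_mem_generatorSpan (a : Fin N) : scaled x D a ∈ generatorSpan ℂ D :=
  Submodule.smul_mem _ _ (mem_generatorSpan a)

/-! ### The indices with nonzero parameter -/

/-- With at least three indices with `x ≠ 0`, either all coefficients between them agree, or
`g_{ba} = 0` for `a < b` and the `g_{ab}` are additive. -/
theorem coeff_const_or_additive (h : IsPBW (straightening g x) D)
    (hg : ∀ a b, a < b → g a b ≠ 0) (hI : 3 ≤ (diffI x).ncard) :
    (∃ G : ℝ, G ≠ 0 ∧ ∀ a b, x a ≠ 0 → x b ≠ 0 → a ≠ b → g a b = G) ∨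
      (∀ a b, x a ≠ 0 → x b ≠ 0 → a < b → g b a = 0) ∧
        ∀ a b c, x a ≠ 0 → x b ≠ 0 → x c ≠ 0 → a < b → b < c → g a c = g a b + g b c := by
  by_cases hex : ∃ a b, x a ≠ 0 ∧ x b ≠ 0 ∧ a ≠ b ∧ g a b * g b a ≠ 0
  · left
    obtain ⟨a, b, ha, hb, hab, hl⟩ := hex
    have key : ∀ c, x c ≠ 0 → a ≠ c → b ≠ c → g b a = g a b ∧ g a c = g a b ∧ g c a = g a b ∧
        g b c = g a b ∧ g c b = g a b := fun c hc hac hbc =>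
      (coeff_trichotomy h hg hab hbc hac ha hb hc).resolve_right fun h' => hl h'.1
    have hG := left_ne_zero_of_mul hl
    have hba : g b a = g a b := by
      obtain ⟨c, hc, hcab⟩ := Set.exists_mem_notMem_of_ncard_lt_ncard
        (s := {a, b}) (t := diffI x) (by rw [Set.ncard_pair hab]; omega)
      simp only [Set.mem_insert_iff, Set.mem_singleton_iff, not_or] at hcab
      exact (key c hc (Ne.symm hcab.1) (Ne.symm hcab.2)).1
    refine ⟨g a b, hG, fun u v hu hv huv => ?_⟩
    -- `a` has the common coefficient with every other index
    have ha' : ∀ c, x c ≠ 0 → a ≠ c → g a c = g a b ∧ g c a = g a b := by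
      intro c hc hac
      by_cases hbc : b = c
      · subst hbc
        exact ⟨rfl, hba⟩
      · exact ⟨(key c hc hac hbc).2.1, (key c hc hac hbc).2.2.1⟩
    by_cases hua : a = u
    · subst hua
      exact (ha' v hv huv).1
    by_cases hva : a = v
    · subst hva
      exact (ha' u hu hua).2
    have h1 := ha' u hu hua
    rcases coeff_trichotomy h hg hua huv hva ha hu hv with h2 | h2
    · rw [h2.2.2.2.1, h1.1]
    · rw [h1.1, h1.2] at h2
      exact absurd h2.1 (mul_ne_zero hG hG)
  · right
    have hzero : ∀ a b, x a ≠ 0 → x b ≠ 0 → a < b → g b a = 0 := by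
      intro a b ha hb hab
      by_contra h0
      exact hex ⟨a, b, ha, hb, hab.ne, mul_ne_zero (hg a b hab) h0⟩
    refine ⟨hzero, fun a b c ha hb hc hab hbc => ?_⟩
    rcases coeff_of_lt h hg hab hbc ha hb hc with h1 | h1
    · exact absurd (h1.1.symm.trans (hzero a b ha hb hab)) (hg a b hab)
    · exact h1.2.2.2

/-- If some index with `x_r = 0` is linked to one of at least three indices with `x ≠ 0`, then
those indices are linked among themselves. -/
theorem coeff_eq_of_link_of_three (h : IsPBW (straightening g x) D)
    (hg : ∀ a b, a < b → g a b ≠ 0) {i j k r : Fin N} (hi : x i ≠ 0) (hj : x j ≠ 0) (hk : x k ≠ 0)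
    (hij : i ≠ j) (hik : i ≠ k) (hjk : j ≠ k) (hr : x r = 0) (hl : g i r * g r i ≠ 0) :
    g i j = g j i := by
  have hne : ∀ {a}, x a ≠ 0 → a ≠ r := fun ha har => ha (har ▸ hr)
  have h1 := coeff_eq_of_link h hg hi hj hij (hne hi) (hne hj) hl
  have h2 := coeff_eq_of_link h hg hi hk hik (hne hi) (hne hk) hl
  have hlj : g j r * g r j ≠ 0 := by rwa [h1.1, h1.2.1, mul_comm]
  have h3 := coeff_eq_of_link h hg hj hk hjk (hne hj) (hne hk) hlj
  have hlk : g k r * g r k ≠ 0 := by rwa [h2.1, h2.2.1, mul_comm]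
  have h4 := coeff_eq_of_link h hg hk hj hjk.symm (hne hk) (hne hj) hlk
  linarith

/-- If `g_{ba} = 0` for `a < b` and the `g_{ab}` are additive, the algebra is of nilpotent type with
generators `D_a / x_a`. -/
theorem exists_calculus_of_additive
    (h : IsPBW (straightening g x) D) (hg : ∀ a b, a < b → g a b ≠ 0) (hN : 1 ≤ N)
    (hx : ∀ a, x a ≠ 0) (hzero : ∀ a b, a < b → g b a = 0)
    (hadd : ∀ a b c, a < b → b < c → g a c = g a b + g b c) :
    ∃ C : DifferentialCalculus ℂ A, C.HasDimension N ∧ C.IsConnected ∧ C.IsIntegrable N := by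
  obtain ⟨n, rfl⟩ := Nat.exists_eq_add_of_le' hN
  -- the potential of the additive coefficients, normalised to vanish at the first index
  let c : Fin (n + 1) → ℝ := fun a => if a = 0 then 0 else -g 0 a
  have hc : ∀ a b, a < b → g a b = c a - c b := by
    intro a b hab
    have hb : b ≠ 0 := (lt_of_le_of_lt (Fin.zero_le a) hab).ne'
    by_cases ha : a = 0
    · simp [c, ha, hb]
    · have := hadd 0 a b (Fin.pos_iff_ne_zero.2 ha) hab
      simp only [c, if_neg ha, if_neg hb]
      linarith
  refine NilpotentType.exists_calculus (c := fun a => (c a : ℂ)) (y := scaled x D) ?_ (by simp [c])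
    (h.of_generatorSpan_eq (NilpotentType.holds_iff.2 fun a b hab => ?_) (le_antisymm
      (generatorSpan_le one_mem_generatorSpan scaled_mem_generatorSpan)
      (generatorSpan_le one_mem_generatorSpan fun a => ?_)))
  · intro a b hab
    have hab' : c a = c b := Complex.ofReal_injective hab
    by_contra hne
    rcases lt_or_gt_of_ne hne with hlt | hlt
    · exact hg a b hlt (by rw [hc a b hlt, hab', sub_self])
    · exact hg b a hlt (by rw [hc b a hlt, hab', sub_self])
  · have h1 := scaled_rel h hg (hx a) (hx b)
    have h0 : (g a b : ℂ) ≠ 0 := by exact_mod_cast hg a b hab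
    rw [hzero a b hab, Complex.ofReal_zero, zero_smul, sub_zero] at h1
    rw [← Complex.ofReal_sub, ← hc a b hab, ← h1, inv_smul_smul₀ h0]
  · rw [← smul_scaled (D := D) (hx a)]
    exact Submodule.smul_mem _ _ (mem_generatorSpan a)

/-- If all coefficients between the indices with `x ≠ 0` agree, the algebra is of Ore type with
`y_0 = D_i / x_i` for some `x_i ≠ 0`; the `z_k` are the differences `D_i / x_i - D_k / x_k` for
`x_k ≠ 0`, and the remaining `D_k`.  All `p_k` are `1`. -/
theorem exists_calculus_of_const
    (h : IsPBW (straightening g x) D) (hg : ∀ a b, a < b → g a b ≠ 0) {i j : Fin N} (hij : i ≠ j)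
    (hi : x i ≠ 0) (hj : x j ≠ 0) {G : ℝ} (hG : G ≠ 0)
    (hI : ∀ a b, x a ≠ 0 → x b ≠ 0 → a ≠ b → g a b = G) (hS : diffS g x = diffR x) :
    ∃ C : DifferentialCalculus ℂ A, C.HasDimension N ∧ C.IsConnected ∧ C.IsIntegrable N := by
  have hne : ∀ {a s}, x a ≠ 0 → x s = 0 → a ≠ s := fun ha hs has => ha (has ▸ hs)
  -- the equality `g a s = g s a` spreads along the chain of links that joins `s` to `b`
  have hsymm : ∀ s, x s = 0 → ∀ a, x a ≠ 0 → g a s = g s a := by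
    intro s hs
    have hsS : s ∈ diffS g x := by
      rw [hS]
      exact hs
    obtain ⟨-, r, hr, hsr, b, hb, hl⟩ := hsS
    refine Relation.ReflTransGen.head_induction_on
      (motive := fun s _ => ∀ a, x a ≠ 0 → g a s = g s a) hsr ?_ ?_
    · -- `r` is linked to `b`, and there is another index `b'` with `x ≠ 0`
      obtain ⟨b', hb', hbb'⟩ : ∃ b', x b' ≠ 0 ∧ b ≠ b' := by
        by_cases hbi : b = i
        · exact ⟨j, hj, hbi ▸ hij⟩
        · exact ⟨i, hi, hbi⟩
      have h1 := (coeff_eq_of_link h hg hb hb' hbb' (hne hb hr) (hne hb' hr) hl).2.2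
      rw [hI b b' hb hb' hbb', hI b' b hb' hb hbb'.symm, sub_self, sub_eq_zero] at h1
      intro a ha
      by_cases hba : b = a
      · exact hba ▸ h1
      · have h2 := coeff_eq_of_link h hg hb ha hba (hne hb hr) (hne ha hr) hl
        rw [h2.1, h2.2.1, h1]
    · intro s t hst _ ih a ha
      have := diff_eq_of_link h hg (hne ha hst.1).symm (hne ha hst.2.1).symm ha hst.2.2
      have := ih a ha
      linarith
  have hnz : ∀ s, x s = 0 → ∀ a, x a ≠ 0 → g a s ≠ 0 := by
    intro s hs a ha h0
    rcases lt_or_gt_of_ne (hne ha hs) with hlt | hlt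
    · exact hg a s hlt h0
    · exact hg s a hlt ((hsymm s hs a ha).symm.trans h0)
  have hconst : ∀ s, x s = 0 → ∀ a, x a ≠ 0 → g a s = g i s := by
    intro s hs a ha
    by_cases hia : i = a
    · rw [hia]
    · have hl : g i s * g s i ≠ 0 :=
        mul_ne_zero (hnz s hs i hi) (hsymm s hs i hi ▸ hnz s hs i hi)
      have := (coeff_eq_of_link h hg hi ha hia (hne hi hs) (hne ha hs) hl).2.1
      rw [this, hsymm s hs i hi]
  have hGc : (G : ℂ) ≠ 0 := by exact_mod_cast hG
  have hEE : ∀ a b, x a ≠ 0 → x b ≠ 0 → scaled x D a * scaled x D b - scaled x D b * scaled x D a =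
      (G : ℂ)⁻¹ • (scaled x D a - scaled x D b) := by
    intro a b ha hb
    by_cases hab : a = b
    · simp [hab]
    · have h1 := scaled_rel h hg ha hb
      rw [hI a b ha hb hab, hI b a hb ha (Ne.symm hab), ← smul_sub] at h1
      rw [← h1, inv_smul_smul₀ hGc]
  have hED : ∀ a s, x a ≠ 0 → x s = 0 →
      scaled x D a * D s = D s * scaled x D a - (g i s : ℂ)⁻¹ • D s := by
    intro a s ha hs
    have h0 : (g i s : ℂ) ≠ 0 := by exact_mod_cast hnz s hs i hi
    have h1 := scaled_mul_rel h hg ha hs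
    rw [← hsymm s hs a ha, hconst s hs a ha, ← smul_sub] at h1
    have h2 := congrArg (fun v => (g i s : ℂ)⁻¹ • v) h1
    simp only [inv_smul_smul₀ h0] at h2
    linear_combination (norm := module) h2
  obtain ⟨n, rfl⟩ : ∃ n, N = n + 1 := Nat.exists_eq_succ_of_ne_zero fun h0 => by
    subst h0
    exact i.elim0
  refine OreType.exists_calculus_of_isPBW h i (E := scaled x D i)
    (z := fun k => if x k = 0 then D k else scaled x D i - scaled x D k) (p := fun _ => 1)
    (w := fun k => if x k = 0 then (g i k : ℂ)⁻¹ else (G : ℂ)⁻¹)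
    (q := fun k l => if x k = 0 ∧ x l = 0 then (g l k / g k l : ℂ) else 1)
    (fun k hk => ?_) (fun k l hk hl hkl => ?_) (scaled_mem_generatorSpan i) (fun k hk => ?_)
    (fun W h1 hE hz k => ?_) (fun _ _ => one_ne_zero) (fun _ _ _ _ _ _ => rfl)
    (Or.inl fun _ _ => rfl)
  · by_cases hxk : x k = 0
    · simp only [if_pos hxk, Complex.ofReal_one, one_smul]
      exact hED i k hi hxk
    · have h1 := hEE i k hi hxk
      simp only [if_neg hxk, Complex.ofReal_one, one_smul, mul_sub, sub_mul]
      linear_combination (norm := module) -h1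
  · by_cases hxk : x k = 0
    · by_cases hxl : x l = 0
      · simp only [if_pos hxk, if_pos hxl, if_pos (show x k = 0 ∧ x l = 0 from ⟨hxk, hxl⟩)]
        exact mul_rel h hkl hxk hxl
      · have h1 := hED i k hi hxk
        have h2 := hED l k hxl hxk
        simp only [if_pos hxk, hxl, and_false, if_false, one_smul, mul_sub, sub_mul]
        linear_combination (norm := module) h2 - h1
    · by_cases hxl : x l = 0
      · have h1 := hED i l hi hxl
        have h2 := hED k l hxk hxl
        simp only [if_pos hxl, hxk, false_and, if_false, one_smul, mul_sub, sub_mul]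
        linear_combination (norm := module) h1 - h2
      · have h1 := hEE i l hi hxl
        have h2 := hEE k i hxk hi
        have h3 := hEE k l hxk hxl
        simp only [if_neg hxl, hxk, false_and, if_false, one_smul, mul_sub, sub_mul]
        linear_combination (norm := module) h3 - h1 - h2
  · split_ifs
    · exact mem_generatorSpan k
    · exact Submodule.sub_mem _ (scaled_mem_generatorSpan i) (scaled_mem_generatorSpan k)
  · by_cases hki : k = i
    · subst hki
      rw [← smul_scaled (D := D) hi]
      exact W.smul_mem _ hE
    · have h2 := hz k hki
      split_ifs at h2 with hxk
      · exact h2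
      · rw [← smul_scaled (D := D) hxk]
        refine W.smul_mem _ ?_
        have := W.sub_mem hE h2
        rwa [sub_sub_cancel] at this

/-! ### One or two indices with nonzero parameter, or none -/

/-- With a single index `i` with `x_i ≠ 0`, the algebra is of Ore type with `y_0 = D_i / x_i`; all
`w_k` are `G⁻¹`. -/
theorem exists_calculus_of_single
    (h : IsPBW (straightening g x) D) (hg : ∀ a b, a < b → g a b ≠ 0) {i : Fin N} (hi : x i ≠ 0)
    (hx : ∀ s, s ≠ i → x s = 0) {G : ℝ} (hG : G ≠ 0)
    (hs : ∀ s, s ≠ i → g i s = G ∧ g s i ≠ 0) :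
    ∃ C : DifferentialCalculus ℂ A, C.HasDimension N ∧ C.IsConnected ∧ C.IsIntegrable N := by
  have hGc : (G : ℂ) ≠ 0 := by exact_mod_cast hG
  obtain ⟨n, rfl⟩ : ∃ n, N = n + 1 := Nat.exists_eq_succ_of_ne_zero fun h0 => by
    subst h0
    exact i.elim0
  refine OreType.exists_calculus_of_isPBW h i (E := scaled x D i) (z := D)
    (p := fun k => g k i / G) (w := fun _ => (G : ℂ)⁻¹) (q := fun k l => (g l k / g k l : ℂ))
    (fun k hk => ?_) (fun k l hk hl hkl => mul_rel h hkl (hx k hk) (hx l hl))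
    (scaled_mem_generatorSpan i) (fun k _ => mem_generatorSpan k) (fun W _ hE hz k => ?_)
    (fun k hk => div_ne_zero (hs k hk).2 hG) (fun k l hk hl hkl hq => ?_)
    (Or.inr fun _ _ _ _ => rfl)
  · have h1 := congrArg (fun v => (G : ℂ)⁻¹ • v) (scaled_mul_rel h hg hi (hx k hk))
    simp only [(hs k hk).1, smul_sub, inv_smul_smul₀ hGc] at h1
    push_cast
    linear_combination (norm := module) h1
  · by_cases hki : k = i
    · rw [hki, ← smul_scaled (D := D) hi]
      exact W.smul_mem _ hE
    · exact hz k hki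
  · have hlk : g l k ≠ 0 := fun h0 => hq (by simp [h0])
    have h1 := diff_eq_of_link h hg hk hl hi (mul_ne_zero (hg k l hkl) hlk)
    rw [(hs k hk).1, (hs l hl).1, sub_left_inj] at h1
    rw [h1]

/-- With two indices `i < j` with `x ≠ 0` and `L = g_{ij} - g_{ji} ≠ 0`, the algebra is of Weyl type
with generators `D_i / x_i + L⁻¹`, `D_j / x_j - L⁻¹` and the remaining `D_k`: the translations
remove the linear terms of the relations. -/
theorem exists_calculus_of_pair
    (h : IsPBW (straightening g x) D) (hg : ∀ a b, a < b → g a b ≠ 0) {i j : Fin N} (hij : i < j)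
    (hi : x i ≠ 0) (hj : x j ≠ 0) (hx : ∀ s, s ≠ i → s ≠ j → x s = 0) {G L : ℝ} (hG : G ≠ 0)
    (hL : L ≠ 0) (hGL : G ≠ L) (hgL : g i j - g j i = L)
    (hs : ∀ s, s ≠ i → s ≠ j → g i s = G ∧ g s j = G ∧ g s i = G - L ∧ g j s = G - L) :
    ∃ C : DifferentialCalculus ℂ A, C.HasDimension N ∧ C.IsConnected ∧ C.IsIntegrable N := by
  obtain ⟨n, rfl⟩ : ∃ n, N = n + 2 := Nat.exists_eq_add_of_le' (by omega)
  obtain ⟨j, rfl⟩ := Fin.exists_succAbove_eq hij.ne'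
  have hGc : (G : ℂ) ≠ 0 := by exact_mod_cast hG
  have hLc : (L : ℂ) ≠ 0 := by exact_mod_cast hL
  have hGLc : (G - L : ℂ) ≠ 0 := by exact_mod_cast sub_ne_zero.2 hGL
  have hgc : (g i (i.succAbove j) : ℂ) ≠ 0 := by exact_mod_cast hg _ _ hij
  let c : Fin n → Fin (n + 2) := fun k => i.succAbove (j.succAbove k)
  have hci : ∀ k, c k ≠ i := fun k => i.succAbove_ne _
  have hcj : ∀ k, c k ≠ i.succAbove j := fun k h' =>
    j.succAbove_ne k (Fin.succAbove_right_injective h')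
  have hxc : ∀ k, x (c k) = 0 := fun k => hx _ (hci k) (hcj k)
  let Fi : A := scaled x D i + (L : ℂ)⁻¹ • 1
  let Fj : A := scaled x D (i.succAbove j) - (L : ℂ)⁻¹ • 1
  have hsmem : ∀ a, scaled x D a ∈ generatorSpan ℂ D := fun a => scaled_mem_generatorSpan a
  have hone : (L : ℂ)⁻¹ • (1 : A) ∈ generatorSpan ℂ D :=
    Submodule.smul_mem _ _ one_mem_generatorSpan
  refine WeylType.exists_calculus (y := Fin.cons Fi (Fin.cons Fj fun k => D (c k)))
    (q := g (i.succAbove j) i / g i (i.succAbove j))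
    (κ := ((L : ℂ) * g i (i.succAbove j))⁻¹) (p := (G - L) / G)
    (r := fun k l => (g (c l) (c k) / g (c k) (c l) : ℂ))
    (h.of_generatorSpan_eq (WeylType.holds_iff.2 ⟨?_, fun k => ?_, fun k => ?_, fun k l hkl => ?_⟩)
      (le_antisymm (generatorSpan_le one_mem_generatorSpan (WeylType.forall_fin ?_ ?_ fun k => ?_))
        (generatorSpan_le one_mem_generatorSpan fun a => ?_)))
    (inv_ne_zero (mul_ne_zero hLc hgc)) (fun hq => ?_) (div_ne_zero (sub_ne_zero.2 hGL) hG)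
  · have h1 := congrArg (fun v => (g i (i.succAbove j) : ℂ)⁻¹ • v) (scaled_rel h hg hi hj)
    have h2 : (g (i.succAbove j) i : ℂ) = g i (i.succAbove j) - L := by
      rw [← hgL]
      push_cast
      ring
    simp only [h2, smul_sub, inv_smul_smul₀ hgc] at h1
    simp only [Fin.cons_zero, Fin.cons_one, Fi, Fj, add_mul, sub_mul, mul_add, mul_sub,
      smul_mul_assoc, mul_smul_comm, one_mul, mul_one]
    push_cast
    rw [h2]
    linear_combination (norm := skip) h1
    match_scalars <;> field_simp <;> ring
  · have h1 := congrArg (fun v => (G : ℂ)⁻¹ • v) (scaled_mul_rel h hg hi (hxc k))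
    obtain ⟨h2, -, h3, -⟩ := hs (c k) (hci k) (hcj k)
    simp only [h2, h3, smul_sub, inv_smul_smul₀ hGc] at h1
    simp only [Fin.cons_zero, Fin.cons_succ, Fi, add_mul, mul_add, smul_mul_assoc, mul_smul_comm,
      one_mul, mul_one]
    push_cast at h1 ⊢
    linear_combination (norm := skip) h1
    match_scalars <;> field_simp <;> ring
  · have h1 := congrArg (fun v => (G - L : ℂ)⁻¹ • v) (scaled_mul_rel h hg hj (hxc k))
    obtain ⟨-, h2, -, h3⟩ := hs (c k) (hci k) (hcj k)
    rw [h2, h3, Complex.ofReal_sub] at h1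
    simp only [smul_sub, inv_smul_smul₀ hGLc] at h1
    simp only [Fin.cons_one, Fin.cons_zero, Fin.cons_succ, Fj, sub_mul, mul_sub, smul_mul_assoc,
      mul_smul_comm, one_mul, mul_one]
    push_cast at h1 ⊢
    linear_combination (norm := skip) h1
    match_scalars <;> field_simp <;> ring
  · simpa using mul_rel h (i.strictMono_succAbove (j.strictMono_succAbove hkl)) (hxc k) (hxc l)
  · exact Submodule.add_mem _ (hsmem i) hone
  · exact Submodule.sub_mem _ (hsmem _) hone
  · exact mem_generatorSpan (c k)
  · set W := generatorSpan ℂ (Fin.cons Fi (Fin.cons Fj fun k => D (c k)) : Fin (n + 2) → A)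
    have hW1 : (L : ℂ)⁻¹ • (1 : A) ∈ W := W.smul_mem _ one_mem_generatorSpan
    have hWi : Fi ∈ W := mem_generatorSpan
      (y := (Fin.cons Fi (Fin.cons Fj fun k => D (c k)) : Fin (n + 2) → A)) 0
    have hWj : Fj ∈ W := mem_generatorSpan
      (y := (Fin.cons Fi (Fin.cons Fj fun k => D (c k)) : Fin (n + 2) → A)) 1
    by_cases hai : a = i
    · rw [hai, ← smul_scaled (D := D) hi]
      refine W.smul_mem _ ?_
      have := W.sub_mem hWi hW1
      rwa [add_sub_cancel_right] at this
    obtain ⟨a, rfl⟩ := Fin.exists_succAbove_eq hai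
    by_cases haj : a = j
    · rw [haj, ← smul_scaled (D := D) hj]
      refine W.smul_mem _ ?_
      have := W.add_mem hWj hW1
      rwa [sub_add_cancel] at this
    obtain ⟨k, rfl⟩ := Fin.exists_succAbove_eq haj
    exact mem_generatorSpan
      (y := (Fin.cons Fi (Fin.cons Fj fun k => D (c k)) : Fin (n + 2) → A)) k.succ.succ
  · rw [div_eq_one_iff_eq (hg _ _ hij)] at hq
    exact hL (by rw [← hgL, hq, sub_self])

/-- With two indices `i`, `j` with nonzero parameter, every index linked to them, possibly through
other indices, has the same coefficients with `i` and with `j`. -/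
theorem coeff_eq_of_mem_diffS (h : IsPBW (straightening g x) D) (hg : ∀ a b, a < b → g a b ≠ 0)
    {i j : Fin N} (hij : i ≠ j) (hi : x i ≠ 0) (hj : x j ≠ 0) (hI : diffI x = {i, j})
    {G : ℝ} (hG : G ≠ 0) (hGL : G ≠ g i j - g j i) (hs : ∀ s ∈ diffS g x, g i s = G) {s : Fin N}
    (hsS : s ∈ diffS g x) : g s j = G ∧ g s i = G - (g i j - g j i) ∧
      g j s = G - (g i j - g j i) := by
  have hne : ∀ {a s}, x a ≠ 0 → x s = 0 → a ≠ s := fun ha hs has => ha (has ▸ hs)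
  have hx := hsS.1
  have hdiff : g i s - g s i = g i j - g j i := by
    obtain ⟨-, r, hr, hsr, b, hb, hl⟩ := hsS
    refine Relation.ReflTransGen.head_induction_on
      (motive := fun s _ => g i s - g s i = g i j - g j i) hsr ?_ ?_
    · have hb' : b = i ∨ b = j := by
        rw [hI] at hb
        exact hb
      rcases hb' with rfl | rfl
      · exact (coeff_eq_of_link h hg hi hj hij (hne hi hr) (hne hj hr) hl).2.2
      · obtain ⟨h1, h2, h3⟩ := coeff_eq_of_link h hg hj hi hij.symm (hne hj hr) (hne hi hr) hl
        linarith
    · intro s t hst _ ih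
      have := diff_eq_of_link h hg (hne hi hst.1).symm (hne hi hst.2.1).symm hi hst.2.2
      linarith
  have h1 : g i s = G := hs s hsS
  have h2 : g s i = G - (g i j - g j i) := by linarith
  have hl : g i s * g s i ≠ 0 := by
    rw [h1, h2]
    exact mul_ne_zero hG (sub_ne_zero.2 hGL)
  obtain ⟨h3, h4, -⟩ := coeff_eq_of_link h hg hi hj hij (hne hi hx) (hne hj hx) hl
  exact ⟨h3.trans h1, h2, h4.trans h2⟩

/-- If all parameters vanish, the algebra is a quantum affine space. -/
theorem exists_calculus_of_eq_zero (h : IsPBW (straightening g x) D)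
    (hN : 1 ≤ N) (hx : ∀ a, x a = 0) (hg : ∀ a b, a < b → g a b ≠ 0)
    (hg' : ∀ a b, a < b → g b a ≠ 0) :
    ∃ C : DifferentialCalculus ℂ A, C.HasDimension N ∧ C.IsConnected ∧ C.IsIntegrable N := by
  refine QuantumAffineSpace.exists_calculus (c := fun a b => (g b a / g a b : ℂ)) hN
    (h.of_generatorSpan_eq (QuantumAffineSpace.holds_iff.2 fun a b hab => ?_) rfl)
    fun a b hab => div_ne_zero ?_ ?_
  · exact mul_rel h hab (hx a) (hx b)
  · exact_mod_cast hg' a b hab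
  · exact_mod_cast hg a b hab

theorem diffS_eq_diffR (hS : (diffS g x).ncard = N - (diffI x).ncard) : diffS g x = diffR x := by
  refine Set.eq_of_subset_of_ncard_le (fun s hs => hs.1) ?_
  have h1 : diffR x = (diffI x)ᶜ := by
    ext a
    simp [diffR, diffI]
  rw [hS, h1, Set.ncard_compl, Nat.card_eq_fintype_card, Fintype.card_fin]

/-- The case of three or more indices with nonzero parameter. -/
theorem exists_calculus_of_three_le
    (h : IsPBW (straightening g x) D) (hg : ∀ a b, a < b → g a b ≠ 0)
    (hI : 3 ≤ (diffI x).ncard) (hS : diffS g x = diffR x) :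
    ∃ C : DifferentialCalculus ℂ A, C.HasDimension N ∧ C.IsConnected ∧ C.IsIntegrable N := by
  rcases coeff_const_or_additive h hg hI with ⟨G, hG, hconst⟩ | ⟨hzero, hadd⟩
  · obtain ⟨i, j, hi, hj, hij⟩ := (Set.one_lt_ncard_iff).1 (by omega : 1 < (diffI x).ncard)
    exact exists_calculus_of_const h hg hij hi hj hG hconst hS
  · -- a link would force vanishing coefficients, so that all parameters are nonzero
    have hx : ∀ a, x a ≠ 0 := by
      by_contra! hex
      obtain ⟨a, ha⟩ := hex
      have haS : a ∈ diffS g x := by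
        rw [hS]
        exact ha
      obtain ⟨-, r, hr, -, i, hi, hl⟩ := haS
      obtain ⟨j, hj, hji⟩ := Set.exists_ne_of_one_lt_ncard (by omega : 1 < (diffI x).ncard) i
      obtain ⟨k, hk, hkij⟩ := Set.exists_mem_notMem_of_ncard_lt_ncard
        (s := {i, j}) (t := diffI x) (by rw [Set.ncard_pair hji.symm]; omega)
      simp only [Set.mem_insert_iff, Set.mem_singleton_iff, not_or] at hkij
      have h1 := coeff_eq_of_link_of_three h hg hi hj hk hji.symm (Ne.symm hkij.1)
        (Ne.symm hkij.2) hr hl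
      rcases lt_or_gt_of_ne hji with hlt | hlt
      · exact hg j i hlt (h1.symm.trans (hzero j i hj hi hlt))
      · exact hg i j hlt (h1.trans (hzero i j hi hj hlt))
    have hN : 1 ≤ N := by
      obtain ⟨i, -⟩ := (Set.one_lt_ncard_iff).1 (by omega : 1 < (diffI x).ncard)
      exact Nat.one_le_iff_ne_zero.2 fun h0 => by subst h0; exact i.elim0
    exact exists_calculus_of_additive h hg hN hx (fun a b => hzero a b (hx a) (hx b))
      fun a b c => hadd a b c (hx a) (hx b) (hx c)

end DiffusionAlgebra

end

/-! ### Differential smoothness -/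

theorem mainTheorem1 (N : ℕ) (hN : 3 ≤ N) (g : Fin N → Fin N → ℝ) (x : Fin N → ℂ)
    (hD : IsDiffusionAlgebra g x)
    (hcases :
      (∃ L : ℕ, 3 ≤ L ∧ L ≤ N ∧ (diffI x).ncard = L ∧ (diffS g x).ncard = N - L) ∨
      (∃ (i : Fin N) (G : ℝ), diffI x = {i} ∧ (diffS g x).ncard = N - 1 ∧ G ≠ 0 ∧
        ∀ s ∈ diffS g x, g i s = G ∧ G ≠ g i s - g s i) ∨
      (∃ (i j : Fin N) (G : ℝ), i < j ∧ diffI x = {i, j} ∧ (diffS g x).ncard = N - 2 ∧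
        G ≠ 0 ∧ G ≠ g i j - g j i ∧ ∀ s ∈ diffS g x, g i s = G) ∨
      (diffI x = ∅ ∧ ∀ α β : Fin N, α < β → g β α ≠ 0)) :
    gkDim ℂ (DiffusionAlgebra g x) = (N : EReal) ∧
      DifferentiallySmooth ℂ (DiffusionAlgebra g x) := by
  have hg := hD.1
  have h := DiffusionAlgebra.isPBW_gen hD
  have hN1 : 1 ≤ N := by omega
  refine ⟨h.gkDim_eq hN1, h.differentiallySmooth hN1 ?_⟩
  rcases hcases with ⟨L, hL, -, hI, hS⟩ | ⟨i, G, hI, hS, hG, hs⟩ |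
    ⟨i, j, G, hij, hI, hS, hG, hGL, hs⟩ | ⟨hI, hg'⟩
  · exact DiffusionAlgebra.exists_calculus_of_three_le h hg (by omega)
      (DiffusionAlgebra.diffS_eq_diffR (by rw [hS, hI]))
  · have hSR := DiffusionAlgebra.diffS_eq_diffR (g := g) (x := x)
      (by rw [hS, hI, Set.ncard_singleton])
    have hi : x i ≠ 0 := by
      change i ∈ diffI x
      simp [hI]
    have hx : ∀ s, s ≠ i → x s = 0 := fun s hsi => by
      by_contra hxs
      have : s ∈ diffI x := hxs
      rw [hI] at this
      exact hsi this
    refine DiffusionAlgebra.exists_calculus_of_single h hg hi hx hG fun s hsi => ?_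
    have hsS : s ∈ diffS g x := by
      rw [hSR]
      exact hx s hsi
    obtain ⟨h1, h2⟩ := hs s hsS
    exact ⟨h1, fun h0 => h2 (by rw [h0, sub_zero, h1])⟩
  · have hSR := DiffusionAlgebra.diffS_eq_diffR (g := g) (x := x)
      (by rw [hS, hI, Set.ncard_pair hij.ne])
    have hi : x i ≠ 0 := by
      change i ∈ diffI x
      simp [hI]
    have hj : x j ≠ 0 := by
      change j ∈ diffI x
      simp [hI]
    have hx : ∀ s, x s ≠ 0 → s = i ∨ s = j := fun s hxs => by
      have : s ∈ diffI x := hxs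
      rw [hI] at this
      exact this
    have hx' : ∀ s, s ≠ i → s ≠ j → x s = 0 := fun s hsi hsj => by
      by_contra hxs
      exact (hx s hxs).elim hsi hsj
    -- for `g i j = g j i` the coefficients are constant, as in the case of three or more indices
    by_cases hL : g i j - g j i = 0
    · rw [sub_eq_zero] at hL
      refine DiffusionAlgebra.exists_calculus_of_const h hg hij.ne hi hj (hg i j hij)
        (fun a b ha hb hab => ?_) hSR
      rcases hx a ha with rfl | rfl <;> rcases hx b hb with rfl | rfl
      · exact absurd rfl hab
      · rfl
      · exact hL.symm
      · exact absurd rfl hab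
    · refine DiffusionAlgebra.exists_calculus_of_pair h hg hij hi hj hx' hG hL hGL rfl
        fun s hsi hsj => ?_
      have hsS : s ∈ diffS g x := by
        rw [hSR]
        exact hx' s hsi hsj
      exact ⟨hs s hsS, DiffusionAlgebra.coeff_eq_of_mem_diffS h hg hij.ne hi hj hI hG hGL hs hsS⟩
  · refine DiffusionAlgebra.exists_calculus_of_eq_zero h hN1 (fun a => ?_) hg hg'
    by_contra ha
    have : a ∈ diffI x := ha
    rw [hI] at this
    exact this
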